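/- Let $\sigma$ be arc length measure on $\mathbb{S}^1\subset\mathbb{R}^2$, and for $g\in L^2(\mathbb{S}^1)$ let $\widehat{gd\sigma}(x)=\int_{\mathbb{S}^1}e^{ix\cdot\xi}g(\xi)\,d\sigma(\xi)$, $x\in\mathbb{R}^2$. For $\omega\in\mathbb{S}^1$ and $v\in\langle\omega\rangle^\perp$ let $Xf(\omega,v)=\int_{\mathbb{R}}f(v+s\omega)\,ds$ be the X-ray transform, and let $(-\Delta_v)^{s}$ be the fractional Laplacian on the line $\langle\omega\rangle^\perp\cong\mathbb{R}$, i.e. the Fourier multiplier with symbol $|\eta|^{2s}$, understood in the sense of distributions. Write $L^p_\omega L^r_v$ for the mixed norms with respect to $d\sigma(\omega)$ and Lebesgue measure on $\langle\omega\rangle^\perp$, and put $\|(-\Delta_v)^su\|_{L^r_v}=\infty$ if $(-\Delta_v)^su$ is not defined or not a function in $L^r_v$. Let $B_R$ be the ball of radius $R$ about $0$. Let $\gamma_R(x)=\psi(x/R)^3$, where $\psi$ is a nonnegative, radially decreasing Schwartz function on $\mathbb{R}^2$ whose Fourier transform $\int\psi(x)e^{-ix\cdot\xi}dx$ is supported in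 the closed unit ball. A weight is a function $w\ge 0$ on $\mathbb{R}^2$ such that $x\mapsto w(x)/(1+|x|)$ is Lebesgue integrable (equivalently, $Xw$ is locally integrable on the space of lines). **Theorem.** Let $1\le q\le 2$, $\frac1q+\frac1{q'}=1$, and $\varepsilon>0$. (i) There is a constant $C=C(\psi,q,\varepsilon)$ such that for all $R\ge1$ and all $g\in L^2(\mathbb{S}^1)$, $$\big\|(-\Delta_v)^{\frac12(1-\frac1q)}X(\gamma_R|\widehat{gd\sigma}|^2)\big\|_{L^1_\omega L^{q'}_v}\le C R^\varepsilon\|g\|_{L^2(\mathbb{S}^1)}^2 .$$ (ii) There is a constant $C=C(q,\varepsilon)$ such that for all $R\ge1$, all $g\in L^2(\mathbb{S}^1)$ and all weights $w$, $$\int_{B_R}|\widehat{gd\sigma}|^2w\le C R^\varepsilon\big\|(-\Delta_v)^{\frac1{2q}}Xw\big\|_{L^\infty_\omega L^q_v}\|g\|_{L^2(\mathbb{S}^1)}^2 .$$ (iii) There is a constant $C=C(\psi)$ such that for all $R\ge2$ and all $g\in L^2(\mathbb{S}^1)$, $$\big\|(-\Delta_v)^{\frac14}X(\gamma_R|\widehat{gd\sigma}|^2)\big\|_{L^1_\omega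 L^2_v}\le C\log R\,\|g\|_{L^2(\mathbb{S}^1)}^2 .$$ (iv) There is an absolute constant $C$ such that for all $R\ge2$, all $g\in L^2(\mathbb{S}^1)$ and all weights $w$, $$\int_{B_R}|\widehat{gd\sigma}|^2w\le C\log R\,\big\|(-\Delta_v)^{\frac14}Xw\big\|_{L^\infty_\omega L^2_v}\|g\|_{L^2(\mathbb{S}^1)}^2 .$$ (In (ii) and (iv) the right-hand side is read as $0$ if $\|g\|_{L^2(\mathbb{S}^1)}=0$.) -/

import Mathlib

open MeasureTheory
open scoped ENNReal NNReal FourierTransform SchwartzMap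

noncomputable section

namespace MizohataTakeuchi

/-- The Euclidean plane. -/
abbrev Plane : Type := EuclideanSpace ℝ (Fin 2)

/-- The unit circle in the plane. -/
abbrev UnitCircle : Type := Metric.sphere (0 : Plane) 1

/-- Surface (arc length) measure on the unit circle; its total mass is `2π`. -/
def surf : Measure UnitCircle := (volume : Measure Plane).toSphere

/-- The Fourier extension operator: `x ↦ ∫ exp (i x·ξ) g(ξ) dσ(ξ)`. -/
def extension (g : UnitCircle → ℂ) (x : Plane) : ℂ :=
  ∫ ξ : UnitCircle, Complex.exp (Complex.I * ((inner ℝ x (ξ : Plane) : ℝ) : ℂ)) * g ξ ∂surf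

/-- Rotation by a right angle. For a unit vector `ω`, the map `t ↦ t • perp ω` is an isometric
parametrisation of the orthogonal complement of `ω`. -/
def perp (ω : Plane) : Plane := !₂[-(ω 1), ω 0]

/-- The X-ray transform: the integral of `f` over the line through `v = t • perp ω` in the
direction `ω`. -/
def xray (f : Plane → ℝ) (ω : UnitCircle) (t : ℝ) : ℝ :=
  ∫ s : ℝ, f (t • perp (ω : Plane) + s • (ω : Plane))

/-- `(-Δ)^s φ` for a Schwartz function `φ` on the line: the Fourier multiplier operator with
symbol `|η|^(2s)` in angular frequency. Mathlib's Fourier transform has the kernel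
`exp (-2π i v η)`, so that its frequency variable has to be multiplied by `2π`. -/
def fracLapSchwartz (s : ℝ) (φ : 𝓢(ℝ, ℂ)) : ℝ → ℂ :=
  𝓕⁻ (fun η : ℝ => (((|2 * Real.pi * η| ^ (2 * s) : ℝ)) : ℂ) * 𝓕 (φ : ℝ → ℂ) η)

/-- `(-Δ)^s u = h` on the line in the sense of distributions (for `s ≥ 0`).

Since `(-Δ)^s φ` decays like `(1 + |v|)^(-1 - 2s)` for a Schwartz function `φ`, the pairing of `u`
with `(-Δ)^s φ` makes sense when `u` is integrable against that weight; this is the usual domain of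
the distributional fractional Laplacian. -/
structure IsFracLap (s : ℝ) (u h : ℝ → ℝ) : Prop where
  integrable : Integrable (fun v : ℝ => u v * (1 + |v|) ^ (-(1 + 2 * s)))
  pairing : ∀ φ : 𝓢(ℝ, ℂ),
    ∫ v : ℝ, (u v : ℂ) * fracLapSchwartz s φ v = ∫ v : ℝ, (h v : ℂ) * φ v

/-- `‖(-Δ)^s u‖_{L^p(ℝ)}`, with the value `∞` if the distribution `(-Δ)^s u` is not defined or is
not given by a function in `L^p`. The function `h` in the infimum is unique almost everywhere. -/
def fracLapNorm (s : ℝ) (p : ℝ≥0∞) (u : ℝ → ℝ) : ℝ≥0∞ :=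
  ⨅ (h : ℝ → ℝ) (_ : MemLp h p ∧ IsFracLap s u h), eLpNorm h p

/-- `‖(-Δ_v)^s X f‖_{L^1_ω L^p_v}`. -/
def xrayNormOne (s : ℝ) (p : ℝ≥0∞) (f : Plane → ℝ) : ℝ≥0∞ :=
  ∫⁻ ω : UnitCircle, fracLapNorm s p (xray f ω) ∂surf

/-- `‖(-Δ_v)^s X f‖_{L^∞_ω L^p_v}`. -/
def xrayNormTop (s : ℝ) (p : ℝ≥0∞) (f : Plane → ℝ) : ℝ≥0∞ :=
  essSup (fun ω : UnitCircle => fracLapNorm s p (xray f ω)) surf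

/-- A nonnegative, radial and radially decreasing Schwartz function on the plane, whose Fourier
transform (with kernel `exp (-i x·ξ)`) is supported in the closed unit ball. -/
structure IsProfile (ψ : 𝓢(Plane, ℝ)) : Prop where
  nonneg : ∀ x, 0 ≤ ψ x
  radially_decreasing : ∀ x y, ‖x‖ ≤ ‖y‖ → ψ y ≤ ψ x
  fourier_support : ∀ ξ : Plane, 1 < ‖ξ‖ →
    ∫ x : Plane, Complex.exp (-(Complex.I * ((inner ℝ x ξ : ℝ) : ℂ))) * ((ψ x : ℝ) : ℂ) = 0

/-- The cutoff `γ_R(x) = ψ(x/R)^3`, adapted to the ball of radius `R`. -/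
def cutoff (ψ : 𝓢(Plane, ℝ)) (R : ℝ) (x : Plane) : ℝ := ψ (R⁻¹ • x) ^ 3

/-- The function `γ_R |extension g|^2`. -/
def truncatedSq (ψ : 𝓢(Plane, ℝ)) (R : ℝ) (g : UnitCircle → ℂ) (x : Plane) : ℝ :=
  cutoff ψ R x * ‖extension g x‖ ^ 2

/-- A weight on the plane: a nonnegative function with `∫ w(x) / (1 + |x|) dx < ∞`. By polar
coordinates this finiteness says exactly that the X-ray transform of `w` is locally integrable on
the manifold of lines, so that `(-Δ_v)^s` can be applied to it. -/
structure IsWeight (w : Plane → ℝ) : Prop where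
  nonneg : ∀ x, 0 ≤ w x
  integrable : Integrable (fun x : Plane => w x / (1 + ‖x‖))

/-- `∫_{B_R} |extension g|^2 w`. -/
def weightedMass (R : ℝ) (g : UnitCircle → ℂ) (w : Plane → ℝ) : ℝ≥0∞ :=
  ∫⁻ x in Metric.ball (0 : Plane) R, ENNReal.ofReal (‖extension g x‖ ^ 2 * w x)

end MizohataTakeuchi

end

open MeasureTheory
open scoped ENNReal NNReal FourierTransform SchwartzMap

noncomputable section

namespace MizohataTakeuchi

/-! Write `κ = 1 / R` and `P = γ_R |extension g| ^ 2`. By the Fourier slice theorem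
(`fourier_lineIntegral`) the Fourier transform of `X P(ω, ·)` is the restriction of that of `P` to
the line spanned by `perp ω`. The transform of `P` is the correlation of `g dσ` with itself, smeared
by a kernel of height `O(R ^ 2)` living on a ball of radius `3 κ`. In modulus it is at most `O(R ^
2)` times `pairSum κ |g|` (`enorm_fourier_truncSchwartz_le`).

All exponents are handled by one norm. If a function on the line has frequencies in `|η| ≤ δ`,
Bernstein's inequality loses `δ ^ (1/2 - 1/p)` in passing from `L^2` to `L^p`, while the symbol `|η|
^ (1/p)` costs `δ ^ (1/p)`. The product is `δ ^ (1/2)` for every `p ≥ 2`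
(`eLpNorm_fourierInv_band_le`). Summing over dyadic bands bounds the `L^p` norm of `(-Δ) ^ (1/(2p))
X P` by `besovNorm`, uniformly in `p`. Here `p = q'`.

It remains to integrate the contribution of each frequency shell over `ω`. Every shell contributes
`O(κ ^ 2) ‖g‖ ^ 2`, which cancels the factor `R ^ 2`, and there are `O(1 + log R)` shells
(`lintegral_besovNorm_pairSum_le`). Besides the dyadic shells `|t| ~ δ`, the region near the
diameter `|t| = 2` is cut according to the size of `2 - |t|`. For `|t| ≤ √κ` a Schur bound suffices
(`shell_estimate_of_sup`). Otherwise Cauchy–Schwarz, the transversality of the circle to its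
translate, and a linearisation of the square root with an `ω`-dependent parameter are used
(`shell_estimate`). Polar coordinates then turn the integral over `ω` and `t` into a planar
integral.

The weighted inequalities are dual to this. Polar coordinates on the Fourier side write `∫ w P` as
an average over `ω` of pairings of `Xw` with `(-Δ) ^ (1/2) X P`. The derivative is shared as `2 s +
1/p = 1` between the two factors and Hölder's inequality applies. The symbols are not smooth at
frequency zero, so small frequencies are removed first. Their contribution tends to zero because `w
/ (1 + |x|)` is integrable (`enorm_integral_weight_mul_le`). -/

/-! ### Coordinates adapted to a direction -/

theorem inner_eq_coords (x y : Plane) : inner ℝ x y = x 0 * y 0 + x 1 * y 1 := by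
  simp [PiLp.inner_apply, Fin.sum_univ_two]; ring

theorem norm_sq_eq_coords (x : Plane) : ‖x‖ ^ 2 = x 0 ^ 2 + x 1 ^ 2 := by
  rw [← real_inner_self_eq_norm_sq, inner_eq_coords]; ring

@[simp] theorem perp_zero_coord (x : Plane) : perp x 0 = -x 1 := rfl

@[simp] theorem perp_one_coord (x : Plane) : perp x 1 = x 0 := rfl

theorem inner_perp_self (x : Plane) : inner ℝ (perp x) x = 0 := by
  rw [inner_eq_coords]; simp; ring

theorem inner_perp_left (x y : Plane) : inner ℝ (perp x) y = -inner ℝ x (perp y) := by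
  simp only [inner_eq_coords, perp_zero_coord, perp_one_coord]; ring

theorem norm_perp (x : Plane) : ‖perp x‖ = ‖x‖ := by
  rw [← sq_eq_sq₀ (norm_nonneg _) (norm_nonneg _), norm_sq_eq_coords, norm_sq_eq_coords]
  simp; ring

theorem norm_coe (ω : UnitCircle) : ‖(ω : Plane)‖ = 1 := by
  simp

theorem norm_perp_coe (ω : UnitCircle) : ‖perp (ω : Plane)‖ = 1 := by
  rw [norm_perp, norm_coe]

/-- Rotation by a right angle, as a linear isometry. -/
def perpIsometry : Plane ≃ₗᵢ[ℝ] Plane :=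
  LinearIsometry.toLinearIsometryEquiv
    { toFun := perp
      map_add' := fun x y => by ext i; fin_cases i <;> simp [perp]; ring
      map_smul' := fun c x => by ext i; fin_cases i <;> simp [perp]
      norm_map' := norm_perp } rfl

@[simp] theorem perpIsometry_apply (x : Plane) : perpIsometry x = perp x := rfl

theorem continuous_perp : Continuous perp := perpIsometry.continuous

theorem perp_smul (c : ℝ) (x : Plane) : perp (c • x) = c • perp x := perpIsometry.map_smul c x

/-- The isometry of the plane with `(v, s) ↦ v • perp ω + s • ω`. -/
def frame (ω : UnitCircle) : Plane ≃ₗᵢ[ℝ] Plane :=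
  LinearIsometry.toLinearIsometryEquiv
    { toFun := fun x => x 0 • perp (ω : Plane) + x 1 • (ω : Plane)
      map_add' := fun x y => by simp [add_smul]; abel
      map_smul' := fun c x => by simp [mul_smul]
      norm_map' := fun x => by
        have h : ((ω : Plane) 0) ^ 2 + ((ω : Plane) 1) ^ 2 = 1 := by
          rw [← norm_sq_eq_coords, norm_coe]; norm_num
        change ‖x 0 • perp (ω : Plane) + x 1 • (ω : Plane)‖ = ‖x‖
        rw [← sq_eq_sq₀ (norm_nonneg _) (norm_nonneg _), norm_sq_eq_coords, norm_sq_eq_coords]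
        simp
        linear_combination (x 0 ^ 2 + x 1 ^ 2) * h } rfl

/-- The parametrisation of the plane by the lines in the direction `ω`. -/
def lineCoords (ω : UnitCircle) : ℝ × ℝ ≃ᵐ Plane :=
  (MeasurableEquiv.finTwoArrow.symm.trans (MeasurableEquiv.toLp 2 (Fin 2 → ℝ))).trans
    (frame ω).toHomeomorph.toMeasurableEquiv

theorem lineCoords_apply (ω : UnitCircle) (p : ℝ × ℝ) :
    lineCoords ω p = p.1 • perp (ω : Plane) + p.2 • (ω : Plane) := rfl

theorem measurePreserving_lineCoords (ω : UnitCircle) :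
    MeasurePreserving (lineCoords ω) (volume : Measure (ℝ × ℝ)) (volume : Measure Plane) := by
  refine MeasurePreserving.trans (MeasurePreserving.trans (volume_preserving_finTwoArrow ℝ).symm
    (EuclideanSpace.volume_preserving_symm_measurableEquiv_toLp (Fin 2)).symm) ?_
  exact (frame ω).measurePreserving

theorem integral_lineCoords (ω : UnitCircle) (f : Plane → ℂ) (hf : Integrable f) :
    ∫ x, f x = ∫ v : ℝ, ∫ s : ℝ, f (v • perp (ω : Plane) + s • (ω : Plane)) := by
  rw [← (measurePreserving_lineCoords ω).integral_comp' f, Measure.volume_eq_prod, integral_prod]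
  · rfl
  · exact ((measurePreserving_lineCoords ω).integrable_comp_emb
      (lineCoords ω).measurableEmbedding).2 hf

/-! ### Polar coordinates along lines through the origin -/

instance : IsFiniteMeasure surf := by unfold surf; infer_instance

theorem lintegral_polar (f : Plane → ℝ≥0∞) (hf : Measurable f) :
    ∫⁻ x, f x = ∫⁻ ω : UnitCircle, (∫⁻ t in Set.Ioi (0 : ℝ),
      ENNReal.ofReal t * f (t • (ω : Plane))) ∂surf := by
  have h := (volume : Measure Plane).measurePreserving_homeomorphUnitSphereProd
  have hd : Module.finrank ℝ Plane = 2 := by simp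
  rw [hd] at h
  have h1 := h.lintegral_comp_emb (Homeomorph.measurableEmbedding _)
    (fun q : UnitCircle × Set.Ioi (0 : ℝ) => f ((q.2 : ℝ) • (q.1 : Plane)))
  have h2 : ∀ a : ({0}ᶜ : Set Plane), f (((homeomorphUnitSphereProd Plane a).2 : ℝ) •
      ((homeomorphUnitSphereProd Plane a).1 : Plane)) = f a := by
    intro a
    have ha : ‖(a : Plane)‖ ≠ 0 := norm_ne_zero_iff.2 a.2
    simp [smul_smul, ha]
  simp only [h2] at h1
  rw [lintegral_subtype_comap (measurableSet_singleton _).compl,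
    restrict_compl_singleton] at h1
  rw [h1, lintegral_prod]
  · refine lintegral_congr fun ω => ?_
    rw [Measure.volumeIoiPow, lintegral_withDensity_eq_lintegral_mul _ (by fun_prop) (by fun_prop)]
    rw [← lintegral_subtype_comap measurableSet_Ioi]
    simp
  · fun_prop

/-- Polar coordinates with signed radius. -/
theorem lintegral_polar_line (f : Plane → ℝ≥0∞) (hf : Measurable f) :
    ∫⁻ ω : UnitCircle, (∫⁻ t : ℝ, ENNReal.ofReal |t| * f (t • perp (ω : Plane))) ∂surf
      = 2 * ∫⁻ x, f x := by
  have key : ∀ ω : UnitCircle, ∫⁻ t : ℝ, ENNReal.ofReal |t| * f (t • perp (ω : Plane)) =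
      -- The negative half-line is reflected onto the positive one. Each half covers the plane once,
      -- which gives the factor 2.
      (∫⁻ t in Set.Ioi (0 : ℝ), ENNReal.ofReal t * f (perp (t • (ω : Plane)))) +
      ∫⁻ t in Set.Ioi (0 : ℝ), ENNReal.ofReal t * f (-perp (t • (ω : Plane))) := by
    intro ω
    rw [← setLIntegral_univ, ← Set.Iic_union_Ioi (a := (0 : ℝ)), lintegral_union measurableSet_Ioi
      (Set.Iic_disjoint_Ioi le_rfl), add_comm]
    congr 1
    · refine setLIntegral_congr_fun measurableSet_Ioi fun t ht => ?_
      simp only [perp_smul, abs_of_pos (Set.mem_Ioi.1 ht)]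
    · rw [setLIntegral_congr Iio_ae_eq_Iic.symm]
      have := (Measure.measurePreserving_neg (volume : Measure ℝ)).setLIntegral_comp_preimage_emb
        (MeasurableEquiv.neg ℝ).measurableEmbedding
        (fun t => ENNReal.ofReal |t| * f (t • perp (ω : Plane))) (Set.Iio 0)
      rw [← this]
      simp only [Set.neg_preimage, Set.neg_Iio, neg_zero]
      refine setLIntegral_congr_fun measurableSet_Ioi fun t ht => ?_
      simp only [perp_smul, abs_neg, abs_of_pos (Set.mem_Ioi.1 ht), neg_smul]
  simp only [key]
  have mp := continuous_perp.measurable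
  rw [lintegral_add_left, ← lintegral_polar (fun x => f (perp x)) (by fun_prop),
    ← lintegral_polar (fun x => f (-perp x)) (by fun_prop), two_mul]
  · congr 1
    · exact perpIsometry.measurePreserving.lintegral_comp hf
    · exact (perpIsometry.trans (LinearIsometryEquiv.neg ℝ)).measurePreserving.lintegral_comp hf
  · refine Measurable.lintegral_prod_right' (f := fun q : UnitCircle × ℝ =>
      ENNReal.ofReal q.2 * f (perp (q.2 • (q.1 : Plane)))) ?_
    fun_prop

theorem map_polar_line :
    Measure.map (fun q : UnitCircle × ℝ => q.2 • perp (q.1 : Plane))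
      (surf.prod ((volume : Measure ℝ).withDensity fun t => ENNReal.ofReal |t|))
      = (2 : ℝ≥0∞) • (volume : Measure Plane) := by
  have mp := continuous_perp.measurable
  have hm : Measurable (fun q : UnitCircle × ℝ => q.2 • perp (q.1 : Plane)) := by fun_prop
  ext s hs
  rw [Measure.map_apply hm hs, Measure.prod_apply (hm hs), Measure.smul_apply, smul_eq_mul,
    ← lintegral_indicator_one hs, ← lintegral_polar_line _ (measurable_one.indicator hs)]
  refine lintegral_congr fun ω => ?_
  have hms : MeasurableSet (Prod.mk ω ⁻¹' ((fun q : UnitCircle × ℝ => q.2 • perp (q.1 : Plane)) ⁻¹' s)) :=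
    measurable_prodMk_left (hm hs)
  rw [withDensity_apply _ hms, ← lintegral_indicator hms]
  refine lintegral_congr fun t => ?_
  by_cases h : t • perp (ω : Plane) ∈ s <;> simp [Set.indicator, h]

/-- Polar coordinates with signed radius, for Bochner integrals. -/
theorem integral_polar_line (f : Plane → ℂ) (hf : Integrable f) :
    ∫ ω : UnitCircle, (∫ t : ℝ, ((|t| : ℝ) : ℂ) * f (t • perp (ω : Plane))) ∂surf = 2 * ∫ x, f x := by
  have mp := continuous_perp.measurable
  have hm : Measurable (fun q : UnitCircle × ℝ => q.2 • perp (q.1 : Plane)) := by fun_prop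
  have hf2 : Integrable f ((2 : ℝ≥0∞) • (volume : Measure Plane)) := hf.smul_measure (by simp)
  have h2 : ∫ x, f x ∂((2 : ℝ≥0∞) • (volume : Measure Plane)) = 2 * ∫ x, f x := by
    rw [integral_smul_measure]; simp
  rw [← map_polar_line] at hf2 h2
  rw [← h2, integral_map hm.aemeasurable hf2.1, integral_prod]
  · refine integral_congr_ae (.of_forall fun ω => ?_)
    simp only
    rw [integral_withDensity_eq_integral_toReal_smul (by fun_prop) (by simp)]
    simp
  · exact (integrable_map_measure hf2.1 hm.aemeasurable).1 hf2

/-! ### Arc length of strips and caps -/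

theorem coords_of_frame (e : UnitCircle) (v s : ℝ) :
    inner ℝ (e : Plane) (v • perp (e : Plane) + s • (e : Plane)) = s ∧
    inner ℝ (perp (e : Plane)) (v • perp (e : Plane) + s • (e : Plane)) = v := by
  have h1 : inner ℝ (e : Plane) (e : Plane) = 1 := by
    rw [real_inner_self_eq_norm_sq, norm_coe]; norm_num
  have h2 : inner ℝ (perp (e : Plane)) (perp (e : Plane)) = 1 := by
    rw [real_inner_self_eq_norm_sq, norm_perp_coe]; norm_num
  have h3 := inner_perp_self (e : Plane)
  have h4 : inner ℝ (e : Plane) (perp (e : Plane)) = 0 := by rw [real_inner_comm, h3]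
  constructor <;> rw [inner_add_right, inner_smul_right, inner_smul_right]
  · rw [h1, h4]; ring
  · rw [h2, h3]; ring

theorem exists_coords (e : UnitCircle) (x : Plane) :
    x = (inner ℝ (perp (e : Plane)) x : ℝ) • perp (e : Plane) + (inner ℝ (e : Plane) x : ℝ) • (e : Plane) := by
  obtain ⟨q, rfl⟩ := (lineCoords e).surjective x
  rw [lineCoords_apply, (coords_of_frame e q.1 q.2).1, (coords_of_frame e q.1 q.2).2]

theorem norm_sq_frame (e : UnitCircle) (x : Plane) :
    ‖x‖ ^ 2 = (inner ℝ (perp (e : Plane)) x : ℝ) ^ 2 + (inner ℝ (e : Plane) x : ℝ) ^ 2 := by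
  have h := exists_coords e x
  have h1 : ‖x‖ ^ 2 = inner ℝ x x := (real_inner_self_eq_norm_sq x).symm
  nth_rw 2 [h] at h1
  rw [h1, inner_add_left, real_inner_smul_left, real_inner_smul_left]
  ring

open scoped Pointwise in
/-- The part of the circle in a strip about a line through the origin. -/
theorem surf_strip_le (e : UnitCircle) (h : ℝ) :
    surf {a : UnitCircle | |inner ℝ (e : Plane) (a : Plane)| ≤ h} ≤ ENNReal.ofReal (8 * h) := by
  rcases lt_or_ge h 0 with hneg | hpos
  · have : {a : UnitCircle | |inner ℝ (e : Plane) (a : Plane)| ≤ h} = ∅ := by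
      ext a; simpa using hneg.trans_le (abs_nonneg _)
    simp [this]
  have hs : MeasurableSet {a : UnitCircle | |inner ℝ (e : Plane) (a : Plane)| ≤ h} :=
    measurableSet_le (by fun_prop) (by fun_prop)
  have hd : Module.finrank ℝ Plane = 2 := by simp
  rw [surf, Measure.toSphere_apply' _ hs, hd]
  -- `surf` is twice the area of the cone over a set, and the cone over the strip lies in a `2 × 2h`
  -- rectangle.
  have hsub : Set.Ioo (0 : ℝ) 1 • (Subtype.val '' {a : UnitCircle | |inner ℝ (e : Plane) (a : Plane)| ≤ h})
      ⊆ lineCoords e '' (Set.Icc (-1) 1 ×ˢ Set.Icc (-h) h) := by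
    rintro _ ⟨c, hc, _, ⟨a, ha, rfl⟩, rfl⟩
    refine ⟨(inner ℝ (perp (e : Plane)) (c • (a : Plane)), inner ℝ (e : Plane) (c • (a : Plane))),
      ?_, (exists_coords e _).symm⟩
    have h1 : |inner ℝ (perp (e : Plane)) (a : Plane)| ≤ 1 := by
      simpa [norm_coe, norm_perp_coe] using abs_real_inner_le_norm (perp (e : Plane)) (a : Plane)
    simp only [Set.mem_ofPred_eq] at ha
    have aux : ∀ y b : ℝ, |y| ≤ b → 0 ≤ b → c * y ∈ Set.Icc (-b) b := by
      intro y b hy hb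
      rw [Set.mem_Icc, ← abs_le, abs_mul, abs_of_pos hc.1]
      nlinarith [hc.1, hc.2, abs_nonneg y]
    simp only [inner_smul_right]
    exact ⟨aux _ _ h1 zero_le_one, aux _ _ ha hpos⟩
  have hvol : (volume : Measure Plane) (lineCoords e '' (Set.Icc (-1) 1 ×ˢ Set.Icc (-h) h))
      = ENNReal.ofReal (4 * h) := by
    rw [← (measurePreserving_lineCoords e).measure_preimage_equiv,
      (lineCoords e).injective.preimage_image, Measure.volume_eq_prod, Measure.prod_prod,
      Real.volume_Icc, Real.volume_Icc, ← ENNReal.ofReal_mul (by norm_num)]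
    congr 1; ring
  calc _ ≤ ((2 : ℕ) : ℝ≥0∞) * ENNReal.ofReal (4 * h) := by
        rw [← hvol]; gcongr
    _ = ENNReal.ofReal (8 * h) := by
        rw [show (8 * h) = 2 * (4 * h) by ring, ENNReal.ofReal_mul (p := 2) (by norm_num)]; simp

/-- The unit vector `perp e`, as a point of the circle. -/
def perpCircle (e : UnitCircle) : UnitCircle := ⟨perp (e : Plane), by simp [norm_perp]⟩

@[simp] theorem coe_perpCircle (e : UnitCircle) : (perpCircle e : Plane) = perp (e : Plane) := rfl

theorem surf_strip_perp_le (e : UnitCircle) (h : ℝ) :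
    surf {a : UnitCircle | |inner ℝ (perp (a : Plane)) (e : Plane)| ≤ h} ≤ ENNReal.ofReal (8 * h) := by
  refine le_trans (measure_mono fun a ha => ?_) (surf_strip_le (perpCircle e) h)
  simp only [Set.mem_ofPred_eq] at ha
  rw [inner_perp_left, abs_neg, real_inner_comm] at ha
  exact ha

/-- Length of a cap with arbitrary centre. -/
theorem surf_cap_le (x : Plane) (r : ℝ) :
    surf {b : UnitCircle | ‖(b : Plane) - x‖ ≤ r} ≤ ENNReal.ofReal (16 * r) := by
  -- The given centre may lie off the circle. Recentring at a point `c` of the cap doubles the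
  -- radius, and the component along the tangent at `c` then confines the cap to a strip.
  rcases Set.eq_empty_or_nonempty {b : UnitCircle | ‖(b : Plane) - x‖ ≤ r} with h | ⟨c, hc⟩
  · simp [h]
  refine le_trans (measure_mono fun a ha => ?_)
    ((surf_strip_le (perpCircle c) (2 * r)).trans_eq (by congr 1; ring))
  simp only [Set.mem_ofPred_eq, coe_perpCircle] at ha hc ⊢
  have h1 : inner ℝ (perp (c : Plane)) (a : Plane) = inner ℝ (perp (c : Plane)) ((a : Plane) - c) := by
    rw [inner_sub_right, inner_perp_self, sub_zero]
  have h2 : ‖(a : Plane) - c‖ ≤ 2 * r := by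
    calc ‖(a : Plane) - c‖ = ‖((a : Plane) - x) - (c - x)‖ := by congr 1; abel
      _ ≤ _ := norm_sub_le _ _
      _ ≤ _ := by linarith
  rw [h1]
  refine (abs_real_inner_le_norm _ _).trans ?_
  rwa [norm_perp_coe, one_mul]

/-- The part of the circle in a strip at height `t < 1`. -/
theorem surf_offset_strip_le (e : UnitCircle) (t h m : ℝ) (ht0 : 0 ≤ t) (hm : 0 < m)
    (hm1 : m ≤ 1) (ht : m ^ 2 ≤ 1 - t ^ 2) :
    surf {a : UnitCircle | |inner ℝ (e : Plane) (a : Plane) - t| ≤ h}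
      ≤ ENNReal.ofReal (96 * (h / m)) := by
  rcases lt_or_ge h 0 with hneg | hpos
  · have : {a : UnitCircle | |inner ℝ (e : Plane) (a : Plane) - t| ≤ h} = ∅ := by
      ext a; simpa using hneg.trans_le (abs_nonneg _)
    simp [this]
  set t' := Real.sqrt (1 - t ^ 2) with ht'
  have hsq : t' ^ 2 = 1 - t ^ 2 := Real.sq_sqrt ((sq_nonneg m).trans ht)
  have hmt : m ≤ t' := Real.le_sqrt_of_sq_le ht
  have ht1 : t ≤ 1 := by nlinarith [sq_nonneg m]
  have hhm : h ≤ h / m := by rw [le_div_iff₀ hm]; nlinarith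
  have hsub : {a : UnitCircle | |inner ℝ (e : Plane) (a : Plane) - t| ≤ h} ⊆
      {a : UnitCircle | ‖(a : Plane) - (t' • perp (e : Plane) + t • (e : Plane))‖ ≤ 3 * (h / m)} ∪
      {a : UnitCircle | ‖(a : Plane) - ((-t') • perp (e : Plane) + t • (e : Plane))‖ ≤ 3 * (h / m)} := by
    intro a ha
    simp only [Set.mem_ofPred_eq] at ha
    set s := inner ℝ (e : Plane) (a : Plane) with hs
    set s' := inner ℝ (perp (e : Plane)) (a : Plane) with hs'
    have hn : s' ^ 2 + s ^ 2 = 1 := by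
      rw [hs, hs', ← norm_sq_frame, norm_coe]; norm_num
    have hs1 : |s| ≤ 1 := abs_le_one_iff_mul_self_le_one.2 (by nlinarith [sq_nonneg s'])
    have dist : ∀ τ : ℝ, |s' - τ| ≤ 2 * (h / m) →
        ‖(a : Plane) - (τ • perp (e : Plane) + t • (e : Plane))‖ ≤ 3 * (h / m) := by
      intro τ hτ
      have : (a : Plane) - (τ • perp (e : Plane) + t • (e : Plane))
          = (s' - τ) • perp (e : Plane) + (s - t) • (e : Plane) := by
        nth_rw 1 [exists_coords e (a : Plane)]
        rw [sub_smul, sub_smul]; abel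
      rw [this]
      refine (norm_add_le _ _).trans ?_
      rw [norm_smul, norm_smul, norm_perp_coe, norm_coe, Real.norm_eq_abs, Real.norm_eq_abs]
      linarith
    -- Both `(s', s)` and `(t', t)` lie on the unit circle. One of the two factors on the left is at
    -- least `m` in modulus, so the other one is `O(h / m)`: the strip consists of pieces near the
    -- two points `(± t', t)`.
    have key : (s' - t') * (s' + t') = (t - s) * (t + s) := by nlinarith
    have hts : |(t - s) * (t + s)| ≤ 2 * h := by
      rw [abs_mul, abs_sub_comm]
      have : |t + s| ≤ 2 := by
        refine (abs_add_le _ _).trans ?_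
        rw [abs_of_nonneg ht0]; linarith
      nlinarith [abs_nonneg (s - t), abs_nonneg (t + s)]
    have div : ∀ x y : ℝ, m ≤ y → |x * y| ≤ 2 * h → |x| ≤ 2 * (h / m) := by
      intro x y hy hxy
      rw [mul_div_assoc', le_div_iff₀ hm]
      rw [abs_mul] at hxy
      have : m ≤ |y| := hy.trans (le_abs_self y)
      nlinarith [abs_nonneg x]
    rcases le_total 0 s' with hc | hc
    · left
      refine dist t' (div _ (s' + t') (by linarith) ?_)
      rwa [key]
    · right
      refine dist (-t') ?_
      refine div _ (t' - s') (by linarith) ?_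
      rw [show (s' - -t') * (t' - s') = -((s' - t') * (s' + t')) by ring, abs_neg, key]
      exact hts
  refine (measure_mono hsub).trans ((measure_union_le _ _).trans ?_)
  refine (add_le_add (surf_cap_le _ _) (surf_cap_le _ _)).trans_eq ?_
  rw [← ENNReal.ofReal_add (by positivity) (by positivity)]
  congr 1; ring

/-- Either `√x ≤ y` or `√x ≤ x / y`. The free parameter `y` linearises the square root, so that
integration over `ω` can be interchanged with the integral inside. -/
theorem sqrt_le_add_inv_mul (x y : ℝ≥0∞) : x ^ (1 / 2 : ℝ) ≤ y + y⁻¹ * x := by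
  rcases eq_or_ne y ∞ with rfl | hy
  · simp
  set z := x ^ (1 / 2 : ℝ) with hz
  have hx : x = z * z := by
    rw [hz, ← ENNReal.rpow_add_of_nonneg _ _ (by norm_num) (by norm_num)]; norm_num
  rcases le_total z y with h | h
  · exact h.trans le_self_add
  rcases eq_or_ne y 0 with rfl | hy0
  · rcases eq_or_ne z 0 with h0 | h0
    · simp [h0]
    · rw [hx]; simp [h0]
  · refine le_trans ?_ le_add_self
    rw [hx, ← mul_assoc]
    calc z = y⁻¹ * y * z := by rw [ENNReal.inv_mul_cancel hy0 hy, one_mul]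
      _ ≤ y⁻¹ * z * z := by gcongr

theorem lintegral_mul_sq_le {α : Type*} [MeasurableSpace α] (μ : Measure α) {f g : α → ℝ≥0∞}
    (hf : AEMeasurable f μ) (hg : AEMeasurable g μ) :
    (∫⁻ x, f x * g x ∂μ) ^ 2 ≤ (∫⁻ x, f x ^ 2 ∂μ) * ∫⁻ x, g x ^ 2 ∂μ := by
  have h := ENNReal.lintegral_mul_le_Lp_mul_Lq μ (p := 2) (q := 2) Real.HolderConjugate.two_two hf hg
  simp only [Pi.mul_apply, ENNReal.rpow_two] at h
  calc _ ≤ ((∫⁻ x, f x ^ 2 ∂μ) ^ (1 / 2 : ℝ) * (∫⁻ x, g x ^ 2 ∂μ) ^ (1 / 2 : ℝ)) ^ 2 := by gcongr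
    _ = _ := by
      rw [mul_pow, ← ENNReal.rpow_natCast, ← ENNReal.rpow_natCast, ← ENNReal.rpow_mul,
        ← ENNReal.rpow_mul]
      norm_num

/-! ### Bilinear averages over pairs of points with prescribed difference -/

/-- The indicator function of the ball of radius `3κ`. -/
def ballInd (κ : ℝ) : Plane → ℝ≥0∞ := (Metric.closedBall (0 : Plane) (3 * κ)).indicator 1

@[fun_prop]
theorem measurable_ballInd (κ : ℝ) : Measurable (ballInd κ) :=
  measurable_one.indicator Metric.isClosed_closedBall.measurableSet

theorem ballInd_eq_one {κ : ℝ} {x : Plane} (h : ‖x‖ ≤ 3 * κ) : ballInd κ x = 1 :=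
  Set.indicator_of_mem (by simpa using h) _

theorem ballInd_eq_zero {κ : ℝ} {x : Plane} (h : ¬ ‖x‖ ≤ 3 * κ) : ballInd κ x = 0 :=
  Set.indicator_of_notMem (by simpa using h) _

theorem ballInd_neg (κ : ℝ) (x : Plane) : ballInd κ (-x) = ballInd κ x := by
  by_cases h : ‖x‖ ≤ 3 * κ
  · rw [ballInd_eq_one h, ballInd_eq_one (by simpa using h)]
  · rw [ballInd_eq_zero h, ballInd_eq_zero (by simpa using h)]

theorem lintegral_ballInd_add_le (κ : ℝ) (x : Plane) :
    ∫⁻ b : UnitCircle, ballInd κ (x + b) ∂surf ≤ ENNReal.ofReal (48 * κ) := by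
  have : (fun b : UnitCircle => ballInd κ (x + b)) =
      Set.indicator {b : UnitCircle | ‖(b : Plane) - (-x)‖ ≤ 3 * κ} 1 := by
    ext b
    simp only [ballInd, Set.indicator, Metric.mem_closedBall, dist_zero_right, sub_neg_eq_add,
      Set.mem_ofPred_eq, add_comm, Pi.one_apply]
  rw [this, lintegral_indicator_one (measurableSet_le (by fun_prop) (by fun_prop))]
  exact (surf_cap_le _ _).trans_eq (by congr 1; ring)

theorem lintegral_ballInd_sub_le (κ : ℝ) (x : Plane) :
    ∫⁻ b : UnitCircle, ballInd κ (x - b) ∂surf ≤ ENNReal.ofReal (48 * κ) := by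
  have : ∀ b : UnitCircle, ballInd κ (x - b) = ballInd κ (-x + b) := fun b => by
    rw [← ballInd_neg]; congr 1; abel
  simp only [this]
  exact lintegral_ballInd_add_le κ _

theorem lintegral_ballInd_plane_le {κ : ℝ} (hκ : 0 ≤ κ) (y : Plane) :
    ∫⁻ ξ : Plane, ballInd κ (ξ - y) ≤ ENNReal.ofReal (36 * κ ^ 2) := by
  rw [lintegral_sub_right_eq_self (fun ξ => ballInd κ ξ) y, ballInd,
    lintegral_indicator_one Metric.isClosed_closedBall.measurableSet,
    EuclideanSpace.volume_closedBall_fin_two, ← ENNReal.ofReal_pow (by positivity),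
    ← ENNReal.ofReal_mul (by positivity)]
  refine ENNReal.ofReal_le_ofReal ?_
  nlinarith [Real.pi_le_four, sq_nonneg κ]

/-- A bilinear average of `p` over the pairs of points of the circle with difference close to
`ξ`. -/
def pairSum (κ : ℝ) (p : UnitCircle → ℝ≥0∞) (ξ : Plane) : ℝ≥0∞ :=
  ∫⁻ a : UnitCircle, (∫⁻ b : UnitCircle, ballInd κ (ξ - a + b) * (p a * p b) ∂surf) ∂surf

/-- The measure of the set of pairs of points of the circle with difference close to `ξ`. -/
def pairMeasure (κ : ℝ) (ξ : Plane) : ℝ≥0∞ :=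
  ∫⁻ a : UnitCircle, (∫⁻ b : UnitCircle, ballInd κ (ξ - a + b) ∂surf) ∂surf

variable {κ : ℝ} {p : UnitCircle → ℝ≥0∞}

@[fun_prop]
theorem measurable_pairSum (hp : Measurable p) : Measurable (pairSum κ p) := by
  unfold pairSum
  have h1 : Measurable fun q : Plane × UnitCircle =>
      ∫⁻ b : UnitCircle, ballInd κ (q.1 - q.2 + b) * (p q.2 * p b) ∂surf :=
    Measurable.lintegral_prod_right' (f := fun q : (Plane × UnitCircle) × UnitCircle =>
      ballInd κ (q.1.1 - q.1.2 + q.2) * (p q.1.2 * p q.2)) (by fun_prop)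
  exact h1.lintegral_prod_right'

/-- Cauchy–Schwarz on the set of admissible pairs; the indicator is its own square and can be put in
both factors. -/
theorem pairSum_sq_le (hp : Measurable p) (ξ : Plane) :
    pairSum κ p ξ ^ 2 ≤ pairMeasure κ ξ *
      ∫⁻ a : UnitCircle, (∫⁻ b : UnitCircle, ballInd κ (ξ - a + b) * (p a ^ 2 * p b ^ 2) ∂surf) ∂surf := by
  have h := lintegral_mul_sq_le (surf.prod surf)
    (f := fun q : UnitCircle × UnitCircle => ballInd κ (ξ - q.1 + q.2))
    (g := fun q => ballInd κ (ξ - q.1 + q.2) * (p q.1 * p q.2)) (by fun_prop) (by fun_prop)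
  have idem : ∀ x : Plane, ballInd κ x * ballInd κ x = ballInd κ x := fun x => by
    by_cases h : ‖x‖ ≤ 3 * κ
    · simp [ballInd_eq_one h]
    · simp [ballInd_eq_zero h]
  simp only [← mul_assoc, sq, idem] at h
  rw [lintegral_prod _ (by fun_prop), lintegral_prod _ (by fun_prop),
    lintegral_prod _ (by fun_prop)] at h
  simp only [pairSum, pairMeasure, sq]
  refine (le_of_eq ?_).trans (h.trans (le_of_eq ?_))
  · simp only [mul_assoc]
  · congr 1
    refine lintegral_congr fun a => lintegral_congr fun b => ?_
    simp only
    calc _ = (ballInd κ (ξ - a + b) * ballInd κ (ξ - a + b)) * (p a * p a * (p b * p b)) := by ring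
      _ = _ := by rw [idem]

/-- A Schur test: `p a * p b ≤ p a ^ 2 + p b ^ 2`, and once one point is frozen the other ranges
over a cap of length `O(κ)`. Only the localisation of the pairs to `T` is used, not the
transversality of the two circles. -/
theorem pairSum_le_of_forall_mem (hp : Measurable p) (ξ : Plane) {T : Set UnitCircle}
    (hT : MeasurableSet T)
    (h : ∀ a b : UnitCircle, ‖ξ - a + b‖ ≤ 3 * κ → a ∈ T ∧ b ∈ T) :
    pairSum κ p ξ ≤ ENNReal.ofReal (96 * κ) * ∫⁻ a, T.indicator 1 a * p a ^ 2 ∂surf := by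
  have hi : Measurable (T.indicator (1 : UnitCircle → ℝ≥0∞)) := measurable_one.indicator hT
  have hle : ∀ a b : UnitCircle, ballInd κ (ξ - a + b) * (p a * p b) ≤
      (T.indicator 1 a * p a ^ 2) * ballInd κ (ξ - a + b)
        + (T.indicator 1 b * p b ^ 2) * ballInd κ (ξ - a + b) := by
    intro a b
    by_cases hab : ‖ξ - a + b‖ ≤ 3 * κ
    · obtain ⟨ha, hb⟩ := h a b hab
      simp only [ballInd_eq_one hab, Set.indicator_of_mem ha, Set.indicator_of_mem hb,
        Pi.one_apply, one_mul, mul_one, sq]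
      rcases le_total (p a) (p b) with h' | h'
      · exact (mul_le_mul' h' le_rfl).trans le_add_self
      · exact (mul_le_mul' le_rfl h').trans le_self_add
    · simp [ballInd_eq_zero hab]
  set I := ∫⁻ a, T.indicator 1 a * p a ^ 2 ∂surf with hI
  have e1 : ∫⁻ a : UnitCircle, (∫⁻ b : UnitCircle,
      (T.indicator 1 a * p a ^ 2) * ballInd κ (ξ - a + b) ∂surf) ∂surf
        ≤ ENNReal.ofReal (48 * κ) * I := by
    rw [hI, ← lintegral_const_mul _ (by fun_prop)]
    refine lintegral_mono fun a => ?_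
    rw [lintegral_const_mul _ (by fun_prop), mul_comm]
    exact mul_le_mul' (lintegral_ballInd_add_le κ _) le_rfl
  have e2 : ∫⁻ a : UnitCircle, (∫⁻ b : UnitCircle,
      (T.indicator 1 b * p b ^ 2) * ballInd κ (ξ - a + b) ∂surf) ∂surf
        ≤ ENNReal.ofReal (48 * κ) * I := by
    rw [lintegral_lintegral_swap (by fun_prop), hI, ← lintegral_const_mul _ (by fun_prop)]
    refine lintegral_mono fun b => ?_
    rw [lintegral_const_mul _ (by fun_prop), mul_comm]
    refine mul_le_mul' ?_ le_rfl
    simp only [sub_add_eq_add_sub]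
    exact lintegral_ballInd_sub_le κ _
  calc pairSum κ p ξ ≤ _ := lintegral_mono fun a => lintegral_mono fun b => hle a b
    _ = _ := by
      rw [← lintegral_add_left]
      · refine lintegral_congr fun a => ?_
        rw [lintegral_add_left (by fun_prop)]
      · exact Measurable.lintegral_prod_right' (f := fun q : UnitCircle × UnitCircle =>
          (T.indicator 1 q.1 * p q.1 ^ 2) * ballInd κ (ξ - q.1 + q.2)) (by fun_prop)
    _ ≤ ENNReal.ofReal (48 * κ) * I + ENNReal.ofReal (48 * κ) * I := add_le_add e1 e2
    _ = _ := by
      rw [← two_mul, ← mul_assoc, show (96 * κ) = 2 * (48 * κ) by ring,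
        ENNReal.ofReal_mul (p := 2) (by norm_num)]
      simp

/-- The mass of `p ^ 2` on the section of `U` over `ω`. -/
def sectionMass (p : UnitCircle → ℝ≥0∞) (U : Set (UnitCircle × UnitCircle)) (ω : UnitCircle) : ℝ≥0∞ :=
  ∫⁻ b, U.indicator 1 (ω, b) * p b ^ 2 ∂surf

theorem measurable_sectionMass (hp : Measurable p) {U : Set (UnitCircle × UnitCircle)}
    (hU : MeasurableSet U) : Measurable (sectionMass p U) := by
  have hi : Measurable (U.indicator (1 : UnitCircle × UnitCircle → ℝ≥0∞)) :=
    measurable_one.indicator hU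
  exact Measurable.lintegral_prod_right' (f := fun q : UnitCircle × UnitCircle =>
    U.indicator 1 q * p q.2 ^ 2) (by fun_prop)

theorem lintegral_sectionMass_le (hp : Measurable p) {U : Set (UnitCircle × UnitCircle)}
    (hU : MeasurableSet U) {V : ℝ≥0∞} (hV : ∀ b, surf {ω | (ω, b) ∈ U} ≤ V) :
    ∫⁻ ω, sectionMass p U ω ∂surf ≤ V * ∫⁻ b, p b ^ 2 ∂surf := by
  have hi : Measurable (U.indicator (1 : UnitCircle × UnitCircle → ℝ≥0∞)) :=
    measurable_one.indicator hU
  unfold sectionMass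
  rw [lintegral_lintegral_swap (by fun_prop), ← lintegral_const_mul _ (by fun_prop)]
  refine lintegral_mono fun b => ?_
  rw [lintegral_mul_const _ (by fun_prop)]
  refine mul_le_mul' ?_ le_rfl
  have : (fun ω : UnitCircle => U.indicator (1 : UnitCircle × UnitCircle → ℝ≥0∞) (ω, b)) =
      Set.indicator {ω | (ω, b) ∈ U} 1 := by
    ext ω; simp [Set.indicator]
  have hb : MeasurableSet {ω | (ω, b) ∈ U} := measurable_prodMk_right hU
  rw [this, lintegral_indicator_one hb]
  exact hV b

/-! ### Two general estimates for a shell of frequencies -/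

/-- The Schur bound is uniform in `t`, so the square root of the `t`-integral costs only `volume S ^
(1/2)`. What is left is linear in `p ^ 2`, and the average over `ω` yields the factor `V`. -/
theorem shell_estimate_of_sup (hp : Measurable p) {S : Set ℝ} (hS : MeasurableSet S) (η : ℝ≥0∞)
    {U : Set (UnitCircle × UnitCircle)} (hU : MeasurableSet U) {V : ℝ≥0∞}
    (hV : ∀ b, surf {ω | (ω, b) ∈ U} ≤ V)
    (h : ∀ (ω : UnitCircle), ∀ t ∈ S, ∀ a b : UnitCircle,
      ‖t • perp (ω : Plane) - a + b‖ ≤ 3 * κ → (ω, a) ∈ U ∧ (ω, b) ∈ U) :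
    ∫⁻ ω : UnitCircle, (η * ∫⁻ t in S, pairSum κ p (t • perp (ω : Plane)) ^ 2) ^ (1 / 2 : ℝ) ∂surf
      ≤ (η * volume S) ^ (1 / 2 : ℝ) * ENNReal.ofReal (96 * κ) * V * ∫⁻ b, p b ^ 2 ∂surf := by
  have hpt : ∀ ω : UnitCircle,
      (η * ∫⁻ t in S, pairSum κ p (t • perp (ω : Plane)) ^ 2) ^ (1 / 2 : ℝ)
        ≤ (η * volume S) ^ (1 / 2 : ℝ) * ENNReal.ofReal (96 * κ) * sectionMass p U ω := by
    intro ω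
    have hb : ∀ t ∈ S, pairSum κ p (t • perp (ω : Plane)) ^ 2 ≤
        (ENNReal.ofReal (96 * κ) * sectionMass p U ω) ^ 2 := fun t ht => by
      gcongr
      exact pairSum_le_of_forall_mem hp _ (T := {b | (ω, b) ∈ U}) (measurable_prodMk_left hU)
        (h ω t ht)
    calc _ ≤ (η * ((ENNReal.ofReal (96 * κ) * sectionMass p U ω) ^ 2 * volume S)) ^ (1 / 2 : ℝ) := by
          gcongr
          rw [← setLIntegral_const]
          exact setLIntegral_mono' hS hb
      _ = _ := by
          rw [mul_comm (_ ^ 2), ← mul_assoc, ENNReal.mul_rpow_of_nonneg _ _ (by norm_num),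
            ← ENNReal.rpow_natCast, ← ENNReal.rpow_mul]
          norm_num [mul_assoc]
  calc _ ≤ ∫⁻ ω : UnitCircle, (η * volume S) ^ (1 / 2 : ℝ) * ENNReal.ofReal (96 * κ) *
        sectionMass p U ω ∂surf := lintegral_mono hpt
    _ = (η * volume S) ^ (1 / 2 : ℝ) * ENNReal.ofReal (96 * κ) * ∫⁻ ω, sectionMass p U ω ∂surf :=
        lintegral_const_mul _ (measurable_sectionMass hp hU)
    _ ≤ (η * volume S) ^ (1 / 2 : ℝ) * ENNReal.ofReal (96 * κ) * (V * ∫⁻ b, p b ^ 2 ∂surf) := by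
        gcongr; exact lintegral_sectionMass_le hp hU hV
    _ = _ := by ring

variable {κ : ℝ} {p : UnitCircle → ℝ≥0∞}

/-- The square root is linearised around `r * E ω`, where `E ω` is the mass of `p ^ 2` on the
section of `U` over `ω`. This leaves a quadrilinear expression divided by `E ω`. Every `a` that
occurs has its own neighbourhood of partners, of mass `m a ≤ E ω`, so dividing by `m a` instead is
harmless and removes the dependence on `ω`. Integration in `ω` and `|t| dt` is then integration over
the plane, and the weight `(m a)⁻¹` absorbs the integral in `b`, which leaves one factor `∫ p ^ 2`.
-/
theorem shell_estimate (hκ : 0 < κ) (hp : Measurable p)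
    {S : Set ℝ} (hS : MeasurableSet S) (η r V M : ℝ≥0∞) (hr : r ≠ 0) (hr' : r ≠ ∞)
    {U D : Set (UnitCircle × UnitCircle)} (hU : MeasurableSet U) (hD : MeasurableSet D)
    (hV : ∀ b, surf {ω | (ω, b) ∈ U} ≤ V)
    (hη : ∀ t ∈ S, η ≤ ENNReal.ofReal |t|)
    (hM : ∀ (ω : UnitCircle), ∀ t ∈ S, pairMeasure κ (t • perp (ω : Plane)) ≤ M)
    (h : ∀ (ω : UnitCircle), ∀ t ∈ S, ∀ a b : UnitCircle,
      ‖t • perp (ω : Plane) - a + b‖ ≤ 3 * κ → (a, b) ∈ D ∧ ∀ b', (a, b') ∈ D → (ω, b') ∈ U) :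
    ∫⁻ ω : UnitCircle, (η * ∫⁻ t in S, pairSum κ p (t • perp (ω : Plane)) ^ 2) ^ (1 / 2 : ℝ) ∂surf
      ≤ (r * V + r⁻¹ * M * ENNReal.ofReal (72 * κ ^ 2)) * ∫⁻ b, p b ^ 2 ∂surf := by
  have mp := continuous_perp.measurable
  set m := sectionMass p D with hm
  have mm : Measurable m := measurable_sectionMass hp hD
  have mD : Measurable (D.indicator (1 : UnitCircle × UnitCircle → ℝ≥0∞)) :=
    measurable_one.indicator hD
  set E := sectionMass p U with hE
  have mE : Measurable E := measurable_sectionMass hp hU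
  set W : UnitCircle × UnitCircle → ℝ≥0∞ := fun q =>
    D.indicator 1 q * (p q.1 ^ 2 * p q.2 ^ 2) * (m q.1)⁻¹ with hW
  have mW : Measurable W := by fun_prop
  set f : Plane → ℝ≥0∞ := fun ξ =>
    ∫⁻ a : UnitCircle, (∫⁻ b : UnitCircle, ballInd κ (ξ - a + b) * W (a, b) ∂surf) ∂surf with hf
  have mf0 : Measurable fun q : Plane × UnitCircle =>
      ∫⁻ b : UnitCircle, ballInd κ (q.1 - q.2 + b) * W (q.2, b) ∂surf :=
    Measurable.lintegral_prod_right' (f := fun q : (Plane × UnitCircle) × UnitCircle =>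
      ballInd κ (q.1.1 - q.1.2 + q.2) * W (q.1.2, q.2)) (by fun_prop)
  have mf : Measurable f := mf0.lintegral_prod_right'
  have hpt : ∀ ω : UnitCircle, ∀ t ∈ S,
      (E ω)⁻¹ * (η * pairSum κ p (t • perp (ω : Plane)) ^ 2) ≤
        M * (ENNReal.ofReal |t| * f (t • perp (ω : Plane))) := by
    intro ω t ht
    set ξ := t • perp (ω : Plane) with hξ
    have hle : (E ω)⁻¹ * (∫⁻ a : UnitCircle, (∫⁻ b : UnitCircle,
        ballInd κ (ξ - a + b) * (p a ^ 2 * p b ^ 2) ∂surf) ∂surf) ≤ f ξ := by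
      rw [← lintegral_const_mul]
      · refine lintegral_mono fun a => ?_
        rw [← lintegral_const_mul _ (by fun_prop)]
        refine lintegral_mono fun b => ?_
        by_cases hab : ‖ξ - a + b‖ ≤ 3 * κ
        · obtain ⟨h1, h2⟩ := h ω t ht a b hab
          -- The section of `D` over `a` is contained in that of `U` over `ω`; this is the purpose
          -- of the second half of `h`.
          have hmE : m a ≤ E ω := by
            refine lintegral_mono fun b' => ?_
            gcongr
            by_cases hb' : (a, b') ∈ D
            · rw [Set.indicator_of_mem hb', Set.indicator_of_mem (h2 b' hb')]; rfl
            · rw [Set.indicator_of_notMem hb']; exact zero_le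
          simp only [ballInd_eq_one hab, hW, Set.indicator_of_mem h1, Pi.one_apply, one_mul]
          rw [mul_comm]
          gcongr
        · simp [ballInd_eq_zero hab]
      · exact Measurable.lintegral_prod_right' (f := fun q : UnitCircle × UnitCircle =>
          ballInd κ (ξ - q.1 + q.2) * (p q.1 ^ 2 * p q.2 ^ 2)) (by fun_prop)
    calc _ ≤ (E ω)⁻¹ * (ENNReal.ofReal |t| * (M * ∫⁻ a : UnitCircle, (∫⁻ b : UnitCircle,
        ballInd κ (ξ - a + b) * (p a ^ 2 * p b ^ 2) ∂surf) ∂surf)) := by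
          gcongr
          · exact hη t ht
          · exact (pairSum_sq_le hp ξ).trans (by gcongr; exact hM ω t ht)
      _ = M * (ENNReal.ofReal |t| * ((E ω)⁻¹ * ∫⁻ a : UnitCircle, (∫⁻ b : UnitCircle,
        ballInd κ (ξ - a + b) * (p a ^ 2 * p b ^ 2) ∂surf) ∂surf)) := by ring
      _ ≤ _ := by gcongr
  have hWint : ∫⁻ a : UnitCircle, (∫⁻ b : UnitCircle, W (a, b) ∂surf) ∂surf
      ≤ ∫⁻ b, p b ^ 2 ∂surf := by
    refine lintegral_mono fun a => ?_
    have : ∀ b, W (a, b) = (p a ^ 2 * (m a)⁻¹) * (D.indicator 1 (a, b) * p b ^ 2) := fun b => by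
      simp only [hW]; ring
    simp only [this]
    rw [lintegral_const_mul _ (by fun_prop)]
    change p a ^ 2 * (m a)⁻¹ * m a ≤ p a ^ 2
    rw [mul_assoc]
    -- This also covers `m a = 0` and `m a = ∞`, by the conventions for inverses and products.
    exact (mul_le_mul' le_rfl (ENNReal.inv_mul_le_one _)).trans_eq (mul_one _)
  have hfint : ∫⁻ ξ, f ξ ≤ ENNReal.ofReal (36 * κ ^ 2) * ∫⁻ b, p b ^ 2 ∂surf := by
    rw [hf, lintegral_lintegral_swap mf0.aemeasurable]
    calc _ = ∫⁻ a : UnitCircle, (∫⁻ b : UnitCircle, (∫⁻ ξ : Plane,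
          ballInd κ (ξ - a + b) * W (a, b)) ∂surf) ∂surf :=
          lintegral_congr fun a => lintegral_lintegral_swap (by fun_prop)
      _ ≤ ∫⁻ a : UnitCircle, (∫⁻ b : UnitCircle,
          ENNReal.ofReal (36 * κ ^ 2) * W (a, b) ∂surf) ∂surf := by
          refine lintegral_mono fun a => lintegral_mono fun b => ?_
          simp only
          rw [lintegral_mul_const _ (by fun_prop)]
          gcongr
          simp only [sub_add]
          exact lintegral_ballInd_plane_le hκ.le _
      _ = ENNReal.ofReal (36 * κ ^ 2) * ∫⁻ a : UnitCircle, (∫⁻ b : UnitCircle, W (a, b) ∂surf) ∂surf := by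
          rw [← lintegral_const_mul _ mW.lintegral_prod_right']
          exact lintegral_congr fun a => lintegral_const_mul _ (by fun_prop)
      _ ≤ _ := by gcongr
  have hamgm : ∀ ω : UnitCircle,
      (η * ∫⁻ t in S, pairSum κ p (t • perp (ω : Plane)) ^ 2) ^ (1 / 2 : ℝ) ≤
        r * E ω + r⁻¹ * (M * ∫⁻ t : ℝ, ENNReal.ofReal |t| * f (t • perp (ω : Plane))) := by
    intro ω
    refine (sqrt_le_add_inv_mul _ (r * E ω)).trans ?_
    rw [ENNReal.mul_inv (.inl hr) (.inl hr'), mul_assoc]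
    refine add_le_add le_rfl (mul_le_mul' le_rfl ?_)
    rw [← lintegral_const_mul _ (by fun_prop), ← lintegral_const_mul _ (by fun_prop),
      ← lintegral_const_mul _ (by fun_prop)]
    exact (setLIntegral_mono' hS (hpt ω)).trans (setLIntegral_le_lintegral _ _)
  refine (lintegral_mono hamgm).trans ?_
  have mline : Measurable fun ω : UnitCircle =>
      ∫⁻ t : ℝ, ENNReal.ofReal |t| * f (t • perp (ω : Plane)) :=
    Measurable.lintegral_prod_right' (f := fun q : UnitCircle × ℝ =>
      ENNReal.ofReal |q.2| * f (q.2 • perp (q.1 : Plane))) (by fun_prop)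
  rw [lintegral_add_left (by fun_prop), lintegral_const_mul _ mE,
    lintegral_const_mul _ (by fun_prop), lintegral_const_mul _ (by fun_prop),
    lintegral_polar_line f mf, add_mul]
  gcongr ?_ + ?_
  · rw [mul_assoc]; gcongr; exact lintegral_sectionMass_le hp hU hV
  · rw [show (72 * κ ^ 2) = 2 * (36 * κ ^ 2) by ring, ENNReal.ofReal_mul (p := 2) (by norm_num),
      ENNReal.ofReal_ofNat]
    calc _ ≤ r⁻¹ * (M * (2 * (ENNReal.ofReal (36 * κ ^ 2) * ∫⁻ b, p b ^ 2 ∂surf))) := by gcongr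
      _ = _ := by ring

/-! ### Geometry of chords and the individual shells -/

variable {κ : ℝ} {p : UnitCircle → ℝ≥0∞}

theorem pairMeasure_le {ξ : Plane} {T : Set UnitCircle} (hT : MeasurableSet T)
    (h : ∀ a b : UnitCircle, ‖ξ - a + b‖ ≤ 3 * κ → a ∈ T) :
    pairMeasure κ ξ ≤ ENNReal.ofReal (48 * κ) * surf T := by
  rw [← setLIntegral_const, ← lintegral_indicator hT]
  refine lintegral_mono fun a => ?_
  by_cases ha : a ∈ T
  · rw [Set.indicator_of_mem ha]
    exact lintegral_ballInd_add_le κ _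
  · have : ∀ b : UnitCircle, ballInd κ (ξ - a + b) = 0 := fun b =>
      ballInd_eq_zero fun hab => ha (h a b hab)
    simp [this]

/-- The point `a - ξ` is within `3κ` of the unit vector `b`, so its norm is within `3κ` of 1.
Expanding the square of that norm gives the claim. -/
theorem abs_two_mul_inner_sub_le (hκ1 : κ ≤ 1) {ω a b : UnitCircle} {t : ℝ}
    (h : ‖t • perp (ω : Plane) - a + b‖ ≤ 3 * κ) :
    |2 * (t * inner ℝ (perp (ω : Plane)) (a : Plane)) - t ^ 2| ≤ 15 * κ := by
  set ξ := t • perp (ω : Plane) with hξ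
  have h1 : ‖(a : Plane) - ξ‖ ^ 2 = 1 - (2 * (t * inner ℝ (perp (ω : Plane)) (a : Plane)) - t ^ 2) := by
    rw [norm_sub_sq_real, norm_coe, hξ, inner_smul_right, norm_smul, norm_perp_coe,
      real_inner_comm]
    simp; ring
  have h2 : |‖(a : Plane) - ξ‖ - 1| ≤ 3 * κ := by
    have h0 := abs_norm_sub_norm_le ((a : Plane) - ξ) (b : Plane)
    rw [norm_coe b, ← norm_neg ((a : Plane) - ξ - b),
      show -((a : Plane) - ξ - b) = ξ - a + b by abel] at h0
    exact h0.trans h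
  have h3 : 2 * (t * inner ℝ (perp (ω : Plane)) (a : Plane)) - t ^ 2 =
      -((‖(a : Plane) - ξ‖ - 1) * (‖(a : Plane) - ξ‖ - 1 + 2)) := by linarith
  rw [h3, abs_neg, abs_mul]
  have h4 : |‖(a : Plane) - ξ‖ - 1 + 2| ≤ 5 := by
    refine (abs_add_le _ _).trans ?_
    rw [abs_of_pos (zero_lt_two' ℝ)]; linarith
  nlinarith [abs_nonneg (‖(a : Plane) - ξ‖ - 1)]

/-- The roles of `a` and `b` are exchanged by reversing the chord, that is by `t ↦ -t`. -/
theorem abs_two_mul_inner_add_le (hκ1 : κ ≤ 1) {ω a b : UnitCircle} {t : ℝ}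
    (h : ‖t • perp (ω : Plane) - a + b‖ ≤ 3 * κ) :
    |2 * (t * inner ℝ (perp (ω : Plane)) (b : Plane)) + t ^ 2| ≤ 15 * κ := by
  have := abs_two_mul_inner_sub_le (ω := ω) (a := b) (b := a) (t := -t) hκ1 (by
    rwa [← norm_neg, show -((-t) • perp (ω : Plane) - b + a) = t • perp (ω : Plane) - a + b by
      rw [neg_smul]; abel])
  rw [← abs_neg]
  convert this using 2
  ring

/-- The parameter of `shell_estimate` is taken to be `r = κ ^ 2 / δ`. With `V` of order `δ` and `M`
of order `κ ^ 2 / δ`, both summands are then of order `κ ^ 2`. -/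
theorem ofReal_const {κ δ : ℝ} (hκ : 0 < κ) (hδ : 0 < δ) {v m C : ℝ} (hv : 0 ≤ v) (hm : 0 ≤ m)
    (h : κ ^ 2 / δ * v + (κ ^ 2 / δ)⁻¹ * m * (72 * κ ^ 2) ≤ C) :
    ENNReal.ofReal (κ ^ 2 / δ) * ENNReal.ofReal v + (ENNReal.ofReal (κ ^ 2 / δ))⁻¹ *
      ENNReal.ofReal m * ENNReal.ofReal (72 * κ ^ 2) ≤ ENNReal.ofReal C := by
  rw [← ENNReal.ofReal_inv_of_pos (by positivity), ← ENNReal.ofReal_mul (by positivity),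
    ← ENNReal.ofReal_mul (by positivity), ← ENNReal.ofReal_mul (by positivity),
    ← ENNReal.ofReal_add (by positivity) (by positivity)]
  exact ENNReal.ofReal_le_ofReal h

theorem measurableSet_abs_Icc (δ δ' : ℝ) : MeasurableSet {t : ℝ | δ ≤ |t| ∧ |t| ≤ δ'} := by
  measurability

theorem volume_abs_le {S : Set ℝ} {δ : ℝ} (h : ∀ t ∈ S, |t| ≤ δ) :
    volume S ≤ ENNReal.ofReal (2 * δ) := by
  refine (measure_mono (t := Set.Icc (-δ) δ) fun t ht => abs_le.1 (h t ht)).trans_eq ?_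
  rw [Real.volume_Icc]; congr 1; ring

theorem sup_const {η κ v V C : ℝ} {S : Set ℝ} (hη : 0 ≤ η) (hκ : 0 ≤ κ) (hv : 0 ≤ v) (hC : 0 ≤ C)
    (hS : volume S ≤ ENNReal.ofReal v) (h : (η * v) * (96 * κ * V) ^ 2 ≤ C ^ 2) :
    (ENNReal.ofReal η * volume S) ^ (1 / 2 : ℝ) * ENNReal.ofReal (96 * κ) * ENNReal.ofReal V
      ≤ ENNReal.ofReal C := by
  calc _ ≤ (ENNReal.ofReal η * ENNReal.ofReal v) ^ (1 / 2 : ℝ) * ENNReal.ofReal (96 * κ) *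
        ENNReal.ofReal V := by gcongr
    _ = ENNReal.ofReal (√(η * v) * (96 * κ) * V) := by
      rw [← ENNReal.ofReal_mul hη, ENNReal.ofReal_rpow_of_nonneg (by positivity) (by norm_num),
        ← Real.sqrt_eq_rpow, ← ENNReal.ofReal_mul (by positivity),
        ← ENNReal.ofReal_mul (by positivity)]
    _ ≤ _ := by
      refine ENNReal.ofReal_le_ofReal (abs_le_of_sq_le_sq' ?_ hC).2
      rw [mul_assoc, mul_pow, Real.sq_sqrt (by positivity)]
      exact h

/-- Very low frequencies. -/
theorem low_block (hκ : 0 < κ) (hp : Measurable p) {δ : ℝ} (hδ : 0 < δ) (hδκ : δ ≤ κ) :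
    ∫⁻ ω : UnitCircle, (ENNReal.ofReal δ * ∫⁻ t in {t : ℝ | |t| ≤ δ},
      pairSum κ p (t • perp (ω : Plane)) ^ 2) ^ (1 / 2 : ℝ) ∂surf
      ≤ ENNReal.ofReal (10 ^ 7 * κ ^ 2) * ∫⁻ b, p b ^ 2 ∂surf := by
  -- No localisation is available at these frequencies. The strip of half-width 1 is the entire
  -- circle.
  have hV : ∀ b : UnitCircle, surf {ω : UnitCircle | (ω, b) ∈ (Set.univ : Set (UnitCircle × UnitCircle))}
      ≤ ENNReal.ofReal 8 := fun b => by
    refine (measure_mono fun ω _ => ?_).trans ((surf_strip_le b 1).trans_eq (by norm_num))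
    have := abs_real_inner_le_norm (b : Plane) (ω : Plane)
    simpa [norm_coe] using this
  refine (shell_estimate_of_sup hp (measurableSet_le (by fun_prop) measurable_const) _
    MeasurableSet.univ hV (fun _ _ _ _ _ _ => ⟨trivial, trivial⟩)).trans ?_
  gcongr
  refine sup_const hδ.le hκ.le (by positivity) (by positivity) (volume_abs_le fun t ht => ht)
    ?_
  have : δ * δ ≤ κ ^ 2 := by nlinarith
  nlinarith [sq_nonneg κ, sq_nonneg (κ ^ 2)]

/-- Frequencies below the square root of the scale. -/
theorem lower_block (hκ : 0 < κ) (hκ1 : κ ≤ 1) (hp : Measurable p) {δ : ℝ} (hδ : 0 < δ)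
    (hδκ : δ ^ 2 ≤ κ) :
    ∫⁻ ω : UnitCircle, (ENNReal.ofReal δ * ∫⁻ t in {t : ℝ | δ ≤ |t| ∧ |t| ≤ 2 * δ},
      pairSum κ p (t • perp (ω : Plane)) ^ 2) ^ (1 / 2 : ℝ) ∂surf
      ≤ ENNReal.ofReal (10 ^ 7 * κ ^ 2) * ∫⁻ b, p b ^ 2 ∂surf := by
  have mp := continuous_perp.measurable
  have hdiv : ∀ x t : ℝ, δ ≤ |t| → |t * x| ≤ 10 * κ → |x| ≤ 10 * κ / δ := fun x t ht h => by
    rw [le_div_iff₀ hδ]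
    rw [abs_mul] at h
    nlinarith [abs_nonneg x]
  refine (shell_estimate_of_sup hp (measurableSet_abs_Icc _ _) _
    (U := {q | |inner ℝ (perp (q.1 : Plane)) (q.2 : Plane)| ≤ 10 * κ / δ})
    (measurableSet_le (by fun_prop) measurable_const) (fun b => surf_strip_perp_le b (10 * κ / δ))
    ?_).trans ?_
  · rintro ω t ⟨ht1, ht2⟩ a b hab
    have h1 := abs_two_mul_inner_sub_le hκ1 hab
    have h2 := abs_two_mul_inner_add_le hκ1 hab
    -- Because `t ^ 2` is itself `O(κ)`, the chord relations force `|t|` times the component along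
    -- `perp ω` to be `O(κ)` for both endpoints.
    have ht : t ^ 2 ≤ 4 * κ := by rw [← sq_abs]; nlinarith [abs_nonneg t]
    rw [abs_le] at h1 h2
    refine ⟨hdiv _ t ht1 (abs_le.2 ⟨?_, ?_⟩), hdiv _ t ht1 (abs_le.2 ⟨?_, ?_⟩)⟩ <;>
      nlinarith [sq_nonneg t]
  · gcongr
    refine sup_const hδ.le hκ.le (v := 2 * (2 * δ)) (by positivity) (by positivity)
      (volume_abs_le fun t ht => ht.2) ?_
    have : δ * (2 * (2 * δ)) * (96 * κ * (8 * (10 * κ / δ))) ^ 2 = 4 * (96 * 80) ^ 2 * (κ ^ 2) ^ 2 := by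
      field_simp; ring
    rw [this]
    nlinarith [sq_nonneg (κ ^ 2)]

/-- The direction of `t • perp ω`. -/
theorem exists_unit_direction (ω : UnitCircle) (t : ℝ) :
    ∃ e : UnitCircle, t • perp (ω : Plane) = |t| • (e : Plane) := by
  rcases le_total 0 t with h | h
  · exact ⟨perpCircle ω, by rw [abs_of_nonneg h]; rfl⟩
  · exact ⟨-perpCircle ω, by rw [abs_of_nonpos h]; simp⟩

/-- The first endpoint lies near the circle and near its translate by a vector of length `|t|`.
These meet at height `|t| / 2` in the direction of translation, so the endpoint lies in a strip
about that height. The number `m` bounds the half-chord `√(1 - t ^ 2 / 4)` from below and measures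
the transversality. -/
theorem pairMeasure_le_of_transversal (hκ : 0 < κ) (hκ1 : κ ≤ 1) (ω : UnitCircle) {t h m : ℝ}
    (ht : t ≠ 0) (hh : 15 * κ ≤ 2 * |t| * h) (hm : 0 < m) (hm1 : m ≤ 1) (htm : m ^ 2 ≤ 1 - (|t| / 2) ^ 2) :
    pairMeasure κ (t • perp (ω : Plane)) ≤ ENNReal.ofReal (48 * κ * (96 * (h / m))) := by
  obtain ⟨e, he⟩ := exists_unit_direction ω t
  have ht' : 0 < |t| := abs_pos.2 ht
  rw [ENNReal.ofReal_mul (by positivity)]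
  refine (pairMeasure_le (T := {a : UnitCircle | |inner ℝ (e : Plane) (a : Plane) - |t| / 2| ≤ h})
    (measurableSet_le (by fun_prop) measurable_const) ?_).trans
    (by gcongr; exact surf_offset_strip_le e _ h m (by positivity) hm hm1 htm)
  intro a b hab
  have h1 := abs_two_mul_inner_sub_le hκ1 hab
  have h2 : t * inner ℝ (perp (ω : Plane)) (a : Plane) = |t| * inner ℝ (e : Plane) (a : Plane) := by
    rw [← real_inner_smul_left, he, real_inner_smul_left]
  rw [h2, ← sq_abs, show 2 * (|t| * inner ℝ (e : Plane) (a : Plane)) - |t| ^ 2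
    = 2 * |t| * (inner ℝ (e : Plane) (a : Plane) - |t| / 2) by ring, abs_mul,
    abs_of_pos (by positivity : 0 < 2 * |t|)] at h1
  have := h1.trans hh
  exact le_of_mul_le_mul_left this (by positivity)

/-- Here the chord is short, so its endpoints are `O(δ)` apart and, since `κ ≤ δ ^ 2`, both lie
within `O(δ)` of the line spanned by `ω`. The two circles still cross at an angle of order `δ`,
which gives `M` of order `κ ^ 2 / δ`. -/
theorem middle_block (hκ : 0 < κ) (hκ1 : κ ≤ 1) (hp : Measurable p) {δ : ℝ} (hδ : 0 < δ)
    (hδκ : κ ≤ δ ^ 2) (hδ1 : 2 * δ ≤ 1) :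
    ∫⁻ ω : UnitCircle, (ENNReal.ofReal δ * ∫⁻ t in {t : ℝ | δ ≤ |t| ∧ |t| ≤ 2 * δ},
      pairSum κ p (t • perp (ω : Plane)) ^ 2) ^ (1 / 2 : ℝ) ∂surf
      ≤ ENNReal.ofReal (10 ^ 7 * κ ^ 2) * ∫⁻ b, p b ^ 2 ∂surf := by
  have mp := continuous_perp.measurable
  have hκδ : κ ≤ δ := by nlinarith
  refine (shell_estimate hκ hp (measurableSet_abs_Icc _ _) _ (ENNReal.ofReal (κ ^ 2 / δ))
    (ENNReal.ofReal (8 * (15 * δ))) (ENNReal.ofReal (48 * κ * (96 * (8 * κ / δ / (1 / 2)))))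
    (by rw [ne_eq, ENNReal.ofReal_eq_zero, not_le]; positivity) ENNReal.ofReal_ne_top
    (U := {q | |inner ℝ (perp (q.1 : Plane)) (q.2 : Plane)| ≤ 15 * δ})
    (D := {q | ‖(q.1 : Plane) - (q.2 : Plane)‖ ≤ 5 * δ})
    (measurableSet_le (by fun_prop) measurable_const)
    (measurableSet_le (by fun_prop) measurable_const) (fun b => surf_strip_perp_le b (15 * δ))
    (fun t ht => ENNReal.ofReal_le_ofReal ht.1) ?_ ?_).trans ?_
  · rintro ω t ⟨ht1, ht2⟩
    refine pairMeasure_le_of_transversal hκ hκ1 ω (abs_pos.1 (hδ.trans_le ht1)) ?_ (by norm_num)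
      -- `|t| ≤ 1` keeps the crossing points away from the tangency at `|t| = 2`, so `m = 1 / 2` is
      -- admissible.
      (by norm_num) (by nlinarith [abs_nonneg t])
    have : 8 * κ = δ * (8 * κ / δ) := by field_simp
    have h0 : 0 ≤ 8 * κ / δ := by positivity
    nlinarith
  · rintro ω t ⟨ht1, ht2⟩ a b hab
    have h1 := abs_two_mul_inner_sub_le hκ1 hab
    refine ⟨?_, fun b' hb' => ?_⟩
    · rw [Set.mem_ofPred_eq]
      calc ‖(a : Plane) - b‖ = ‖t • perp (ω : Plane) - (t • perp (ω : Plane) - a + b)‖ := by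
            congr 1; abel
        _ ≤ ‖t • perp (ω : Plane)‖ + ‖t • perp (ω : Plane) - a + b‖ := norm_sub_le _ _
        _ ≤ 2 * δ + 3 * κ := by
            gcongr
            rwa [norm_smul, norm_perp_coe, mul_one]
        _ ≤ _ := by linarith
    · rw [Set.mem_ofPred_eq] at hb' ⊢
      have h2 : |inner ℝ (perp (ω : Plane)) (a : Plane)| ≤ 10 * δ := by
        have h3 : |t| * |inner ℝ (perp (ω : Plane)) (a : Plane)| ≤ 10 * δ ^ 2 := by
          rw [← abs_mul]
          have ht : t ^ 2 ≤ 4 * δ ^ 2 := by rw [← sq_abs]; nlinarith [abs_nonneg t]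
          rw [abs_le] at h1 ⊢
          constructor <;> nlinarith [sq_nonneg t]
        nlinarith [abs_nonneg (inner ℝ (perp (ω : Plane)) (a : Plane))]
      have h4 : |inner ℝ (perp (ω : Plane)) ((a : Plane) - b')| ≤ 5 * δ := by
        refine (abs_real_inner_le_norm _ _).trans ?_
        rwa [norm_perp_coe, one_mul]
      rw [inner_sub_right] at h4
      rw [abs_le] at h2 h4 ⊢
      constructor <;> linarith
  · gcongr
    refine ofReal_const hκ hδ (by positivity) (by positivity) (le_of_eq_of_le ?_
      (show (120 + 48 * 96 * 16 * 72) * κ ^ 2 ≤ _ by gcongr; norm_num))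
    field_simp; ring

/-- A chord of length `2 - O(δ ^ 2)` is nearly a diameter, so by the parallelogram law its endpoints
are antipodal up to `O(δ)`. The chord is almost orthogonal to `ω`, so `a` and `b` have nearly equal
components along `ω`. Since those components also nearly cancel, both are `O(δ)`. -/
theorem antipodal_geometry {δ : ℝ} (hδ : 0 < δ) (hδκ : κ ≤ δ ^ 2) (hδ1 : δ ≤ 1)
    {ω a b : UnitCircle} {t : ℝ} (ht : 2 - 4 * δ ^ 2 ≤ |t|)
    (hab : ‖t • perp (ω : Plane) - a + b‖ ≤ 3 * κ) :
    ‖(a : Plane) + b‖ ≤ 6 * δ ∧ |inner ℝ (a : Plane) (ω : Plane)| ≤ 5 * δ := by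
  have hκδ : κ ≤ δ := by nlinarith
  have hsum : ‖(a : Plane) + b‖ ≤ 6 * δ := by
    have h1 := parallelogram_law_with_norm ℝ (a : Plane) (b : Plane)
    rw [norm_coe, norm_coe] at h1
    have h2 : 2 - 7 * δ ^ 2 ≤ ‖(a : Plane) - b‖ := by
      have : |t| ≤ ‖t • perp (ω : Plane) - a + b‖ + ‖(a : Plane) - b‖ := by
        have h0 : |t| = ‖t • perp (ω : Plane)‖ := by
          rw [norm_smul, norm_perp_coe, mul_one, Real.norm_eq_abs]
        rw [h0]
        refine le_trans (le_of_eq ?_) (norm_add_le _ _)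
        congr 1; abel
      linarith [ht]
    refine (abs_le_of_sq_le_sq' ?_ (by positivity)).2
    rcases le_total (7 * δ ^ 2) 2 with h | h
    · nlinarith [norm_nonneg ((a : Plane) - b)]
    · nlinarith [norm_nonneg ((a : Plane) - b)]
  have hunit : ∀ x : Plane, |inner ℝ x (ω : Plane)| ≤ ‖x‖ := fun x => by
    simpa [norm_coe] using abs_real_inner_le_norm x (ω : Plane)
  have ha : |inner ℝ (a : Plane) (ω : Plane)| ≤ 5 * δ := by
    have h1 := (hunit _).trans hsum
    have h2 := (hunit _).trans hab
    rw [inner_add_left, inner_sub_left, real_inner_smul_left, inner_perp_self] at h2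
    rw [inner_add_left] at h1
    rw [abs_le] at h1 h2 ⊢
    constructor <;> linarith
  exact ⟨hsum, ha⟩

/-- Frequencies close to the diameter of the circle. -/
theorem antipodal_block (hκ : 0 < κ) (hp : Measurable p) {δ : ℝ} (hδ : 0 < δ)
    (hδκ : κ ≤ δ ^ 2) (hδ1 : δ ≤ 1) {S : Set ℝ} (hS : MeasurableSet S) (h1S : ∀ t ∈ S, 1 ≤ |t|)
    (h2S : ∀ t ∈ S, 2 - 4 * δ ^ 2 ≤ |t|) (hM : ∀ (ω : UnitCircle), ∀ t ∈ S,
      pairMeasure κ (t • perp (ω : Plane)) ≤ ENNReal.ofReal (10 ^ 5 * (κ ^ 2 / δ))) :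
    ∫⁻ ω : UnitCircle, (∫⁻ t in S, pairSum κ p (t • perp (ω : Plane)) ^ 2) ^ (1 / 2 : ℝ) ∂surf
      ≤ ENNReal.ofReal (10 ^ 7 * κ ^ 2) * ∫⁻ b, p b ^ 2 ∂surf := by
  have mp := continuous_perp.measurable
  have hκδ : κ ≤ δ := by nlinarith
  have hV : ∀ b : UnitCircle, surf {ω : UnitCircle | (ω, b) ∈
      {q : UnitCircle × UnitCircle | |inner ℝ (q.2 : Plane) (q.1 : Plane)| ≤ 11 * δ}} ≤
      ENNReal.ofReal (8 * (11 * δ)) := fun b => surf_strip_le b (11 * δ)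
  have h0 := shell_estimate hκ hp hS 1 (ENNReal.ofReal (κ ^ 2 / δ))
    (ENNReal.ofReal (8 * (11 * δ))) (ENNReal.ofReal (10 ^ 5 * (κ ^ 2 / δ)))
    (by rw [ne_eq, ENNReal.ofReal_eq_zero, not_le]; positivity) ENNReal.ofReal_ne_top
    (D := {q | ‖(q.1 : Plane) + (q.2 : Plane)‖ ≤ 6 * δ})
    (measurableSet_le (by fun_prop) measurable_const)
    (measurableSet_le (by fun_prop) measurable_const) hV
    (fun t ht => by simpa using h1S t ht) hM ?_
  · simp only [one_mul] at h0
    refine h0.trans ?_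
    gcongr
    refine ofReal_const hκ hδ (by positivity) (by positivity) (le_of_eq_of_le ?_
      (show (88 + 10 ^ 5 * 72) * κ ^ 2 ≤ _ by gcongr; norm_num))
    field_simp; ring
  · intro ω t ht a b hab
    obtain ⟨hsum, ha⟩ := antipodal_geometry hδ hδκ hδ1 (h2S t ht) hab
    have hunit : ∀ x : Plane, |inner ℝ x (ω : Plane)| ≤ ‖x‖ := fun x => by
      simpa [norm_coe] using abs_real_inner_le_norm x (ω : Plane)
    refine ⟨hsum, fun b' hb' => ?_⟩
    rw [Set.mem_ofPred_eq] at hb' ⊢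
    have h3 := (hunit _).trans hb'
    simp only [inner_add_left] at h3
    rw [abs_le] at h3 ha ⊢
    constructor <;> linarith

/-- On this shell the half-chord `√(1 - t ^ 2 / 4)` is at least `δ / 2`, which plays the role of
`m`. -/
theorem antipodal_shell (hκ : 0 < κ) (hκ1 : κ ≤ 1) (hp : Measurable p) {δ : ℝ} (hδ : 0 < δ)
    (hδκ : κ ≤ δ ^ 2) (hδ1 : δ ≤ 1) :
    ∫⁻ ω : UnitCircle, (∫⁻ t in {t : ℝ | 1 ≤ |t| ∧ δ ^ 2 ≤ 2 - |t| ∧ 2 - |t| ≤ 4 * δ ^ 2},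
      pairSum κ p (t • perp (ω : Plane)) ^ 2) ^ (1 / 2 : ℝ) ∂surf
      ≤ ENNReal.ofReal (10 ^ 7 * κ ^ 2) * ∫⁻ b, p b ^ 2 ∂surf := by
  refine antipodal_block hκ hp hδ hδκ hδ1 ?_ (fun t ht => ht.1)
    (fun t ht => by linarith [ht.2.2]) ?_
  · measurability
  · rintro ω t ⟨ht1, ht2, ht3⟩
    refine (pairMeasure_le_of_transversal hκ hκ1 ω (h := 8 * κ) (m := δ / 2)
      (abs_pos.1 (by linarith)) (by nlinarith) (by positivity) (by linarith)
      (by nlinarith)).trans (ENNReal.ofReal_le_ofReal ?_)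
    have : 48 * κ * (96 * (8 * κ / (δ / 2))) = (48 * 96 * 16) * (κ ^ 2 / δ) := by field_simp; ring
    rw [this]
    gcongr
    norm_num

/-- The circles may be tangent or disjoint here, so transversality is replaced by the trivial bound
`O(κ δ)` for the measure of pairs. It is good enough because `δ ^ 2 ≤ 4 * κ`. -/
theorem antipodal_end (hκ : 0 < κ) (hp : Measurable p) {δ : ℝ} (hδ : 0 < δ)
    (hδκ : κ ≤ δ ^ 2) (hδκ' : δ ^ 2 ≤ 4 * κ) (hδ1 : δ ≤ 1) :
    ∫⁻ ω : UnitCircle, (∫⁻ t in {t : ℝ | 1 ≤ |t| ∧ 2 - |t| ≤ δ ^ 2},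
      pairSum κ p (t • perp (ω : Plane)) ^ 2) ^ (1 / 2 : ℝ) ∂surf
      ≤ ENNReal.ofReal (10 ^ 7 * κ ^ 2) * ∫⁻ b, p b ^ 2 ∂surf := by
  refine antipodal_block hκ hp hδ hδκ hδ1 ?_ (fun t ht => ht.1)
    (fun t ht => by nlinarith [ht.2]) ?_
  · measurability
  · rintro ω t ⟨ht1, ht2⟩
    refine (pairMeasure_le (T := {a : UnitCircle | |inner ℝ (ω : Plane) (a : Plane)| ≤ 5 * δ})
      (measurableSet_le (by fun_prop) measurable_const) fun a b hab => ?_).trans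
      ((mul_le_mul' le_rfl (surf_strip_le ω (5 * δ))).trans ?_)
    · rw [Set.mem_ofPred_eq, real_inner_comm]
      exact (antipodal_geometry hδ hδκ hδ1 (by nlinarith) hab).2
    · rw [← ENNReal.ofReal_mul (by positivity)]
      refine ENNReal.ofReal_le_ofReal ?_
      rw [mul_div_assoc', le_div_iff₀ hδ]
      nlinarith [mul_le_mul_of_nonneg_left hδκ' hκ.le, sq_nonneg κ]

/-! ### Summation over the shells -/

variable {κ : ℝ} {p : UnitCircle → ℝ≥0∞}

theorem measurable_block (hp : Measurable p) (η : ℝ≥0∞) (S : Set ℝ) :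
    Measurable fun ω : UnitCircle =>
      (η * ∫⁻ t in S, pairSum κ p (t • perp (ω : Plane)) ^ 2) ^ (1 / 2 : ℝ) := by
  have mp := continuous_perp.measurable
  have : Measurable fun ω : UnitCircle => ∫⁻ t in S, pairSum κ p (t • perp (ω : Plane)) ^ 2 :=
    Measurable.lintegral_prod_right' (f := fun q : UnitCircle × ℝ =>
      pairSum κ p (q.2 • perp (q.1 : Plane)) ^ 2) (by fun_prop)
  fun_prop

/-- An inhomogeneous Besov-type norm, of smoothness one half, of a function with square `Φ`. -/
def besovNorm (K : ℕ) (Φ : ℝ → ℝ≥0∞) : ℝ≥0∞ :=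
  (∫⁻ t in {t : ℝ | 1 ≤ |t|}, Φ t) ^ (1 / 2 : ℝ)
    + ∑ k ∈ Finset.range K, (ENNReal.ofReal ((1 / 2) ^ (k + 1)) *
        ∫⁻ t in {t : ℝ | (1 / 2) ^ (k + 1) ≤ |t| ∧ |t| ≤ 2 * (1 / 2) ^ (k + 1)}, Φ t) ^ (1 / 2 : ℝ)
    + (ENNReal.ofReal ((1 / 2) ^ K) * ∫⁻ t in {t : ℝ | |t| ≤ (1 / 2) ^ K}, Φ t) ^ (1 / 2 : ℝ)

theorem sqrt_setLIntegral_le {S A B : Set ℝ} (h : S ⊆ A ∪ B) (f : ℝ → ℝ≥0∞) :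
    (∫⁻ t in S, f t) ^ (1 / 2 : ℝ) ≤
      (∫⁻ t in A, f t) ^ (1 / 2 : ℝ) + (∫⁻ t in B, f t) ^ (1 / 2 : ℝ) := by
  refine le_trans ?_ (ENNReal.rpow_add_le_add_rpow _ _ (by norm_num) (by norm_num))
  gcongr
  exact (lintegral_mono_set h).trans (lintegral_union_le _ _ _)

theorem antipodal_interior (hκ : 0 < κ) (hκ1 : κ ≤ 1) (hp : Measurable p) (J : ℕ)
    (hJ : κ ≤ (1 / 4) ^ J) :
    ∫⁻ ω : UnitCircle, (∫⁻ t in {t : ℝ | 1 ≤ |t| ∧ (1 / 4) ^ J < 2 - |t|},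
      pairSum κ p (t • perp (ω : Plane)) ^ 2) ^ (1 / 2 : ℝ) ∂surf
      ≤ J * (ENNReal.ofReal (10 ^ 7 * κ ^ 2) * ∫⁻ b, p b ^ 2 ∂surf) := by
  induction J with
  | zero =>
    -- At `J = 0` the two conditions contradict each other, so exactly `J` shells are summed.
    have : {t : ℝ | 1 ≤ |t| ∧ (1 / 4 : ℝ) ^ 0 < 2 - |t|} = ∅ := by
      ext t; simp; intro h; linarith
    rw [this]; simp
  | succ J ih =>
    have hδ : ((1 / 2 : ℝ) ^ (J + 1)) ^ 2 = (1 / 4) ^ (J + 1) := by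
      rw [← pow_mul, mul_comm, pow_mul]; norm_num
    have hle : (1 / 4 : ℝ) ^ (J + 1) ≤ (1 / 4) ^ J :=
      pow_le_pow_of_le_one (by norm_num) (by norm_num) (Nat.le_succ J)
    have h1 := antipodal_shell hκ hκ1 hp (δ := (1 / 2) ^ (J + 1)) (by positivity) (by rwa [hδ])
      (pow_le_one₀ (by norm_num) (by norm_num))
    have h2 := ih (hJ.trans hle)
    have hm := measurable_block (κ := κ) hp 1
      {t : ℝ | 1 ≤ |t| ∧ (1 / 4) ^ J < 2 - |t|}
    simp only [one_mul] at hm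
    refine (lintegral_mono fun ω => sqrt_setLIntegral_le
          (A := {t : ℝ | 1 ≤ |t| ∧ (1 / 4) ^ J < 2 - |t|})
          (B := {t : ℝ | 1 ≤ |t| ∧ ((1 / 2) ^ (J + 1)) ^ 2 ≤ 2 - |t| ∧
            2 - |t| ≤ 4 * ((1 / 2) ^ (J + 1)) ^ 2}) (by
          rintro t ⟨ht1, ht2⟩
          rcases lt_or_ge ((1 / 4) ^ J) (2 - |t|) with h | h
          · exact .inl ⟨ht1, h⟩
          · refine .inr ⟨ht1, ?_, ?_⟩ <;> rw [hδ]
            · exact ht2.le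
            · rw [pow_succ]; linarith) _).trans ?_
    rw [lintegral_add_left hm]
    exact (add_le_add h2 h1).trans_eq (by push_cast; ring)

/-- The shells number `J` near the diameter, one at its end, `K` dyadic ones and one at the bottom;
each contributes the same amount, whence the factor `J + K + 2`. -/
theorem lintegral_besovNorm_pairSum_le (hκ : 0 < κ) (hκ1 : κ ≤ 1) (hp : Measurable p) {J K : ℕ}
    (hK : (1 / 2) ^ K ≤ κ) (hJ : κ ≤ (1 / 4) ^ J) (hJ' : (1 / 4) ^ J ≤ 4 * κ) :
    ∫⁻ ω : UnitCircle, besovNorm K (fun t => pairSum κ p (t • perp (ω : Plane)) ^ 2) ∂surf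
      ≤ (J + K + 2) * (ENNReal.ofReal (10 ^ 7 * κ ^ 2) * ∫⁻ b, p b ^ 2 ∂surf) := by
  set I := ENNReal.ofReal (10 ^ 7 * κ ^ 2) * ∫⁻ b, p b ^ 2 ∂surf with hI
  have hδ : ((1 / 2 : ℝ) ^ J) ^ 2 = (1 / 4) ^ J := by
    rw [← pow_mul, mul_comm, pow_mul]; norm_num
  have high : ∫⁻ ω : UnitCircle, (∫⁻ t in {t : ℝ | 1 ≤ |t|},
      pairSum κ p (t • perp (ω : Plane)) ^ 2) ^ (1 / 2 : ℝ) ∂surf ≤ (J + 1) * I := by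
    have h1 := antipodal_end hκ hp (δ := (1 / 2) ^ J) (by positivity) (by rwa [hδ])
      (by rwa [hδ]) (pow_le_one₀ (by norm_num) (by norm_num))
    have h2 := antipodal_interior hκ hκ1 hp J hJ
    have hm := measurable_block (κ := κ) hp 1 {t : ℝ | 1 ≤ |t| ∧ (1 / 4) ^ J < 2 - |t|}
    simp only [one_mul] at hm
    refine (lintegral_mono fun ω => sqrt_setLIntegral_le
          (A := {t : ℝ | 1 ≤ |t| ∧ (1 / 4) ^ J < 2 - |t|})
          (B := {t : ℝ | 1 ≤ |t| ∧ 2 - |t| ≤ ((1 / 2) ^ J) ^ 2}) (by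
          intro t ht
          rcases lt_or_ge ((1 / 4) ^ J) (2 - |t|) with h | h
          · exact .inl ⟨ht, h⟩
          · exact .inr ⟨ht, by rwa [hδ]⟩) _).trans ?_
    rw [lintegral_add_left hm]
    exact (add_le_add h2 h1).trans_eq (by ring)
  have mid : ∫⁻ ω : UnitCircle, (∑ k ∈ Finset.range K, (ENNReal.ofReal ((1 / 2) ^ (k + 1)) *
        ∫⁻ t in {t : ℝ | (1 / 2) ^ (k + 1) ≤ |t| ∧ |t| ≤ 2 * (1 / 2) ^ (k + 1)},
          pairSum κ p (t • perp (ω : Plane)) ^ 2) ^ (1 / 2 : ℝ)) ∂surf ≤ K * I := by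
    rw [lintegral_finsetSum _ fun k _ => measurable_block hp _ _]
    refine (Finset.sum_le_card_nsmul _ _ I fun k _ => ?_).trans_eq (by simp)
    -- The threshold `δ = √κ` decides between the Schur bound and the transversality argument.
    rcases le_total (((1 / 2 : ℝ) ^ (k + 1)) ^ 2) κ with h | h
    · exact lower_block hκ hκ1 hp (by positivity) h
    · refine middle_block hκ hκ1 hp (by positivity) h ?_
      rw [pow_succ]
      have : (1 / 2 : ℝ) ^ k ≤ 1 := pow_le_one₀ (by norm_num) (by norm_num)
      linarith
  have low := low_block hκ hp (δ := (1 / 2) ^ K) (by positivity) hK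
  have m1 := measurable_block (κ := κ) hp 1 {t : ℝ | 1 ≤ |t|}
  simp only [one_mul] at m1
  have m2 := Finset.measurable_sum (Finset.range K) fun k _ => measurable_block (κ := κ) hp
    (ENNReal.ofReal ((1 / 2) ^ (k + 1)))
    {t : ℝ | (1 / 2) ^ (k + 1) ≤ |t| ∧ |t| ≤ 2 * (1 / 2) ^ (k + 1)}
  unfold besovNorm
  beta_reduce
  rw [lintegral_add_left (show Measurable fun ω : UnitCircle => _ + _ from m1.add m2), lintegral_add_left m1]
  calc _ ≤ (J + 1) * I + K * I + I := add_le_add (add_le_add high mid) low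
    _ = _ := by ring

/-- The scales used in the dyadic decomposition. -/
theorem exists_dyadic_scales {R : ℝ} (hR : 1 ≤ R) : ∃ J K : ℕ, (1 / 2 : ℝ) ^ K ≤ R⁻¹ ∧
    R⁻¹ ≤ (1 / 4) ^ J ∧ (1 / 4) ^ J ≤ 4 * R⁻¹ ∧ (J + K + 2 : ℝ) ≤ 5 * (1 + Real.log R) := by
  have hR0 : 0 < R := by linarith
  obtain ⟨J, hJ1, hJ2⟩ := exists_nat_pow_near hR (by norm_num : (1 : ℝ) < 4)
  have e4 : (1 / 4 : ℝ) ^ J = (4 ^ J)⁻¹ := by rw [one_div, inv_pow]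
  -- `J` is the integer with `4 ^ J ≤ R < 4 ^ (J + 1)`, and this `K` makes `2 ^ K = 4 ^ (J + 1)`.
  refine ⟨J, 2 * (J + 1), ?_, ?_, ?_, ?_⟩
  · rw [pow_mul, one_div, inv_pow, inv_pow]
    norm_num
    exact inv_anti₀ hR0 hJ2.le
  · rw [e4]; exact inv_anti₀ (by positivity) hJ1
  · rw [e4, ← div_eq_mul_inv, inv_le_comm₀ (by positivity) (by positivity), inv_div,
      div_le_iff₀ (by norm_num)]
    rw [pow_succ] at hJ2
    exact hJ2.le
  · have h1 : (J : ℝ) * Real.log 4 ≤ Real.log R := by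
      rw [← Real.log_pow]
      exact Real.log_le_log (by positivity) hJ1
    have h2 : 1 ≤ Real.log 4 := by
      rw [show (4 : ℝ) = 2 ^ 2 by norm_num, Real.log_pow]
      have := Real.log_two_gt_d9
      push_cast; linarith
    have h3 : (J : ℝ) ≤ Real.log R := by nlinarith [(Nat.cast_nonneg J : (0 : ℝ) ≤ J)]
    push_cast
    linarith

/-! ### The Fourier transform of a truncated extension -/

theorem extension_congr {g g' : UnitCircle → ℂ} (h : g =ᵐ[surf] g') : extension g = extension g' := by
  ext x
  refine integral_congr_ae ?_
  filter_upwards [h] with ξ hξ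
  rw [hξ]

/-- The pairing that turns Mathlib's Fourier integral into the extension operator. -/
def dualPairing : Plane →L[ℝ] Plane →L[ℝ] ℝ := -((2 * Real.pi)⁻¹ • innerSL ℝ)

theorem extension_eq_fourierIntegral (g : UnitCircle → ℂ) :
    extension g = VectorFourier.fourierIntegral Real.fourierChar
      (surf.map ((↑) : UnitCircle → Plane))
      dualPairing.toLinearMap₁₂
      (Function.extend ((↑) : UnitCircle → Plane) g 0) := by
  have he : MeasurableEmbedding ((↑) : UnitCircle → Plane) :=
    MeasurableEmbedding.subtype_coe Metric.isClosed_sphere.measurableSet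
  ext x
  rw [VectorFourier.fourierIntegral, he.integral_map, extension]
  refine integral_congr_ae (.of_forall fun ξ => ?_)
  simp only [Subtype.val_injective.extend_apply, Circle.smul_def, smul_eq_mul,
    Real.fourierChar_apply]
  congr 2
  have h : dualPairing.toLinearMap₁₂ (ξ : Plane) x = -((2 * Real.pi)⁻¹ * inner ℝ (ξ : Plane) x) := rfl
  rw [h, neg_neg, mul_inv_cancel_left₀ Real.two_pi_pos.ne', real_inner_comm, mul_comm]

/-- The extension is the Fourier transform of a finite measure on a bounded set. All moments are
finite, so every derivative is bounded. This makes the truncated square a Schwartz function. -/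
theorem hasTemperateGrowth_extension {g : UnitCircle → ℂ} (hg : Integrable g surf) :
    (extension g).HasTemperateGrowth := by
  have he : MeasurableEmbedding ((↑) : UnitCircle → Plane) :=
    MeasurableEmbedding.subtype_coe Metric.isClosed_sphere.measurableSet
  set f := Function.extend ((↑) : UnitCircle → Plane) g 0
  have hfi : Integrable f (surf.map ((↑) : UnitCircle → Plane)) := by
    rw [he.integrable_map_iff]
    convert hg using 1
    ext ξ
    exact Subtype.val_injective.extend_apply _ _ _
  have hmom : ∀ n : ℕ, Integrable (fun v => ‖v‖ ^ n * ‖f v‖) (surf.map ((↑) : UnitCircle → Plane)) := by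
    intro n
    rw [he.integrable_map_iff]
    convert hg.norm using 1
    ext ξ
    simp [f]
  rw [extension_eq_fourierIntegral]
  refine ⟨VectorFourier.contDiff_fourierIntegral dualPairing (N := ⊤) fun n _ => hmom n,
    fun n => ⟨0, ∫ v, ‖VectorFourier.fourierPowSMulRight dualPairing f v n‖
      ∂(surf.map ((↑) : UnitCircle → Plane)), fun x => ?_⟩⟩
  rw [VectorFourier.iteratedFDeriv_fourierIntegral dualPairing (N := ⊤) (fun n _ => hmom n) hfi.1
    le_top, pow_zero, mul_one]
  exact VectorFourier.norm_fourierIntegral_le_integral_norm _ _ _ _ _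

/-- The Schwartz function `Γ |extension g| ^ 2`. -/
def truncSchwartz (Γ : 𝓢(Plane, ℂ)) (g : UnitCircle → ℂ) : 𝓢(Plane, ℂ) :=
  SchwartzMap.smulLeftCLM ℂ (fun x => extension g x * (starRingEnd ℂ) (extension g x)) Γ

theorem truncSchwartz_apply {Γ : 𝓢(Plane, ℂ)} {g : UnitCircle → ℂ} (hg : Integrable g surf) (x : Plane) :
    truncSchwartz Γ g x = Γ x * ((‖extension g x‖ ^ 2 : ℝ) : ℂ) := by
  have h1 := hasTemperateGrowth_extension hg
  have h2 : (fun x => (starRingEnd ℂ) (extension g x)).HasTemperateGrowth :=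
    (Complex.conjCLE : ℂ →L[ℝ] ℂ).hasTemperateGrowth.comp h1
  have h3 : (fun x => extension g x * (starRingEnd ℂ) (extension g x)).HasTemperateGrowth := h1.mul h2
  rw [truncSchwartz, SchwartzMap.smulLeftCLM_apply_apply h3, smul_eq_mul, mul_comm,
    Complex.mul_conj, Complex.normSq_eq_norm_sq]

theorem extension_mul_conj {g : UnitCircle → ℂ} (x : Plane) :
    extension g x * (starRingEnd ℂ) (extension g x) =
      ∫ q : UnitCircle × UnitCircle,
        Complex.exp (Complex.I * ((inner ℝ x ((q.1 : Plane) - q.2) : ℝ) : ℂ)) *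
          (g q.1 * (starRingEnd ℂ) (g q.2)) ∂(surf.prod surf) := by
  rw [extension, ← integral_conj, ← integral_prod_mul]
  refine integral_congr_ae (.of_forall fun q => ?_)
  simp only [map_mul, ← Complex.exp_conj, Complex.conj_I, Complex.conj_ofReal]
  rw [mul_mul_mul_comm, ← Complex.exp_add, inner_sub_right]
  push_cast
  ring_nf

/-- The Fourier transform of `Γ |extension g| ^ 2`. -/
theorem fourier_truncSchwartz (Γ : 𝓢(Plane, ℂ)) {g : UnitCircle → ℂ} (hg : Integrable g surf)
    (ζ : Plane) : 𝓕 (truncSchwartz Γ g) ζ = ∫ q : UnitCircle × UnitCircle,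
      (g q.1 * (starRingEnd ℂ) (g q.2)) * 𝓕 Γ (ζ - (2 * Real.pi)⁻¹ • ((q.1 : Plane) - q.2))
        ∂(surf.prod surf) := by
  have hh : Integrable (fun q : UnitCircle × UnitCircle => g q.1 * (starRingEnd ℂ) (g q.2))
      (surf.prod surf) := hg.mul_prod (Complex.conjCLE.toContinuousLinearMap.integrable_comp hg)
  have key : ∀ (x : Plane) (q : UnitCircle × UnitCircle),
      Real.fourierChar (-inner ℝ x ζ) • (Γ x * (Complex.exp (Complex.I *
        ((inner ℝ x ((q.1 : Plane) - q.2) : ℝ) : ℂ)) * (g q.1 * (starRingEnd ℂ) (g q.2)))) =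
      (g q.1 * (starRingEnd ℂ) (g q.2)) *
        (Real.fourierChar (-inner ℝ x (ζ - (2 * Real.pi)⁻¹ • ((q.1 : Plane) - q.2))) • Γ x) := by
    intro x q
    have hpi : ((2 * Real.pi : ℝ) : ℂ) ≠ 0 := by exact_mod_cast Real.two_pi_pos.ne'
    have he : ((Real.fourierChar (-inner ℝ x (ζ - (2 * Real.pi)⁻¹ • ((q.1 : Plane) - q.2))) : Circle) : ℂ)
        = (Real.fourierChar (-inner ℝ x ζ) : ℂ) * Complex.exp (Complex.I *
        ((inner ℝ x ((q.1 : Plane) - q.2) : ℝ) : ℂ)) := by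
      rw [Real.fourierChar_apply, Real.fourierChar_apply, ← Complex.exp_add]
      congr 1
      have : 2 * Real.pi * (-inner ℝ x (ζ - (2 * Real.pi)⁻¹ • ((q.1 : Plane) - q.2))) =
          2 * Real.pi * (-inner ℝ x ζ) + inner ℝ x ((q.1 : Plane) - q.2) := by
        rw [inner_sub_right x ζ, inner_smul_right]
        field_simp
        ring
      rw [this]
      push_cast
      ring
    rw [Circle.smul_def, Circle.smul_def, he, smul_eq_mul, smul_eq_mul]
    ring
  rw [SchwartzMap.fourier_coe, Real.fourier_eq]
  have h1 : ∀ x : Plane, Real.fourierChar (-inner ℝ x ζ) • truncSchwartz Γ g x =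
      ∫ q : UnitCircle × UnitCircle, (g q.1 * (starRingEnd ℂ) (g q.2)) *
        (Real.fourierChar (-inner ℝ x (ζ - (2 * Real.pi)⁻¹ • ((q.1 : Plane) - q.2))) • Γ x)
        ∂(surf.prod surf) := by
    intro x
    simp only [← key]
    rw [truncSchwartz_apply hg, ← Complex.normSq_eq_norm_sq, ← Complex.mul_conj, extension_mul_conj,
      ← integral_const_mul, Circle.smul_def, ← integral_smul]
    simp only [Circle.smul_def]
  simp only [h1]
  rw [integral_integral_swap]
  · refine integral_congr_ae (.of_forall fun q => ?_)
    simp only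
    rw [integral_const_mul, SchwartzMap.fourier_coe, Real.fourier_eq]
  · refine ((Γ.integrable (μ := volume)).norm.mul_prod hh.norm).mono ?_ (.of_forall fun q => ?_)
    · refine AEStronglyMeasurable.mul hh.1.comp_snd ?_
      simp only [Circle.smul_def]
      refine Continuous.aestronglyMeasurable ?_
      have := Real.continuous_fourierChar
      have := Γ.continuous
      fun_prop
    · simp only [Function.uncurry, norm_mul, Circle.norm_smul, norm_norm]
      rw [mul_comm]

/-- The transform of `Γ` sees a pair of points of the circle only if their difference is within `3κ`
of `ξ`. The factors `(2 * π)⁻¹` convert to angular frequency. -/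
theorem enorm_fourier_truncSchwartz_le {Γ : 𝓢(Plane, ℂ)} {g : UnitCircle → ℂ}
    (hg : Integrable g surf) (hgm : Measurable g) {κ : ℝ} {A : ℝ≥0∞}
    (hΓ : ∀ ζ : Plane, ‖𝓕 Γ ζ‖ₑ ≤ A * ballInd κ ((2 * Real.pi) • ζ)) (ξ : Plane) :
    ‖𝓕 (truncSchwartz Γ g) ((2 * Real.pi)⁻¹ • ξ)‖ₑ ≤ A * pairSum κ (fun a => ‖g a‖ₑ) ξ := by
  rw [fourier_truncSchwartz Γ hg]
  refine (enorm_integral_le_lintegral_enorm _).trans ?_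
  calc _ ≤ ∫⁻ q : UnitCircle × UnitCircle,
        A * (ballInd κ (ξ - q.1 + q.2) * (‖g q.1‖ₑ * ‖g q.2‖ₑ)) ∂(surf.prod surf) := by
        refine lintegral_mono fun q => ?_
        have h := hΓ ((2 * Real.pi)⁻¹ • ξ - (2 * Real.pi)⁻¹ • ((q.1 : Plane) - q.2))
        have e : (2 * Real.pi) • ((2 * Real.pi)⁻¹ • ξ - (2 * Real.pi)⁻¹ • ((q.1 : Plane) - q.2)) =
            ξ - q.1 + q.2 := by
          rw [← smul_sub, smul_inv_smul₀ Real.two_pi_pos.ne', ← sub_add]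
        rw [e] at h
        simp only [enorm_mul, RCLike.enorm_conj]
        calc _ ≤ ‖g q.1‖ₑ * ‖g q.2‖ₑ * (A * ballInd κ (ξ - q.1 + q.2)) := by gcongr
          _ = _ := by ring
    _ = A * pairSum κ (fun a => ‖g a‖ₑ) ξ := by
        rw [lintegral_const_mul _ (by fun_prop), lintegral_prod _ (by fun_prop)]
        rfl

theorem besovNorm_mono {K : ℕ} {Φ Ψ : ℝ → ℝ≥0∞} (h : ∀ t, Φ t ≤ Ψ t) :
    besovNorm K Φ ≤ besovNorm K Ψ := by
  unfold besovNorm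
  gcongr with k hk
  all_goals exact h _

theorem besovNorm_const_mul (K : ℕ) (Φ : ℝ → ℝ≥0∞) {c : ℝ≥0∞} (hc : c ≠ ∞) :
    besovNorm K (fun t => c ^ 2 * Φ t) = c * besovNorm K Φ := by
  have hc2 : c ^ 2 ≠ ∞ := ENNReal.pow_ne_top hc
  have hs : ∀ x : ℝ≥0∞, (c ^ 2 * x) ^ (1 / 2 : ℝ) = c * x ^ (1 / 2 : ℝ) := fun x => by
    rw [ENNReal.mul_rpow_of_nonneg _ _ (by norm_num), ← ENNReal.rpow_natCast, ← ENNReal.rpow_mul]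
    norm_num
  unfold besovNorm
  simp only [lintegral_const_mul' _ _ hc2, mul_left_comm _ (c ^ 2), hs, mul_add, Finset.mul_sum]

theorem eLpNorm_two_sq {α : Type*} [MeasurableSpace α] (μ : Measure α) (g : α → ℂ) :
    eLpNorm g 2 μ ^ 2 = ∫⁻ a, ‖g a‖ₑ ^ 2 ∂μ := by
  rw [eLpNorm_eq_lintegral_rpow_enorm_toReal (by norm_num) (by norm_num), ← ENNReal.rpow_natCast,
    ← ENNReal.rpow_mul]
  norm_num

theorem exists_besovNorm_truncSchwartz_le {R : ℝ} (hR : 1 ≤ R) : ∃ K : ℕ, (1 / 2 : ℝ) ^ K ≤ R⁻¹ ∧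
    ∀ (Γ : 𝓢(Plane, ℂ)) (A : ℝ≥0),
      (∀ ζ : Plane, ‖𝓕 Γ ζ‖ₑ ≤ A * ENNReal.ofReal (R ^ 2) * ballInd R⁻¹ ((2 * Real.pi) • ζ)) →
      ∀ g : UnitCircle → ℂ, MemLp g 2 surf →
        ∫⁻ ω : UnitCircle, besovNorm K
          (fun t => ‖𝓕 (truncSchwartz Γ g) ((2 * Real.pi)⁻¹ • t • perp (ω : Plane))‖ₑ ^ 2) ∂surf
        ≤ ENNReal.ofReal (5 * 10 ^ 7) * A * ENNReal.ofReal (1 + Real.log R) * eLpNorm g 2 surf ^ 2 := by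
  obtain ⟨J, K, hK, hJ, hJ', hJK⟩ := exists_dyadic_scales hR
  have hR0 : 0 < R := by linarith
  refine ⟨K, hK, fun Γ A hΓ g hg => ?_⟩
  have key : ∀ g : UnitCircle → ℂ, Measurable g → MemLp g 2 surf →
      ∫⁻ ω : UnitCircle, besovNorm K
          (fun t => ‖𝓕 (truncSchwartz Γ g) ((2 * Real.pi)⁻¹ • t • perp (ω : Plane))‖ₑ ^ 2) ∂surf
        ≤ ENNReal.ofReal (5 * 10 ^ 7) * A * ENNReal.ofReal (1 + Real.log R) * eLpNorm g 2 surf ^ 2 := by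
    intro g hgm hg
    have hgi : Integrable g surf := hg.integrable (by norm_num)
    have hA : (A : ℝ≥0∞) * ENNReal.ofReal (R ^ 2) ≠ ∞ := by finiteness
    calc _ ≤ ∫⁻ ω : UnitCircle, (A * ENNReal.ofReal (R ^ 2)) * besovNorm K
          (fun t => pairSum R⁻¹ (fun a => ‖g a‖ₑ) (t • perp (ω : Plane)) ^ 2) ∂surf := by
          refine lintegral_mono fun ω => ?_
          rw [← besovNorm_const_mul K _ hA]
          refine besovNorm_mono fun t => ?_
          rw [← mul_pow]
          gcongr
          exact enorm_fourier_truncSchwartz_le hgi hgm hΓ _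
      _ ≤ (A * ENNReal.ofReal (R ^ 2)) * ((J + K + 2) *
          (ENNReal.ofReal (10 ^ 7 * R⁻¹ ^ 2) * ∫⁻ b, ‖g b‖ₑ ^ 2 ∂surf)) := by
          rw [lintegral_const_mul' _ _ hA]
          gcongr
          exact lintegral_besovNorm_pairSum_le (inv_pos.2 hR0) (inv_le_one_of_one_le₀ hR)
            (by fun_prop) hK hJ hJ'
      _ = (J + K + 2) * (ENNReal.ofReal (R ^ 2) * ENNReal.ofReal (10 ^ 7 * R⁻¹ ^ 2)) * A *
          eLpNorm g 2 surf ^ 2 := by rw [eLpNorm_two_sq]; ring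
      _ ≤ ENNReal.ofReal (5 * (1 + Real.log R)) * ENNReal.ofReal (10 ^ 7) * A *
          eLpNorm g 2 surf ^ 2 := by
          gcongr
          · have := ENNReal.ofReal_le_ofReal hJK
            rwa [ENNReal.ofReal_add (by positivity) (by positivity),
              ENNReal.ofReal_add (by positivity) (by positivity), ENNReal.ofReal_natCast,
              ENNReal.ofReal_natCast, ENNReal.ofReal_ofNat] at this
          -- The height `R ^ 2` of the transformed cutoff cancels the gain `κ ^ 2 = R⁻¹ ^ 2` of the
          -- shells.
          · rw [← ENNReal.ofReal_mul (by positivity)]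
            refine ENNReal.ofReal_le_ofReal (le_of_eq ?_)
            field_simp
      _ = _ := by
          rw [ENNReal.ofReal_mul (p := 5) (by norm_num), ENNReal.ofReal_mul (p := 5) (by norm_num)]
          ring
  -- The geometric estimates need a measurable `g`; passing to a measurable representative does not
  -- change the extension.
  have hae := hg.1.ae_eq_mk
  have hm : MemLp (hg.1.mk g) 2 surf := (memLp_congr_ae hae).1 hg
  have h := key _ hg.1.stronglyMeasurable_mk.measurable hm
  have hts : truncSchwartz Γ (hg.1.mk g) = truncSchwartz Γ g := by
    unfold truncSchwartz; rw [extension_congr hae]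
  rwa [hts, ← eLpNorm_congr_ae hae] at h

/-- The dilation `x ↦ γ (R⁻¹ x)`. -/
def dilate (γ : 𝓢(Plane, ℂ)) {R : ℝ} (hR : 0 < R) : 𝓢(Plane, ℂ) :=
  SchwartzMap.compCLMOfContinuousLinearEquiv ℂ
    (ContinuousLinearEquiv.smulLeft (Units.mk0 R⁻¹ (inv_ne_zero hR.ne')) : Plane ≃L[ℝ] Plane) γ

theorem dilate_apply (γ : 𝓢(Plane, ℂ)) {R : ℝ} (hR : 0 < R) (x : Plane) :
    dilate γ hR x = γ (R⁻¹ • x) := rfl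

theorem fourier_dilate (γ : 𝓢(Plane, ℂ)) {R : ℝ} (hR : 0 < R) (ζ : Plane) :
    𝓕 (dilate γ hR) ζ = (R ^ 2 : ℝ) • 𝓕 γ (R • ζ) := by
  rw [SchwartzMap.fourier_coe, SchwartzMap.fourier_coe, Real.fourier_eq, Real.fourier_eq]
  have h := Measure.integral_comp_smul (volume : Measure Plane)
    (fun y => Real.fourierChar (-inner ℝ y (R • ζ)) • γ y) R⁻¹
  have hd : Module.finrank ℝ Plane = 2 := by simp
  rw [hd, inv_pow, inv_inv, abs_of_pos (by positivity)] at h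
  rw [← h]
  refine integral_congr_ae (.of_forall fun x => ?_)
  simp only [dilate_apply, inner_smul_left, inner_smul_right, RCLike.conj_to_real]
  rw [mul_inv_cancel_left₀ hR.ne']

/-- The Fourier transform is supported in the ball of radius three (in angular frequency). -/
def BandLimited (γ : 𝓢(Plane, ℂ)) : Prop := ∀ ζ : Plane, 3 < ‖(2 * Real.pi) • ζ‖ → 𝓕 γ ζ = 0

/-- A dilation by `R` in two dimensions multiplies the transform by `R ^ 2` and shrinks its support
by `R`. The constant is the sup norm of `𝓕 γ`, hence independent of `R`. -/
theorem BandLimited.enorm_fourier_dilate_le {γ : 𝓢(Plane, ℂ)} (hγ : BandLimited γ) :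
    ∃ A : ℝ≥0, ∀ (R : ℝ) (hR : 0 < R) (ζ : Plane), ‖𝓕 (dilate γ hR) ζ‖ₑ ≤
      A * ENNReal.ofReal (R ^ 2) * ballInd R⁻¹ ((2 * Real.pi) • ζ) := by
  refine ⟨(SchwartzMap.seminorm ℂ 0 0 (𝓕 γ)).toNNReal, fun R hR ζ => ?_⟩
  rw [fourier_dilate]
  by_cases h : ‖(2 * Real.pi) • ζ‖ ≤ 3 * R⁻¹
  · rw [ballInd_eq_one h, mul_one, enorm_smul, mul_comm, Real.enorm_of_nonneg (by positivity),
      ← ofReal_norm]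
    gcongr
    exact ENNReal.ofReal_le_ofReal (SchwartzMap.norm_le_seminorm ℂ (𝓕 γ) (R • ζ))
  · rw [hγ]
    · simp
    · rw [not_le, ← div_eq_mul_inv, div_lt_iff₀ hR] at h
      rwa [smul_comm, norm_smul, Real.norm_of_nonneg hR.le, mul_comm]

/-! ### Plancherel and Bernstein inequalities -/

section FourierLp

variable {V : Type*} [NormedAddCommGroup V] [InnerProductSpace ℝ V] [FiniteDimensional ℝ V]
  [MeasurableSpace V] [BorelSpace V]

theorem integral_fourierInv_mul_eq_flip {f g : V → ℂ} (hf : Integrable f) (hg : Integrable g) :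
    ∫ x, 𝓕⁻ f x * g x = ∫ x, f x * 𝓕⁻ g x := by
  have := VectorFourier.integral_fourierIntegral_smul_eq_flip (μ := (volume : Measure V))
    (ν := (volume : Measure V)) (L := -innerₗ V) Real.continuous_fourierChar
    (by simpa using! continuous_inner.neg) hf hg
  simpa [Real.fourierInv_eq, VectorFourier.fourierIntegral, real_inner_comm] using! this

theorem enorm_fourierInv_le (f : V → ℂ) (x : V) : ‖𝓕⁻ f x‖ₑ ≤ ∫⁻ y, ‖f y‖ₑ := by
  rw [Real.fourierInv_eq]
  refine (enorm_integral_le_lintegral_enorm _).trans (le_of_eq ?_)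
  simp only [← ofReal_norm, Circle.norm_smul]

theorem continuous_fourierInv {f : V → ℂ} (hf : Integrable f) : Continuous (𝓕⁻ f) := by
  have := VectorFourier.fourierIntegral_continuous (L := -innerₗ V) Real.continuous_fourierChar
    (by simpa using! continuous_inner.neg) hf
  exact this

theorem fourierInv_add' {f g : V → ℂ} (hf : Integrable f) (hg : Integrable g) :
    𝓕⁻ (f + g) = 𝓕⁻ f + 𝓕⁻ g := by
  exact VectorFourier.fourierIntegral_add (L := -innerₗ V) Real.continuous_fourierChar
    (by simpa using! continuous_inner.neg) hf hg

/-- The `L^2` Fourier inversion is defined abstractly. Testing against Schwartz functions shows that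
it agrees almost everywhere with the inverse Fourier integral, which then inherits the isometry. -/
theorem eLpNorm_fourierInv_two {f : V → ℂ} (hf : Integrable f) (hf2 : MemLp f 2) :
    eLpNorm (𝓕⁻ f) 2 = eLpNorm f 2 := by
  set F : Lp ℂ 2 (volume : Measure V) := hf2.toLp f
  have hF : (F : V → ℂ) =ᵐ[volume] f := hf2.coeFn_toLp
  set G : Lp ℂ 2 (volume : Measure V) := 𝓕⁻ F
  have hpair : ∀ φ : 𝓢(V, ℂ), ∫ x, φ x • G x = ∫ x, φ x • 𝓕⁻ f x := by
    intro φ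
    rw [← Lp.toTemperedDistribution_apply, ← Lp.fourierInv_toTemperedDistribution_eq,
      TemperedDistribution.fourierInv_apply, Lp.toTemperedDistribution_apply]
    have h := integral_fourierInv_mul_eq_flip hf φ.integrable
    simp only [smul_eq_mul]
    calc _ = ∫ x, f x * 𝓕⁻ (φ : V → ℂ) x := by
          refine integral_congr_ae ?_
          filter_upwards [hF] with x hx
          rw [hx, mul_comm, SchwartzMap.fourierInv_coe]
      _ = _ := by rw [← h]; simp only [mul_comm]
  have hG : (G : V → ℂ) =ᵐ[volume] 𝓕⁻ f := by
    refine ae_eq_of_integral_contDiff_smul_eq ((Lp.memLp G).locallyIntegrable (by norm_num))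
      (continuous_fourierInv hf).locallyIntegrable ?_
    intro φ hφ hφc
    have hc : HasCompactSupport (fun x => (φ x : ℂ)) := hφc.comp_left Complex.ofReal_zero
    have hs : ContDiff ℝ ((⊤ : ℕ∞) : WithTop ℕ∞) (fun x => (φ x : ℂ)) := Complex.ofRealCLM.contDiff.comp hφ
    have := hpair (hc.toSchwartzMap hs)
    simpa using this
  rw [← eLpNorm_congr_ae hG, ← eLpNorm_congr_ae hF]
  have h : ‖G‖ = ‖F‖ := (Lp.fourierTransformₗᵢ V ℂ).symm.norm_map F
  rw [Lp.norm_def, Lp.norm_def] at h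
  exact (ENNReal.toReal_eq_toReal_iff' (Lp.eLpNorm_ne_top _) (Lp.eLpNorm_ne_top _)).1 h

theorem lintegral_enorm_le_of_support {f : V → ℂ} (hf : AEStronglyMeasurable f) {S : Set V}
    (hS : MeasurableSet S) (hfS : ∀ x ∉ S, f x = 0) :
    ∫⁻ x, ‖f x‖ₑ ≤ volume S ^ (1 / 2 : ℝ) * eLpNorm f 2 := by
  have h1 : ∫⁻ x, ‖f x‖ₑ = ∫⁻ x in S, ‖f x‖ₑ := by
    rw [← lintegral_indicator hS]
    refine lintegral_congr fun x => ?_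
    by_cases hx : x ∈ S
    · simp [hx]
    · simp [hx, hfS x hx]
  have h2 := eLpNorm_le_eLpNorm_mul_rpow_measure_univ (μ := volume.restrict S) (f := f) (p := 1)
    (q := 2) (by norm_num) hf.restrict
  rw [h1, ← eLpNorm_one_eq_lintegral_enorm (f := f)]
  refine h2.trans ?_
  rw [mul_comm]
  norm_num
  refine mul_le_mul_right ?_ _
  exact eLpNorm_mono_measure _ Measure.restrict_le_self

/-- Bernstein's inequality: the sup bound given by Cauchy–Schwarz on the support is interpolated
with Plancherel, `|h| ^ r ≤ ‖h‖_∞ ^ (r - 2) * |h| ^ 2`. -/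
theorem eLpNorm_fourierInv_le_of_support {f : V → ℂ} (hf : MemLp f 2) {S : Set V}
    (hS : MeasurableSet S) (hSt : volume S ≠ ∞) (hfS : ∀ x ∉ S, f x = 0) {p : ℝ≥0∞} (hp : 2 ≤ p) :
    eLpNorm (𝓕⁻ f) p ≤ volume S ^ (1 / 2 - p.toReal⁻¹) * eLpNorm f 2 := by
  have hM := lintegral_enorm_le_of_support hf.1 hS hfS
  have hfi : Integrable f := by
    refine ⟨hf.1, hM.trans_lt ?_⟩
    have := hf.eLpNorm_ne_top
    finiteness
  by_cases hpt : p = ∞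
  · subst hpt
    rw [eLpNorm_exponent_top, ENNReal.toReal_top, inv_zero, sub_zero]
    exact eLpNormEssSup_le_of_ae_enorm_bound
      (.of_forall fun x => (enorm_fourierInv_le f x).trans hM)
  have hp0 : p ≠ 0 := by rintro rfl; simp at hp
  have hpr : 2 ≤ p.toReal := by
    rw [← ENNReal.toReal_ofNat]; exact ENNReal.toReal_mono hpt hp
  have hpi : p.toReal⁻¹ ≤ 1 / 2 := by rw [one_div]; gcongr
  set r := p.toReal
  set N := eLpNorm f 2 with hN
  have hNt : N ≠ ∞ := hf.eLpNorm_ne_top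
  set m := volume S
  rw [eLpNorm_eq_lintegral_rpow_enorm_toReal hp0 hpt]
  have h2 : ∫⁻ x, ‖𝓕⁻ f x‖ₑ ^ (2 : ℝ) = N ^ (2 : ℝ) := by
    rw [hN, ← eLpNorm_fourierInv_two hfi hf,
      eLpNorm_eq_lintegral_rpow_enorm_toReal (by norm_num) (by norm_num), ← ENNReal.rpow_mul]
    norm_num
  calc (∫⁻ x, ‖𝓕⁻ f x‖ₑ ^ r) ^ (1 / r)
      ≤ (∫⁻ x, (m ^ (1 / 2 : ℝ) * N) ^ (r - 2) * ‖𝓕⁻ f x‖ₑ ^ (2 : ℝ)) ^ (1 / r) := by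
        gcongr with x
        calc ‖𝓕⁻ f x‖ₑ ^ r = ‖𝓕⁻ f x‖ₑ ^ ((r - 2) + 2) := by ring_nf
          _ = ‖𝓕⁻ f x‖ₑ ^ (r - 2) * ‖𝓕⁻ f x‖ₑ ^ (2 : ℝ) :=
            ENNReal.rpow_add_of_nonneg _ _ (by linarith) (by norm_num)
          _ ≤ _ := by
            gcongr
            exact (enorm_fourierInv_le f x).trans hM
    _ = (m ^ (1 / 2 : ℝ)) ^ ((r - 2) * (1 / r)) * N ^ (1 : ℝ) := by
        have hr : 0 ≤ r - 2 := by linarith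
        have hmt : m ^ (1 / 2 : ℝ) ≠ ∞ := by finiteness
        have hr' : (r - 2 + 2) * (1 / r) = 1 := by rw [sub_add_cancel]; field_simp
        rw [lintegral_const_mul' _ _ (by finiteness), h2, ENNReal.mul_rpow_of_nonneg _ _ hr,
          mul_assoc, ← ENNReal.rpow_add_of_nonneg _ _ hr (by norm_num),
          ENNReal.mul_rpow_of_nonneg _ _ (by positivity), ← ENNReal.rpow_mul N,
          ← ENNReal.rpow_mul (m ^ (1 / 2 : ℝ)), hr']
    _ = m ^ (1 / 2 - r⁻¹) * N := by
        rw [← ENNReal.rpow_mul, ENNReal.rpow_one]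
        congr 2
        field_simp
        
end FourierLp

/-! ### Fractional derivatives on the line, band by band -/

theorem lintegral_comp_const_mul {a : ℝ} (ha : 0 < a) (f : ℝ → ℝ≥0∞) :
    ENNReal.ofReal a * ∫⁻ t, f (a * t) = ∫⁻ t, f t := by
  have hemb : MeasurableEmbedding (fun t : ℝ => a * t) :=
    (Homeomorph.mulLeft₀ a ha.ne').measurableEmbedding
  have h := Real.map_volume_mul_left ha.ne'
  have h2 : ∫⁻ t, f (a * t) = ENNReal.ofReal |a⁻¹| * ∫⁻ t, f t := by
    rw [← hemb.lintegral_map, h, lintegral_smul_measure, smul_eq_mul]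
  rw [h2, ← mul_assoc, ← ENNReal.ofReal_mul ha.le, abs_of_pos (inv_pos.2 ha),
    mul_inv_cancel₀ ha.ne', ENNReal.ofReal_one, one_mul]

/-- The function `U` multiplied by the symbol of `(-Δ)^(θ / 2)`. -/
def symbolMul (θ : ℝ) (U : ℝ → ℂ) (η : ℝ) : ℂ := ((|2 * Real.pi * η| ^ θ : ℝ) : ℂ) * U η

theorem continuous_symbolMul {θ : ℝ} (hθ : 0 ≤ θ) {U : ℝ → ℂ} (hU : Continuous U) :
    Continuous (symbolMul θ U) := by
  unfold symbolMul
  have : Continuous fun η : ℝ => |2 * Real.pi * η| ^ θ :=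
    (by fun_prop : Continuous fun η : ℝ => |2 * Real.pi * η|).rpow_const fun _ => Or.inr hθ
  fun_prop

/-- The band of frequencies whose angular version lies in `T`. -/
def band (T : Set ℝ) : Set ℝ := {η | 2 * Real.pi * η ∈ T}

theorem measurableSet_band {T : Set ℝ} (hT : MeasurableSet T) : MeasurableSet (band T) :=
  (by fun_prop : Measurable fun η : ℝ => 2 * Real.pi * η) hT

theorem band_subset {T : Set ℝ} {d : ℝ} (hT : ∀ t ∈ T, |t| ≤ d) :
    band T ⊆ Set.Icc (-(d / (2 * Real.pi))) (d / (2 * Real.pi)) := by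
  intro η hη
  have h := hT _ hη
  rw [abs_mul, abs_of_pos Real.two_pi_pos, mul_comm, ← le_div_iff₀ Real.two_pi_pos] at h
  exact abs_le.1 h

theorem volume_band_le {T : Set ℝ} {d : ℝ} (hd : 0 ≤ d) (hT : ∀ t ∈ T, |t| ≤ d) :
    volume (band T) ≤ ENNReal.ofReal d := by
  refine (measure_mono (band_subset hT)).trans ?_
  rw [Real.volume_Icc]
  refine ENNReal.ofReal_le_ofReal ?_
  have h : d / (2 * Real.pi) ≤ d / 2 := by
    gcongr
    linarith [Real.pi_gt_three]
  linarith

theorem setLIntegral_band_le {T : Set ℝ} (hT : MeasurableSet T) (f : ℝ → ℝ≥0∞) :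
    ∫⁻ η in band T, f η ≤ ∫⁻ t in T, f ((2 * Real.pi)⁻¹ * t) := by
  rw [← lintegral_indicator (measurableSet_band hT), ← lintegral_indicator hT,
    ← lintegral_comp_const_mul Real.two_pi_pos (T.indicator _)]
  have : ∀ η, T.indicator (fun t => f ((2 * Real.pi)⁻¹ * t)) (2 * Real.pi * η) =
      (band T).indicator f η := by
    intro η
    by_cases h : 2 * Real.pi * η ∈ T
    · rw [Set.indicator_of_mem h, Set.indicator_of_mem (by exact h),
        inv_mul_cancel_left₀ Real.two_pi_pos.ne']
    · rw [Set.indicator_of_notMem h, Set.indicator_of_notMem (by exact h)]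
  simp only [this]
  refine le_mul_of_one_le_left (by positivity) ?_
  rw [← ENNReal.ofReal_one]
  exact ENNReal.ofReal_le_ofReal (by linarith [Real.pi_gt_three])

theorem memLp_indicator_symbolMul {θ : ℝ} (hθ : 0 ≤ θ) {U : ℝ → ℂ} (hU : Continuous U)
    {T : Set ℝ} (hTm : MeasurableSet T) {d : ℝ} (hT : ∀ t ∈ T, |t| ≤ d) (p : ℝ≥0∞) :
    MemLp ((band T).indicator (symbolMul θ U)) p := by
  have hc := continuous_symbolMul hθ hU
  obtain ⟨C, hC⟩ := (isCompact_Icc (a := -(d / (2 * Real.pi))) (b := d / (2 * Real.pi))).exists_bound_of_continuousOn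
    hc.continuousOn
  rw [memLp_indicator_iff_restrict (measurableSet_band hTm)]
  have : IsFiniteMeasure (volume.restrict (band T)) :=
    ⟨by
      rw [Measure.restrict_apply_univ]
      exact (measure_mono (band_subset hT)).trans_lt measure_Icc_lt_top⟩
  refine MemLp.of_bound hc.aestronglyMeasurable C ?_
  filter_upwards [ae_restrict_mem (measurableSet_band hTm)] with η hη
  exact hC η (band_subset hT hη)

/-- The symbol is at most `d ^ (1/p)` on the band and Bernstein costs `d ^ (1/2 - 1/p)`, so the
right side does not depend on `p`. This lets a single norm serve all exponents. -/
theorem eLpNorm_fourierInv_band_le {U : ℝ → ℂ} (hU : Continuous U) {p : ℝ≥0∞} (hp : 2 ≤ p)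
    {T : Set ℝ} (hTm : MeasurableSet T) {d : ℝ} (hd : 0 ≤ d) (hT : ∀ t ∈ T, |t| ≤ d) :
    eLpNorm (𝓕⁻ ((band T).indicator (symbolMul p.toReal⁻¹ U))) p ≤
      (ENNReal.ofReal d * ∫⁻ t in T, ‖U ((2 * Real.pi)⁻¹ * t)‖ₑ ^ 2) ^ (1 / 2 : ℝ) := by
  set θ := p.toReal⁻¹ with hθd
  have hθ : 0 ≤ θ := by positivity
  have hθ2 : θ ≤ 1 / 2 := by
    by_cases hpt : p = ∞
    · simp [hθd, hpt]
    · have hpr : 2 ≤ p.toReal := by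
        rw [← ENNReal.toReal_ofNat]; exact ENNReal.toReal_mono hpt hp
      rw [hθd, one_div]; gcongr
  have hS := measurableSet_band hTm
  have hm := memLp_indicator_symbolMul hθ hU hTm hT 2
  have h2 : eLpNorm ((band T).indicator (symbolMul θ U)) 2 ≤
      ENNReal.ofReal d ^ θ * (∫⁻ t in T, ‖U ((2 * Real.pi)⁻¹ * t)‖ₑ ^ 2) ^ (1 / 2 : ℝ) := by
    rw [eLpNorm_indicator_eq_eLpNorm_restrict hS,
      eLpNorm_eq_lintegral_rpow_enorm_toReal (by norm_num) (by norm_num)]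
    have hb : ∫⁻ η in band T, ‖symbolMul θ U η‖ₑ ^ (2 : ℝ) ≤
        ∫⁻ η in band T, (ENNReal.ofReal d ^ θ) ^ (2 : ℝ) * ‖U η‖ₑ ^ 2 := by
      refine setLIntegral_mono' hS fun η hη => ?_
      rw [symbolMul, enorm_mul, ENNReal.mul_rpow_of_nonneg _ _ (by norm_num)]
      gcongr ?_ * ?_
      · gcongr
        rw [← ofReal_norm, Complex.norm_real, Real.norm_of_nonneg (by positivity),
          ← ENNReal.ofReal_rpow_of_nonneg (abs_nonneg _) hθ]
        gcongr
        exact hT _ hη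
      · norm_num
    rw [lintegral_const_mul' _ _ (by finiteness)] at hb
    rw [ENNReal.toReal_ofNat]
    calc _ ≤ ((ENNReal.ofReal d ^ θ) ^ (2 : ℝ) *
          ∫⁻ t in T, ‖U ((2 * Real.pi)⁻¹ * t)‖ₑ ^ 2) ^ (1 / 2 : ℝ) := by
          gcongr
          exact hb.trans (mul_le_mul_right (setLIntegral_band_le hTm _) _)
      _ = _ := by
          rw [ENNReal.mul_rpow_of_nonneg _ _ (by norm_num), ← ENNReal.rpow_mul]
          norm_num
  refine (eLpNorm_fourierInv_le_of_support hm hS ?_ (fun x hx => Set.indicator_of_notMem hx _) hp).trans ?_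
  · exact ((volume_band_le hd hT).trans_lt ENNReal.ofReal_lt_top).ne
  · calc _ ≤ ENNReal.ofReal d ^ (1 / 2 - θ) * (ENNReal.ofReal d ^ θ *
          (∫⁻ t in T, ‖U ((2 * Real.pi)⁻¹ * t)‖ₑ ^ 2) ^ (1 / 2 : ℝ)) := by
          refine mul_le_mul' ?_ h2
          exact ENNReal.rpow_le_rpow (volume_band_le hd hT) (by linarith)
      _ = _ := by
          rw [← mul_assoc, ← ENNReal.rpow_add_of_nonneg _ _ (by linarith) hθ, sub_add_cancel,
            ENNReal.mul_rpow_of_nonneg _ _ (by norm_num)]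

theorem eLpNorm_fourierInv_band_union_le {U : ℝ → ℂ} (hU : Continuous U) {p : ℝ≥0∞} (hp : 2 ≤ p)
    {T T' : Set ℝ} (hTm : MeasurableSet T) (hTm' : MeasurableSet T') {d : ℝ}
    (hT : ∀ t ∈ T, |t| ≤ d) (hT' : ∀ t ∈ T', |t| ≤ d) (hdis : Disjoint T T') :
    eLpNorm (𝓕⁻ ((band (T ∪ T')).indicator (symbolMul p.toReal⁻¹ U))) p ≤
      eLpNorm (𝓕⁻ ((band T).indicator (symbolMul p.toReal⁻¹ U))) p +
      eLpNorm (𝓕⁻ ((band T').indicator (symbolMul p.toReal⁻¹ U))) p := by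
  have hθ : 0 ≤ p.toReal⁻¹ := by positivity
  have hi := memLp_one_iff_integrable.1 (memLp_indicator_symbolMul hθ hU hTm hT 1)
  have hi' := memLp_one_iff_integrable.1 (memLp_indicator_symbolMul hθ hU hTm' hT' 1)
  have hd : Disjoint (band T) (band T') :=
    Set.disjoint_left.2 fun η h h' => Set.disjoint_left.1 hdis h h'
  have hu : band (T ∪ T') = band T ∪ band T' := rfl
  have h : (band (T ∪ T')).indicator (symbolMul p.toReal⁻¹ U) =
      (band T).indicator (symbolMul p.toReal⁻¹ U) + (band T').indicator (symbolMul p.toReal⁻¹ U) := by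
    rw [hu, Set.indicator_union_of_disjoint hd]
    rfl
  rw [h, fourierInv_add' hi hi']
  exact eLpNorm_add_le (continuous_fourierInv hi).aestronglyMeasurable
    (continuous_fourierInv hi').aestronglyMeasurable ((by norm_num : (1 : ℝ≥0∞) ≤ 2).trans hp)

theorem sqrt_mul_le {c : ℝ≥0} {b : ℝ≥0} (hb : b ≤ c ^ 2) (x : ℝ≥0∞) :
    (b * x) ^ (1 / 2 : ℝ) ≤ c * x ^ (1 / 2 : ℝ) := by
  calc _ ≤ ((c : ℝ≥0∞) ^ (2 : ℝ) * x) ^ (1 / 2 : ℝ) := by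
        gcongr
        rw [ENNReal.rpow_ofNat]
        exact_mod_cast hb
    _ = _ := by
        rw [ENNReal.mul_rpow_of_nonneg _ _ (by norm_num), ← ENNReal.rpow_mul]
        norm_num

theorem eLpNorm_fourierInv_low_le {U : ℝ → ℂ} (hU : Continuous U) {p : ℝ≥0∞} (hp : 2 ≤ p) (K : ℕ) :
    eLpNorm (𝓕⁻ ((band {t | |t| < 1}).indicator (symbolMul p.toReal⁻¹ U))) p ≤
      (3 : ℝ≥0) * (∑ k ∈ Finset.range K, (ENNReal.ofReal ((1 / 2) ^ (k + 1)) *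
        ∫⁻ t in {t : ℝ | (1 / 2) ^ (k + 1) ≤ |t| ∧ |t| ≤ 2 * (1 / 2) ^ (k + 1)},
          ‖U ((2 * Real.pi)⁻¹ * t)‖ₑ ^ 2) ^ (1 / 2 : ℝ)) +
      eLpNorm (𝓕⁻ ((band {t | |t| < (1 / 2) ^ K}).indicator (symbolMul p.toReal⁻¹ U))) p := by
  induction K with
  | zero => simp
  | succ K ih =>
    refine ih.trans ?_
    rw [Finset.sum_range_succ, mul_add, add_assoc]
    gcongr
    have hpos : (0 : ℝ) < (1 / 2) ^ (K + 1) := by positivity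
    have he : (1 / 2 : ℝ) ^ K = 2 * (1 / 2) ^ (K + 1) := by rw [pow_succ]; ring
    have hsplit : {t : ℝ | |t| < (1 / 2) ^ K} =
        {t | (1 / 2) ^ (K + 1) ≤ |t| ∧ |t| < (1 / 2) ^ K} ∪ {t | |t| < (1 / 2) ^ (K + 1)} := by
      ext t
      simp only [Set.mem_ofPred_eq, Set.mem_union]
      constructor
      · intro h
        rcases le_or_gt ((1 / 2) ^ (K + 1)) |t| with h' | h'
        · exact Or.inl ⟨h', h⟩
        · exact Or.inr h'
      · rintro (h | h)
        · exact h.2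
        · linarith
    have hm1 : MeasurableSet {t : ℝ | (1 / 2) ^ (K + 1) ≤ |t| ∧ |t| < (1 / 2) ^ K} := by measurability
    have hm2 : MeasurableSet {t : ℝ | |t| < (1 / 2) ^ (K + 1)} := by measurability
    rw [hsplit]
    refine (eLpNorm_fourierInv_band_union_le hU hp hm1 hm2 (d := (1 / 2) ^ K)
      (fun t ht => ht.2.le) (fun t ht => ?_) ?_).trans ?_
    · have : |t| < (1 / 2) ^ (K + 1) := ht
      linarith
    · exact Set.disjoint_left.2 fun t h h' => not_lt.2 h.1 h'
    · gcongr
      refine (eLpNorm_fourierInv_band_le hU hp hm1 (d := (1 / 2) ^ K) (by positivity)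
        fun t ht => ht.2.le).trans ?_
      conv_lhs => rw [he, ENNReal.ofReal_mul (by norm_num), mul_assoc, ENNReal.ofReal_ofNat, ← he]
      -- The top of the band is twice the dyadic weight, at the price of `√2`. The constant 3 is
      -- chosen to accommodate also the `√5` of the highest band.
      refine le_trans ?_ (sqrt_mul_le (b := 2) (c := 3) (by norm_num) _)
      push_cast
      refine ENNReal.rpow_le_rpow ?_ (by norm_num)
      gcongr 2 * (_ * ?_)
      exact lintegral_mono_set fun t h => ⟨h.1, h.2.le.trans_eq he⟩

/-- The number `K` of bands is free, because everything below the last one is estimated at once. The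
bound 5 is the sum of the diameter of the circle and the radius 3 of the cutoff's frequency support.
-/
theorem eLpNorm_fourierInv_symbolMul_le {U : ℝ → ℂ} (hU : Continuous U)
    (hU5 : ∀ η, 5 < |2 * Real.pi * η| → U η = 0) {p : ℝ≥0∞} (hp : 2 ≤ p) (K : ℕ) :
    eLpNorm (𝓕⁻ (symbolMul p.toReal⁻¹ U)) p ≤
      (3 : ℝ≥0) * besovNorm K (fun t => ‖U ((2 * Real.pi)⁻¹ * t)‖ₑ ^ 2) := by
  have hm1 : MeasurableSet {t : ℝ | 1 ≤ |t| ∧ |t| ≤ 5} := by measurability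
  have hm2 : MeasurableSet {t : ℝ | |t| < 1} := by measurability
  have hm3 : MeasurableSet {t : ℝ | |t| < (1 / 2) ^ K} := by measurability
  have hfull : (band ({t : ℝ | 1 ≤ |t| ∧ |t| ≤ 5} ∪ {t | |t| < 1})).indicator
      (symbolMul p.toReal⁻¹ U) = symbolMul p.toReal⁻¹ U := by
    rw [Set.indicator_eq_self]
    intro η hη
    rcases lt_or_ge |2 * Real.pi * η| 1 with h | h
    · exact Or.inr h
    · refine Or.inl ⟨h, not_lt.1 fun h5 => hη ?_⟩
      rw [symbolMul, hU5 η h5, mul_zero]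
  rw [← hfull]
  refine (eLpNorm_fourierInv_band_union_le hU hp hm1 hm2 (d := 5) (fun t ht => ht.2)
    (fun t ht => ?_) ?_).trans ?_
  · have : |t| < 1 := ht
    linarith
  · exact Set.disjoint_left.2 fun t h h' => not_lt.2 h.1 h'
  · unfold besovNorm
    rw [mul_add, mul_add, add_assoc]
    refine add_le_add ?_ ((eLpNorm_fourierInv_low_le hU hp K).trans (add_le_add le_rfl ?_))
    · refine (eLpNorm_fourierInv_band_le hU hp hm1 (d := 5) (by norm_num) fun t ht => ht.2).trans ?_
      refine le_trans ?_ (sqrt_mul_le (b := 5) (c := 3) (by norm_num) _)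
      rw [ENNReal.ofReal_ofNat]
      push_cast
      gcongr with t
      exact fun h => h.1
    · refine (eLpNorm_fourierInv_band_le hU hp hm3 (d := (1 / 2) ^ K) (by positivity)
        fun t ht => le_of_lt ht).trans ?_
      refine le_trans ?_ (sqrt_mul_le (b := 1) (c := 3) (by norm_num) _)
      rw [ENNReal.coe_one, one_mul]
      gcongr with t
      exact le_of_lt

/-! ### X-ray transforms of Schwartz functions -/

theorem norm_sq_lineCoords (ω : UnitCircle) (v s : ℝ) :
    ‖v • perp (ω : Plane) + s • (ω : Plane)‖ ^ 2 = v ^ 2 + s ^ 2 := by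
  rw [norm_add_sq_real, norm_smul, norm_smul, norm_perp_coe, norm_coe, inner_smul_left,
    inner_smul_right, inner_perp_self]
  simp

/-- The X-ray transform of a complex-valued function. -/
def lineIntegral (P : Plane → ℂ) (ω : UnitCircle) (v : ℝ) : ℂ :=
  ∫ s : ℝ, P (v • perp (ω : Plane) + s • (ω : Plane))

theorem coe_xray (f : Plane → ℝ) (ω : UnitCircle) (v : ℝ) :
    (xray f ω v : ℂ) = lineIntegral (fun x => (f x : ℂ)) ω v := integral_ofReal.symm

/-- The restriction of a Schwartz function to the line spanned by `perp ω`. -/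
def restrictLine (ω : UnitCircle) : 𝓢(Plane, ℂ) →L[ℂ] 𝓢(ℝ, ℂ) :=
  SchwartzMap.compCLMOfAntilipschitz ℂ (g := fun η : ℝ => η • perp (ω : Plane)) (K := 1)
    (by fun_prop) (AntilipschitzWith.of_le_mul_dist fun x y => by
      rw [dist_eq_norm, dist_eq_norm, ← sub_smul, norm_smul, norm_perp_coe]; simp)

theorem restrictLine_apply (ω : UnitCircle) (P : 𝓢(Plane, ℂ)) (η : ℝ) :
    restrictLine ω P η = P (η • perp (ω : Plane)) := rfl

/-- Decay of order four in `|x|` splits into quadratic decay in each coordinate, with a constant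
independent of `ω`. This yields joint continuity of the line integrals and their integrability in
`v`. -/
theorem exists_norm_le_lineCoords (P : 𝓢(Plane, ℂ)) : ∃ C : ℝ, 0 ≤ C ∧ ∀ (ω : UnitCircle) (v s : ℝ),
    ‖P (v • perp (ω : Plane) + s • (ω : Plane))‖ ≤ C * (1 + v ^ 2)⁻¹ * (1 + s ^ 2)⁻¹ := by
  refine ⟨2 ^ 4 * (Finset.Iic (4, 0)).sup (fun m => SchwartzMap.seminorm ℝ m.1 m.2) P,
    by positivity, fun ω v s => ?_⟩
  have h := SchwartzMap.one_add_le_sup_seminorm_apply (𝕜 := ℝ) (m := (4, 0)) le_rfl le_rfl P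
    (v • perp (ω : Plane) + s • (ω : Plane))
  rw [norm_iteratedFDeriv_zero] at h
  have h2 := norm_sq_lineCoords ω v s
  set x := v • perp (ω : Plane) + s • (ω : Plane)
  have h3 : (1 + v ^ 2) * (1 + s ^ 2) ≤ (1 + ‖x‖) ^ 4 := by
    have h4 : (1 + v ^ 2) * (1 + s ^ 2) ≤ (1 + ‖x‖ ^ 2) ^ 2 := by
      rw [h2]; nlinarith [sq_nonneg v, sq_nonneg s, sq_nonneg (v ^ 2), sq_nonneg (s ^ 2),
        mul_nonneg (sq_nonneg v) (sq_nonneg s)]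
    have h5 : 1 + ‖x‖ ^ 2 ≤ (1 + ‖x‖) ^ 2 := by nlinarith [norm_nonneg x]
    calc _ ≤ _ := h4
      _ ≤ ((1 + ‖x‖) ^ 2) ^ 2 := by gcongr
      _ = _ := by ring
  rw [mul_assoc, ← mul_inv, ← div_eq_mul_inv, le_div_iff₀ (by positivity), mul_comm]
  exact (mul_le_mul_of_nonneg_right h3 (norm_nonneg _)).trans h

theorem continuous_uncurry_lineIntegral (P : 𝓢(Plane, ℂ)) :
    Continuous fun q : UnitCircle × ℝ => lineIntegral P q.1 q.2 := by
  obtain ⟨C, hC, h⟩ := exists_norm_le_lineCoords P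
  have hP := P.continuous
  have hp := continuous_perp
  refine continuous_of_dominated (bound := fun s => C * (1 + s ^ 2)⁻¹) (fun q => ?_) (fun q => ?_)
    (integrable_inv_one_add_sq.const_mul C) ?_
  · exact Continuous.aestronglyMeasurable (by fun_prop)
  · refine .of_forall fun s => (h q.1 q.2 s).trans ?_
    gcongr
    exact mul_le_of_le_one_right hC (inv_le_one_of_one_le₀ (by nlinarith [sq_nonneg q.2]))
  · exact .of_forall fun s => by fun_prop

theorem continuous_lineIntegral (P : 𝓢(Plane, ℂ)) (ω : UnitCircle) :
    Continuous (lineIntegral P ω) :=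
  (continuous_uncurry_lineIntegral P).comp (by fun_prop : Continuous fun v : ℝ => (ω, v))

theorem exists_norm_lineIntegral_le (P : 𝓢(Plane, ℂ)) : ∃ C : ℝ, 0 ≤ C ∧ ∀ (ω : UnitCircle) (v : ℝ),
    ‖lineIntegral P ω v‖ ≤ C * (1 + v ^ 2)⁻¹ := by
  obtain ⟨C, hC, h⟩ := exists_norm_le_lineCoords P
  refine ⟨C * Real.pi, by positivity, fun ω v => ?_⟩
  refine (norm_integral_le_of_norm_le (integrable_inv_one_add_sq.const_mul (C * (1 + v ^ 2)⁻¹))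
    (.of_forall fun s => h ω v s)).trans (le_of_eq ?_)
  rw [integral_const_mul, integral_univ_inv_one_add_sq]
  ring

theorem integrable_lineIntegral (P : 𝓢(Plane, ℂ)) (ω : UnitCircle) :
    Integrable (lineIntegral P ω) := by
  obtain ⟨C, -, h⟩ := exists_norm_lineIntegral_le P
  exact (integrable_inv_one_add_sq.const_mul C).mono' (continuous_lineIntegral P ω).aestronglyMeasurable
    (.of_forall fun v => h ω v)

theorem inner_lineCoords_perp (ω : UnitCircle) (v s η : ℝ) :
    inner ℝ (v • perp (ω : Plane) + s • (ω : Plane)) (η • perp (ω : Plane)) = v * η := by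
  rw [inner_add_left, inner_smul_left, inner_smul_left, inner_smul_right, inner_smul_right,
    real_inner_self_eq_norm_sq, norm_perp_coe, real_inner_comm, inner_perp_self]
  simp

/-- The Fourier slice theorem. -/
theorem fourier_lineIntegral (P : 𝓢(Plane, ℂ)) (ω : UnitCircle) (η : ℝ) :
    𝓕 (lineIntegral P ω) η = 𝓕 P (η • perp (ω : Plane)) := by
  rw [SchwartzMap.fourier_coe, Real.fourier_eq, Real.fourier_eq, integral_lineCoords ω]
  · refine integral_congr_ae (.of_forall fun v => ?_)
    simp only [inner_lineCoords_perp, lineIntegral, Circle.smul_def, smul_eq_mul]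
    rw [integral_const_mul]
    simp [mul_comm]
  · exact (Real.fourierIntegral_convergent_iff _).2 P.integrable

theorem lineIntegral_eq_fourierInv (P : 𝓢(Plane, ℂ)) (ω : UnitCircle) :
    lineIntegral P ω = 𝓕⁻ (restrictLine ω (𝓕 P) : ℝ → ℂ) := by
  have h : 𝓕 (lineIntegral P ω) = restrictLine ω (𝓕 P) := funext fun η => fourier_lineIntegral P ω η
  rw [← h]
  refine ((continuous_lineIntegral P ω).fourierInv_fourier_eq (integrable_lineIntegral P ω) ?_).symm
  rw [h]
  exact SchwartzMap.integrable _

theorem integrable_symbolMul {θ : ℝ} (hθ : 0 ≤ θ) (hθ1 : θ ≤ 1) (φ : 𝓢(ℝ, ℂ)) :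
    Integrable (symbolMul θ φ) := by
  have h0 : Integrable (fun η : ℝ => ‖φ η‖ + 2 * Real.pi * (‖η‖ ^ 1 * ‖φ η‖)) :=
    φ.integrable.norm.add ((φ.integrable_pow_mul volume 1).const_mul _)
  refine h0.mono' (continuous_symbolMul hθ φ.continuous).aestronglyMeasurable (.of_forall fun η => ?_)
  rw [symbolMul, norm_mul, Complex.norm_real, Real.norm_of_nonneg (by positivity)]
  have h : |2 * Real.pi * η| ^ θ ≤ 1 + |2 * Real.pi * η| := by
    calc _ ≤ (1 + |2 * Real.pi * η|) ^ θ := by gcongr; linarith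
      _ ≤ (1 + |2 * Real.pi * η|) ^ (1 : ℝ) :=
        Real.rpow_le_rpow_of_exponent_le (by linarith [abs_nonneg (2 * Real.pi * η)]) hθ1
      _ = _ := Real.rpow_one _
  calc _ ≤ (1 + |2 * Real.pi * η|) * ‖φ η‖ := by gcongr
    _ = _ := by rw [abs_mul, abs_of_pos Real.two_pi_pos, Real.norm_eq_abs]; ring

theorem fracLapSchwartz_eq (s : ℝ) (φ : 𝓢(ℝ, ℂ)) :
    fracLapSchwartz s φ = 𝓕⁻ (symbolMul (2 * s) (𝓕 φ : 𝓢(ℝ, ℂ))) := rfl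

/-- The fractional Laplacian of an inverse Fourier transform, tested against Schwartz functions. -/
theorem integral_mul_fracLapSchwartz {s : ℝ} (hs : 0 ≤ s) (hs1 : 2 * s ≤ 1) (W φ : 𝓢(ℝ, ℂ)) :
    ∫ v, 𝓕⁻ (W : ℝ → ℂ) v * fracLapSchwartz s φ v = ∫ v, 𝓕⁻ (symbolMul (2 * s) W) v * φ v := by
  have hW : Integrable (𝓕⁻ (W : ℝ → ℂ)) := by
    rw [← SchwartzMap.fourierInv_coe]; exact SchwartzMap.integrable _
  have h1 := integral_fourierInv_mul_eq_flip
    (integrable_symbolMul (by linarith : 0 ≤ 2 * s) hs1 (𝓕 φ : 𝓢(ℝ, ℂ))) hW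
  have h2 := integral_fourierInv_mul_eq_flip
    (integrable_symbolMul (by linarith : 0 ≤ 2 * s) hs1 W) φ.integrable
  rw [fracLapSchwartz_eq, h2]
  calc _ = _ := by simp only [mul_comm]
    _ = _ := h1
    _ = _ := by
      rw [← integral_neg_eq_self]
      refine integral_congr_ae (.of_forall fun η => ?_)
      have e1 : 𝓕⁻ (𝓕⁻ (W : ℝ → ℂ)) (-η) = W η := by
        rw [Real.fourierInv_eq_fourier_neg, neg_neg, ← SchwartzMap.fourierInv_coe,
          ← SchwartzMap.fourier_coe, FourierTransform.fourier_fourierInv_eq]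
      have e2 : (𝓕 φ : 𝓢(ℝ, ℂ)) (-η) = 𝓕⁻ (φ : ℝ → ℂ) η := by
        rw [Real.fourierInv_eq_fourier_neg, SchwartzMap.fourier_coe]
      simp only [symbolMul, e1, e2, mul_neg, abs_neg]
      ring

theorem conj_fourier_of_real {V : Type*} [NormedAddCommGroup V] [InnerProductSpace ℝ V]
    [MeasurableSpace V] [BorelSpace V] [FiniteDimensional ℝ V] {P : V → ℂ}
    (hP : ∀ x, (starRingEnd ℂ) (P x) = P x) (ξ : V) :
    (starRingEnd ℂ) (𝓕 P ξ) = 𝓕 P (-ξ) := by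
  rw [Real.fourier_eq', Real.fourier_eq', ← integral_conj]
  refine integral_congr_ae (.of_forall fun x => ?_)
  simp only [smul_eq_mul, map_mul, hP, ← Complex.exp_conj, Complex.conj_I, Complex.conj_ofReal,
    inner_neg_right]
  push_cast
  ring_nf

/-- Together with `conj_fourier_of_real`, this shows that the fractional derivative of a real
function is real, as `IsFracLap` requires. -/
theorem conj_fourierInv_of_symm {F : ℝ → ℂ} (hF : ∀ η, (starRingEnd ℂ) (F η) = F (-η)) (v : ℝ) :
    (starRingEnd ℂ) (𝓕⁻ F v) = 𝓕⁻ F v := by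
  rw [Real.fourierInv_eq', ← integral_conj, ← integral_neg_eq_self]
  refine integral_congr_ae (.of_forall fun x => ?_)
  simp only [smul_eq_mul, map_mul, hF, ← Complex.exp_conj, Complex.conj_I, Complex.conj_ofReal,
    inner_neg_left, neg_neg]
  push_cast
  ring_nf

/-- By the slice theorem the multiplier acts on the restriction of `𝓕 P` to a line. The resulting
function is a candidate in the infimum defining `fracLapNorm`, and its norm is controlled by the sum
over bands. -/
theorem fracLapNorm_xray_le {f : Plane → ℝ} {P : 𝓢(Plane, ℂ)} (hfP : ∀ x, P x = (f x : ℂ))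
    (ω : UnitCircle) (hP : ∀ η : ℝ, 5 < |2 * Real.pi * η| → 𝓕 P (η • perp (ω : Plane)) = 0)
    {p : ℝ≥0∞} (hp : 2 ≤ p) (K : ℕ) :
    fracLapNorm (p.toReal⁻¹ / 2) p (xray f ω) ≤ (3 : ℝ≥0) * besovNorm K
      (fun t => ‖𝓕 P ((2 * Real.pi)⁻¹ • t • perp (ω : Plane))‖ₑ ^ 2) := by
  set θ := p.toReal⁻¹ with hθd
  have hθ : 0 ≤ θ := by positivity
  have hθ1 : θ ≤ 1 := by
    by_cases hpt : p = ∞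
    · simp [hθd, hpt]
    · have hpr : 1 ≤ p.toReal := by
        rw [← ENNReal.toReal_one]
        exact ENNReal.toReal_mono hpt ((by norm_num : (1 : ℝ≥0∞) ≤ 2).trans hp)
      exact inv_le_one_of_one_le₀ hpr
  set U := restrictLine ω (𝓕 P)
  have hle := eLpNorm_fourierInv_symbolMul_le (U := U) U.continuous hP hp K
  have hb : besovNorm K (fun t => ‖U ((2 * Real.pi)⁻¹ * t)‖ₑ ^ 2) =
      besovNorm K (fun t => ‖𝓕 P ((2 * Real.pi)⁻¹ • t • perp (ω : Plane))‖ₑ ^ 2) := by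
    simp only [U, restrictLine_apply, mul_smul]
  rw [hb] at hle
  by_cases hfin : besovNorm K (fun t => ‖𝓕 P ((2 * Real.pi)⁻¹ • t • perp (ω : Plane))‖ₑ ^ 2) = ∞
  · rw [hfin, ENNReal.mul_top (by norm_num)]
    exact le_top
  have hu : ∀ v, ((xray f ω v : ℝ) : ℂ) = 𝓕⁻ (U : ℝ → ℂ) v := by
    intro v
    rw [coe_xray, ← lineIntegral_eq_fourierInv]
    simp only [← hfP]
  have hUi : Integrable (𝓕⁻ (U : ℝ → ℂ)) := by
    rw [← SchwartzMap.fourierInv_coe]; exact SchwartzMap.integrable _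
  have hsymm : ∀ η, (starRingEnd ℂ) (symbolMul θ U η) = symbolMul θ U (-η) := by
    intro η
    have h1 : (starRingEnd ℂ) (U η) = U (-η) := by
      simp only [U, restrictLine_apply, neg_smul, SchwartzMap.fourier_coe]
      exact conj_fourier_of_real (fun x => by rw [hfP, Complex.conj_ofReal]) _
    rw [symbolMul, map_mul, Complex.conj_ofReal, h1, symbolMul, mul_neg, abs_neg]
  set h : ℝ → ℝ := fun v => (𝓕⁻ (symbolMul θ U) v).re
  have hh : ∀ v, (h v : ℂ) = 𝓕⁻ (symbolMul θ U) v := fun v =>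
    Complex.conj_eq_iff_re.1 (conj_fourierInv_of_symm hsymm v)
  have hnorm : eLpNorm h p = eLpNorm (𝓕⁻ (symbolMul θ U)) p := by
    refine eLpNorm_congr_norm_ae (.of_forall fun v => ?_)
    rw [← hh, Complex.norm_real]
  have hmem : MemLp h p := by
    refine ⟨?_, ?_⟩
    · exact (Complex.continuous_re.comp (continuous_fourierInv
        (integrable_symbolMul hθ hθ1 U))).aestronglyMeasurable
    · rw [hnorm]
      exact hle.trans_lt (ENNReal.mul_lt_top (by norm_num) (lt_top_iff_ne_top.2 hfin))
  refine (iInf₂_le h ⟨hmem, ?_, fun φ => ?_⟩).trans (hnorm.trans_le hle)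
  · have hxi : Integrable (xray f ω) := by
      have : Integrable (fun v => (𝓕⁻ (U : ℝ → ℂ) v).re) := hUi.re
      simpa only [← hu, Complex.ofReal_re] using this
    refine hxi.mul_bdd (c := 1) ?_ (.of_forall fun v => ?_)
    · refine Continuous.aestronglyMeasurable ?_
      exact (by fun_prop : Continuous fun v : ℝ => 1 + |v|).rpow_const
        fun v => Or.inl (by positivity)
    · rw [Real.norm_of_nonneg (by positivity)]
      exact Real.rpow_le_one_of_one_le_of_nonpos (by linarith [abs_nonneg v]) (by linarith)
  · simp only [hu, hh]
    have h2 : 2 * (θ / 2) = θ := by ring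
    rw [integral_mul_fracLapSchwartz (by positivity) (by rw [h2]; exact hθ1), h2]

/-! ### Frequency supports of products and the reduced X-ray estimate -/

theorem fourier_mul_apply {V : Type*} [NormedAddCommGroup V] [InnerProductSpace ℝ V]
    [MeasurableSpace V] [BorelSpace V] [FiniteDimensional ℝ V] (f g : 𝓢(V, ℂ)) (ξ : V) :
    𝓕 (fun x => f x * g x) ξ = ∫ ζ, 𝓕 f ζ * 𝓕 g (ξ - ζ) := by
  have hg : Integrable (fun x => Real.fourierChar (-inner ℝ x ξ) • g x) :=
    (Real.fourierIntegral_convergent_iff ξ).2 g.integrable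
  have h := integral_fourierInv_mul_eq_flip (𝓕 f).integrable hg
  rw [Real.fourier_eq]
  calc _ = ∫ x, 𝓕⁻ ((𝓕 f : 𝓢(V, ℂ)) : V → ℂ) x * (Real.fourierChar (-inner ℝ x ξ) • g x) := by
        refine integral_congr_ae (.of_forall fun x => ?_)
        simp only
        rw [← SchwartzMap.fourierInv_coe, FourierTransform.fourierInv_fourier_eq]
        simp only [Circle.smul_def, smul_eq_mul]
        ring
    _ = _ := by
        rw [h]
        refine integral_congr_ae (.of_forall fun ζ => ?_)
        simp only
        rw [Real.fourierInv_eq, SchwartzMap.fourier_coe g, Real.fourier_eq]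
        congr 1
        refine integral_congr_ae (.of_forall fun x => ?_)
        simp only [Circle.smul_def, smul_eq_mul]
        rw [← mul_assoc, ← Circle.coe_mul, ← AddChar.map_add_eq_mul, inner_sub_right]
        ring_nf

/-- The product of two Schwartz functions. -/
def schwartzMul (f g : 𝓢(Plane, ℂ)) : 𝓢(Plane, ℂ) :=
  SchwartzMap.pairing (ContinuousLinearMap.mul ℂ ℂ) f g

theorem schwartzMul_apply (f g : 𝓢(Plane, ℂ)) (x : Plane) : schwartzMul f g x = f x * g x := rfl

theorem fourier_schwartzMul_eq_zero {f g : 𝓢(Plane, ℂ)} {a b : ℝ}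
    (hf : ∀ ζ : Plane, a < ‖(2 * Real.pi) • ζ‖ → 𝓕 f ζ = 0)
    (hg : ∀ ζ : Plane, b < ‖(2 * Real.pi) • ζ‖ → 𝓕 g ζ = 0) (ζ : Plane)
    (hζ : a + b < ‖(2 * Real.pi) • ζ‖) : 𝓕 (schwartzMul f g) ζ = 0 := by
  have h : (schwartzMul f g : Plane → ℂ) = fun x => f x * g x := rfl
  rw [SchwartzMap.fourier_coe, h, fourier_mul_apply]
  refine integral_eq_zero_of_ae (.of_forall fun η => ?_)
  by_cases h1 : a < ‖(2 * Real.pi) • η‖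
  · simp [hf η h1]
  · have h2 : b < ‖(2 * Real.pi) • (ζ - η)‖ := by
      have := norm_add_le ((2 * Real.pi) • (ζ - η)) ((2 * Real.pi) • η)
      rw [← smul_add, sub_add_cancel] at this
      linarith
    simp [hg _ h2]

/-- A real Schwartz function, viewed as a complex one. -/
def complexify (ψ : 𝓢(Plane, ℝ)) : 𝓢(Plane, ℂ) := SchwartzMap.postcompCLM Complex.ofRealCLM ψ

theorem complexify_apply (ψ : 𝓢(Plane, ℝ)) (x : Plane) : complexify ψ x = (ψ x : ℂ) := rfl

theorem IsProfile.fourier_complexify_eq_zero {ψ : 𝓢(Plane, ℝ)} (hψ : IsProfile ψ) (ζ : Plane)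
    (hζ : 1 < ‖(2 * Real.pi) • ζ‖) : 𝓕 (complexify ψ) ζ = 0 := by
  rw [SchwartzMap.fourier_coe, Real.fourier_eq', ← hψ.fourier_support _ hζ]
  refine integral_congr_ae (.of_forall fun x => ?_)
  simp only [complexify_apply, smul_eq_mul, inner_smul_right]
  push_cast
  ring_nf

theorem fourier_truncSchwartz_eq_zero {Γ : 𝓢(Plane, ℂ)} {g : UnitCircle → ℂ}
    (hg : Integrable g surf) {r : ℝ} (hΓ : ∀ ζ : Plane, r < ‖(2 * Real.pi) • ζ‖ → 𝓕 Γ ζ = 0)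
    (ζ : Plane) (hζ : 2 + r < ‖(2 * Real.pi) • ζ‖) : 𝓕 (truncSchwartz Γ g) ζ = 0 := by
  rw [fourier_truncSchwartz Γ hg]
  refine integral_eq_zero_of_ae (.of_forall fun q => ?_)
  simp only
  rw [hΓ, mul_zero, Pi.zero_apply]
  rw [smul_sub, smul_inv_smul₀ Real.two_pi_pos.ne']
  have h1 := norm_sub_le (q.1 : Plane) q.2
  have h2 := norm_sub_norm_le ((2 * Real.pi) • ζ) ((q.1 : Plane) - q.2)
  rw [norm_coe, norm_coe] at h1
  linarith

theorem BandLimited.fourier_dilate_eq_zero {γ : 𝓢(Plane, ℂ)} (hγ : BandLimited γ) {R : ℝ}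
    (hR : 1 ≤ R) (ζ : Plane) (hζ : 3 < ‖(2 * Real.pi) • ζ‖) :
    𝓕 (dilate γ (one_pos.trans_le hR)) ζ = 0 := by
  rw [fourier_dilate, hγ, smul_zero]
  rw [smul_comm, norm_smul, Real.norm_of_nonneg (by linarith)]
  nlinarith

/-- The sum over all lines of the Besov norms of the X-ray transform of a truncated extension. -/
theorem BandLimited.exists_besovNorm_le {γ : 𝓢(Plane, ℂ)} (hγ : BandLimited γ) : ∃ C : ℝ≥0,
    ∀ (R : ℝ) (hR : 1 ≤ R), ∃ K : ℕ, ∀ g : UnitCircle → ℂ, MemLp g 2 surf →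
      ∫⁻ ω : UnitCircle, besovNorm K (fun t => ‖𝓕 (truncSchwartz (dilate γ (one_pos.trans_le hR)) g)
          ((2 * Real.pi)⁻¹ • t • perp (ω : Plane))‖ₑ ^ 2) ∂surf
        ≤ C * ENNReal.ofReal (1 + Real.log R) * eLpNorm g 2 surf ^ 2 := by
  obtain ⟨A, hA⟩ := hγ.enorm_fourier_dilate_le
  refine ⟨5 * 10 ^ 7 * A, fun R hR => ?_⟩
  obtain ⟨K, -, h⟩ := exists_besovNorm_truncSchwartz_le hR
  refine ⟨K, fun g hg => (h _ A (hA R _) g hg).trans (le_of_eq ?_)⟩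
  rw [ENNReal.ofReal_mul (by norm_num), ENNReal.ofReal_pow (by norm_num)]
  norm_num

theorem BandLimited.fracLapNorm_xray_le {γ : 𝓢(Plane, ℂ)} (hγ : BandLimited γ) {R : ℝ} (hR : 1 ≤ R)
    {g : UnitCircle → ℂ} (hg : MemLp g 2 surf) {f : Plane → ℝ}
    (hf : ∀ x, (f x : ℂ) = γ (R⁻¹ • x) * ((‖extension g x‖ ^ 2 : ℝ) : ℂ)) (ω : UnitCircle)
    {p : ℝ≥0∞} (hp : 2 ≤ p) (K : ℕ) :
    fracLapNorm (p.toReal⁻¹ / 2) p (xray f ω) ≤ (3 : ℝ≥0) * besovNorm K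
      (fun t => ‖𝓕 (truncSchwartz (dilate γ (one_pos.trans_le hR)) g)
        ((2 * Real.pi)⁻¹ • t • perp (ω : Plane))‖ₑ ^ 2) := by
  have hgi : Integrable g surf := hg.integrable (by norm_num)
  refine MizohataTakeuchi.fracLapNorm_xray_le (fun x => ?_) ω (fun η hη => ?_) hp K
  · rw [truncSchwartz_apply hgi, hf, dilate_apply]
  · refine fourier_truncSchwartz_eq_zero hgi (hγ.fourier_dilate_eq_zero hR) _ ?_
    rw [smul_smul, norm_smul, norm_perp_coe, mul_one, Real.norm_eq_abs]
    linarith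

/-- The cube of the profile has frequency support of radius `1 + 1 + 1`. The constant is obtained
before `p`, so it is uniform in the exponent. -/
theorem xrayNormOne_truncatedSq_le {ψ : 𝓢(Plane, ℝ)} (hψ : IsProfile ψ) : ∃ C : ℝ≥0,
    ∀ p : ℝ≥0∞, 2 ≤ p → ∀ R : ℝ, 1 ≤ R → ∀ g : UnitCircle → ℂ, MemLp g 2 surf →
      xrayNormOne (p.toReal⁻¹ / 2) p (truncatedSq ψ R g) ≤
        C * ENNReal.ofReal (1 + Real.log R) * eLpNorm g 2 surf ^ 2 := by
  set γ := schwartzMul (schwartzMul (complexify ψ) (complexify ψ)) (complexify ψ)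
  have hψ1 := hψ.fourier_complexify_eq_zero
  have hγ : BandLimited γ := fun ζ hζ => by
    refine fourier_schwartzMul_eq_zero (a := 1 + 1) (fourier_schwartzMul_eq_zero hψ1 hψ1) hψ1 ζ ?_
    linarith
  obtain ⟨C, hC⟩ := hγ.exists_besovNorm_le
  refine ⟨3 * C, fun p hp R hR g hg => ?_⟩
  obtain ⟨K, hK⟩ := hC R hR
  calc _ ≤ _ := lintegral_mono fun ω => hγ.fracLapNorm_xray_le hR hg (fun x => ?_) ω hp K
    _ ≤ _ := by
      rw [lintegral_const_mul' _ _ ENNReal.coe_ne_top, ENNReal.coe_mul, mul_assoc, mul_assoc,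
        ← mul_assoc (C : ℝ≥0∞)]
      gcongr
      exact hK g hg
  simp only [truncatedSq, cutoff, γ, schwartzMul_apply, complexify_apply]
  push_cast
  ring

/-! ### Logarithms against powers, and conjugate exponents -/

theorem one_add_log_le_rpow {R ε : ℝ} (hR : 1 ≤ R) (hε : 0 < ε) :
    1 + Real.log R ≤ (1 + ε⁻¹) * R ^ ε := by
  have h1 := Real.log_le_rpow_div (by linarith : 0 ≤ R) hε
  have h2 := Real.one_le_rpow hR hε.le
  rw [div_eq_mul_inv] at h1
  linarith

theorem one_add_log_le {R : ℝ} (hR : 2 ≤ R) : 1 + Real.log R ≤ 3 * Real.log R := by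
  have h1 := Real.log_le_log (by norm_num) hR
  have h2 := Real.log_two_gt_d9
  linarith

theorem ofReal_one_add_log_le_rpow {ε : ℝ} (hε : 0 < ε) : ∃ C : ℝ≥0, ∀ R : ℝ, 1 ≤ R →
    ENNReal.ofReal (1 + Real.log R) ≤ C * ENNReal.ofReal (R ^ ε) := by
  refine ⟨(1 + ε⁻¹).toNNReal, fun R hR => ?_⟩
  rw [← ENNReal.ofReal, ← ENNReal.ofReal_mul (by positivity)]
  exact ENNReal.ofReal_le_ofReal (one_add_log_le_rpow hR hε)

theorem ofReal_one_add_log_le {R : ℝ} (hR : 2 ≤ R) :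
    ENNReal.ofReal (1 + Real.log R) ≤ (3 : ℝ≥0) * ENNReal.ofReal (Real.log R) := by
  have h := ENNReal.ofReal_le_ofReal (one_add_log_le hR)
  rw [ENNReal.ofReal_mul (by norm_num)] at h
  simpa using h

theorem two_le_conjExponent {q : ℝ} (hq2 : q ≤ 2) :
    2 ≤ (ENNReal.ofReal q).conjExponent := by
  have h : ENNReal.ofReal q - 1 ≤ 1 := by
    rw [← ENNReal.ofReal_one, ← ENNReal.ofReal_sub _ (by norm_num)]
    exact ENNReal.ofReal_le_ofReal (by linarith)
  calc (2 : ℝ≥0∞) = 1 + 1 := by norm_num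
    _ ≤ _ := add_le_add le_rfl (ENNReal.one_le_inv.2 h)

theorem toReal_conjExponent_inv {q : ℝ} (h1 : 1 ≤ q) :
    (ENNReal.ofReal q).conjExponent.toReal⁻¹ = 1 - 1 / q := by
  have h : ENNReal.ofReal q - 1 = ENNReal.ofReal (q - 1) := by
    rw [ENNReal.ofReal_sub _ (by norm_num), ENNReal.ofReal_one]
  rw [ENNReal.conjExponent, h]
  rcases h1.eq_or_lt with rfl | hq
  -- For `q = 1` the conjugate exponent is `∞`; its `toReal` is `0`, whose inverse is again `0`, the
  -- desired value.
  · simp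
  · have h0 : 0 < q - 1 := by linarith
    rw [← ENNReal.ofReal_inv_of_pos h0, ← ENNReal.ofReal_one, ← ENNReal.ofReal_add (by norm_num)
      (by positivity), ENNReal.toReal_ofReal (by positivity)]
    field_simp
    ring

/-! ### Weights, plane waves and duality -/

/-- By the layer-cake formula: the superlevel set at height `t ≤ 1` lies in a strip of half-width `t
^ (-1/2) / r`, and `∫ t ^ (-1/2)` over the unit interval is `2`. -/
theorem lintegral_inv_one_add_sq_strip_le (e : UnitCircle) {r : ℝ} (hr : 0 < r) :
    ∫⁻ ω : UnitCircle, ENNReal.ofReal ((1 + (r * inner ℝ (perp (ω : Plane)) (e : Plane)) ^ 2)⁻¹) ∂surf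
      ≤ ENNReal.ofReal (16 / r) := by
  have hp := continuous_perp
  rw [lintegral_eq_lintegral_meas_le]
  · have hb : ∀ t ∈ Set.Ioi (0 : ℝ), surf {ω : UnitCircle |
        t ≤ (1 + (r * inner ℝ (perp (ω : Plane)) (e : Plane)) ^ 2)⁻¹} ≤
        (Set.Ioc (0 : ℝ) 1).indicator (fun t => ENNReal.ofReal (8 / r * t ^ (-(1 / 2) : ℝ))) t := by
      intro t ht
      have ht : 0 < t := ht
      by_cases h1 : t ≤ 1
      · rw [Set.indicator_of_mem (show t ∈ Set.Ioc (0 : ℝ) 1 from ⟨ht, h1⟩)]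
        have e1 : 8 / r * t ^ (-(1 / 2) : ℝ) = 8 * (t ^ (-(1 / 2) : ℝ) / r) := by ring
        rw [e1]
        refine le_trans (measure_mono fun ω hω => ?_) (surf_strip_perp_le e _)
        simp only [Set.mem_ofPred_eq] at hω ⊢
        rw [le_div_iff₀ hr]
        have h2 := (le_inv_comm₀ ht (by positivity)).1 hω
        have h3 : (t ^ (-(1 / 2) : ℝ)) ^ 2 = t⁻¹ := by
          rw [← Real.rpow_natCast, ← Real.rpow_mul ht.le, ← Real.rpow_neg_one]
          norm_num
        refine le_of_sq_le_sq ?_ (by positivity)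
        rw [h3, mul_pow, sq_abs]
        rw [mul_pow] at h2
        linarith
      · have : {ω : UnitCircle | t ≤ (1 + (r * inner ℝ (perp (ω : Plane)) (e : Plane)) ^ 2)⁻¹} = ∅ := by
          refine Set.eq_empty_of_forall_notMem fun ω hω => h1 (le_trans hω ?_)
          exact inv_le_one_of_one_le₀ (by nlinarith [sq_nonneg (r * inner ℝ (perp (ω : Plane)) (e : Plane))])
        rw [this]
        simp
    refine (setLIntegral_mono' measurableSet_Ioi hb).trans ?_
    refine (setLIntegral_le_lintegral _ _).trans ?_
    rw [lintegral_indicator measurableSet_Ioc]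
    have hi : IntervalIntegrable (fun t : ℝ => t ^ (-(1 / 2) : ℝ)) volume 0 1 :=
      intervalIntegral.intervalIntegrable_rpow' (by norm_num)
    have hi' : IntegrableOn (fun t : ℝ => 8 / r * t ^ (-(1 / 2) : ℝ)) (Set.Ioc 0 1) :=
      ((intervalIntegrable_iff_integrableOn_Ioc_of_le zero_le_one).1 hi).const_mul _
    rw [← ofReal_integral_eq_lintegral_ofReal hi', ← intervalIntegral.integral_of_le zero_le_one,
      intervalIntegral.integral_const_mul, integral_rpow (Or.inl (by norm_num))]
    · refine ENNReal.ofReal_le_ofReal (le_of_eq ?_)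
      norm_num
      ring
    · filter_upwards [ae_restrict_mem measurableSet_Ioc] with t ht
      have := ht.1
      positivity
  · exact .of_forall fun ω => by positivity
  · refine Measurable.aemeasurable ?_
    have := hp.measurable
    fun_prop

/-- The X-ray transform of the weight `(1 + v ^ 2)⁻¹` decays like that of an integrable function. -/
theorem exists_lintegral_inv_one_add_sq_inner_le : ∃ C : ℝ≥0, ∀ x : Plane,
    ∫⁻ ω : UnitCircle, ENNReal.ofReal ((1 + (inner ℝ (perp (ω : Plane)) x) ^ 2)⁻¹) ∂surf
      ≤ C * ENNReal.ofReal ((1 + ‖x‖)⁻¹) := by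
  have hfin : surf Set.univ ≠ ∞ := measure_ne_top _ _
  refine ⟨32 + 2 * (surf Set.univ).toNNReal, fun x => ?_⟩
  push_cast
  rw [ENNReal.coe_toNNReal hfin]
  rcases le_or_gt ‖x‖ 1 with hx | hx
  · calc _ ≤ ∫⁻ ω : UnitCircle, 1 ∂surf := by
          refine lintegral_mono fun ω => ?_
          rw [← ENNReal.ofReal_one]
          refine ENNReal.ofReal_le_ofReal (inv_le_one_of_one_le₀ ?_)
          nlinarith [sq_nonneg (inner ℝ (perp (ω : Plane)) x)]
      _ = 2 * surf Set.univ * ENNReal.ofReal (1 / 2) := by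
          have h : (2 : ℝ≥0∞) * ENNReal.ofReal (1 / 2) = 1 := by
            rw [← ENNReal.ofReal_ofNat, ← ENNReal.ofReal_mul (by norm_num)]
            norm_num
          rw [lintegral_one, mul_right_comm, h, one_mul]
      _ ≤ _ := by
          gcongr
          · exact le_add_self
          · rw [one_div]
            gcongr
            linarith
  · have hx0 : 0 < ‖x‖ := by linarith
    set e : UnitCircle := ⟨‖x‖⁻¹ • x, by
      rw [mem_sphere_zero_iff_norm, norm_smul, norm_inv, norm_norm, inv_mul_cancel₀ hx0.ne']⟩ with he
    have hxe : ∀ ω : UnitCircle, inner ℝ (perp (ω : Plane)) x =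
        ‖x‖ * inner ℝ (perp (ω : Plane)) (e : Plane) := by
      intro ω
      rw [← inner_smul_right, he]
      simp only
      rw [smul_inv_smul₀ hx0.ne']
    simp only [hxe]
    refine (lintegral_inv_one_add_sq_strip_le e hx0).trans ?_
    calc _ ≤ ENNReal.ofReal (32 * (1 + ‖x‖)⁻¹) := by
          refine ENNReal.ofReal_le_ofReal ?_
          rw [← div_eq_mul_inv, div_le_div_iff₀ hx0 (by positivity)]
          linarith
      _ ≤ _ := by
          rw [ENNReal.ofReal_mul (by norm_num), ENNReal.ofReal_ofNat]
          gcongr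
          exact le_self_add

/-- An even real bump function, as a complex Schwartz function. -/
def bumpSchwartz (β : ContDiffBump (0 : Plane)) : 𝓢(Plane, ℂ) :=
  HasCompactSupport.toSchwartzMap (f := fun x => ((β x : ℝ) : ℂ))
    (β.hasCompactSupport.comp_left Complex.ofReal_zero) (Complex.ofRealCLM.contDiff.comp β.contDiff)

theorem bumpSchwartz_apply (β : ContDiffBump (0 : Plane)) (x : Plane) :
    bumpSchwartz β x = (β x : ℂ) := rfl

theorem conj_fourier_bumpSchwartz (β : ContDiffBump (0 : Plane)) (ξ : Plane) :
    (starRingEnd ℂ) (𝓕 (bumpSchwartz β) ξ) = 𝓕 (bumpSchwartz β) ξ := by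
  rw [SchwartzMap.fourier_coe, conj_fourier_of_real (fun x => by
    rw [bumpSchwartz_apply, Complex.conj_ofReal]), ← Real.fourierInv_eq_fourier_neg,
    Real.fourierInv_eq', Real.fourier_eq', ← integral_neg_eq_self]
  refine integral_congr_ae (.of_forall fun x => ?_)
  simp [bumpSchwartz_apply, β.neg]

/-- There is a nonnegative band-limited Schwartz function that is positive on the unit ball. -/
theorem exists_bandLimited : ∃ (γ : 𝓢(Plane, ℂ)) (f : Plane → ℝ) (c : ℝ), BandLimited γ ∧
    (∀ x, γ x = (f x : ℂ)) ∧ (∀ x, 0 ≤ f x) ∧ 0 < c ∧ ∀ x, ‖x‖ ≤ 1 → c ≤ f x := by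
  have hpi := Real.pi_pos
  -- The outer radius `(2 * π)⁻¹` is one in angular frequency, so the square of the transform has
  -- frequency support of radius 2.
  set β : ContDiffBump (0 : Plane) :=
    ⟨(4 * Real.pi)⁻¹, (2 * Real.pi)⁻¹, by positivity, by gcongr; norm_num⟩ with hβ
  set B := 𝓕 (bumpSchwartz β) with hB
  have hBr : ∀ x, B x = ((B x).re : ℂ) := fun x =>
    (Complex.conj_eq_iff_re.1 (conj_fourier_bumpSchwartz β x)).symm
  have hB0 : 0 < (B 0).re := by
    have h : B 0 = ((∫ x, β x : ℝ) : ℂ) := by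
      rw [hB, SchwartzMap.fourier_coe, Real.fourier_eq', ← integral_complex_ofReal]
      simp [bumpSchwartz_apply]
    rw [h, Complex.ofReal_re]
    exact β.integral_pos
  have hBband : ∀ ζ : Plane, 1 < ‖(2 * Real.pi) • ζ‖ → 𝓕 B ζ = 0 := by
    intro ζ hζ
    have h : 𝓕 B ζ = bumpSchwartz β (-ζ) := by
      rw [SchwartzMap.fourier_coe, ← neg_neg ζ, ← Real.fourierInv_eq_fourier_neg, neg_neg,
        ← SchwartzMap.fourierInv_coe, hB, FourierTransform.fourierInv_fourier_eq]
    rw [h, bumpSchwartz_apply, β.zero_of_le_dist, Complex.ofReal_zero]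
    rw [dist_zero_right, norm_neg, hβ]
    rw [norm_smul, Real.norm_of_nonneg (by positivity)] at hζ
    rw [inv_le_iff_one_le_mul₀ (by positivity), mul_comm]
    exact hζ.le
  have hγ0 : BandLimited (schwartzMul B B) := fun ζ hζ =>
    fourier_schwartzMul_eq_zero hBband hBband ζ (by linarith)
  have hcont : Continuous fun x => (B x).re := Complex.continuous_re.comp B.continuous
  obtain ⟨δ, hδ, hδB⟩ := Metric.eventually_nhds_iff.1
    (hcont.tendsto 0 |>.eventually (lt_mem_nhds (half_lt_self hB0)))
  -- A dilation by `ρ⁻¹` spreads the neighbourhood of `0` on which the transform exceeds half its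
  -- central value over the unit ball. Since `ρ ≤ 1`, it only shrinks the frequency support.
  set ρ := min (δ / 2) 1 with hρd
  have hρ : 0 < ρ := by positivity
  have hρ1 : 1 ≤ ρ⁻¹ := (one_le_inv₀ hρ).2 (min_le_right _ _)
  refine ⟨dilate (schwartzMul B B) (one_pos.trans_le hρ1), fun x => (B (ρ • x)).re ^ 2,
    ((B 0).re / 2) ^ 2, fun ζ hζ => hγ0.fourier_dilate_eq_zero hρ1 ζ hζ, fun x => ?_,
    fun x => sq_nonneg _, by positivity, fun x hx => ?_⟩
  · rw [dilate_apply, inv_inv, schwartzMul_apply, hBr]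
    push_cast
    ring
  · have hd : dist (ρ • x) 0 < δ := by
      rw [dist_zero_right, norm_smul, Real.norm_of_nonneg hρ.le]
      calc ρ * ‖x‖ ≤ δ / 2 * 1 := by gcongr; exact min_le_left _ _
        _ < δ := by linarith
    exact pow_le_pow_left₀ (by positivity) (hδB hd).le 2

/-- The kernel `ε ^ 2 * 𝓕 b (ε y)` decays like `ε ^ 2 / (1 + ε |y|) ≤ ε / (1 + |y|)`, and
convolution with a Schwartz function preserves this decay. The low-frequency part is thus `O(ε)`
against the very factor `(1 + |x|)⁻¹` that a weight can integrate. -/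
theorem norm_fourierInv_dilate_mul_le (b G : 𝓢(Plane, ℂ)) : ∃ C : ℝ, 0 ≤ C ∧
    ∀ (ε : ℝ) (hε : 0 < ε), ε ≤ 1 → ∀ x : Plane,
      ‖𝓕⁻ (fun ζ => dilate b hε ζ * 𝓕 G ζ) x‖ ≤ C * ε * (1 + ‖x‖)⁻¹ := by
  set M := 2 ^ 1 * (Finset.Iic (1, 0)).sup (fun m => SchwartzMap.seminorm ℝ m.1 m.2) (𝓕 b)
  have hM0 : 0 ≤ M := by positivity
  have hM : ∀ x, (1 + ‖x‖) * ‖𝓕 b x‖ ≤ M := by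
    intro x
    have h := SchwartzMap.one_add_le_sup_seminorm_apply (𝕜 := ℝ) (m := (1, 0)) le_rfl le_rfl (𝓕 b) x
    rwa [norm_iteratedFDeriv_zero, pow_one] at h
  have hGi : Integrable (fun y => (1 + ‖y‖) * ‖G y‖) := by
    have h : Integrable (fun y => ‖G y‖ + ‖y‖ ^ 1 * ‖G y‖) :=
      G.integrable.norm.add (G.integrable_pow_mul volume 1)
    refine h.congr (.of_forall fun y => ?_)
    simp only
    ring
  refine ⟨M * ∫ y, (1 + ‖y‖) * ‖G y‖, by positivity, fun ε hε hε1 x => ?_⟩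
  rw [Real.fourierInv_eq_fourier_neg]
  have hFG : (fun ζ => dilate b hε ζ * 𝓕 G ζ) = fun ζ => dilate b hε ζ * (𝓕 G : 𝓢(Plane, ℂ)) ζ := rfl
  rw [hFG, fourier_mul_apply, ← div_eq_mul_inv, le_div_iff₀ (by positivity)]
  have hFF : ∀ y, 𝓕 (𝓕 G) y = G (-y) := by
    intro y
    rw [SchwartzMap.fourier_coe, ← neg_neg y, ← Real.fourierInv_eq_fourier_neg, neg_neg,
      ← SchwartzMap.fourierInv_coe, FourierTransform.fourierInv_fourier_eq]
  have hbound : ∀ y, ‖𝓕 (dilate b hε) y * 𝓕 (𝓕 G) (-x - y)‖ * (1 + ‖x‖) ≤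
      M * ε * ((1 + ‖x + y‖) * ‖G (x + y)‖) := by
    intro y
    have e1 : -(-x - y) = x + y := by abel
    rw [hFF, fourier_dilate, norm_mul, norm_smul, Real.norm_of_nonneg (by positivity), e1]
    have h1 := hM (ε • y)
    rw [norm_smul, Real.norm_of_nonneg hε.le] at h1
    have h2 : 1 + ‖x‖ ≤ (1 + ‖x + y‖) * (1 + ‖y‖) := by
      have := norm_sub_le (x + y) y
      rw [add_sub_cancel_right] at this
      nlinarith [norm_nonneg (x + y), norm_nonneg y]
    have h3 : ε * (1 + ‖y‖) ≤ 1 + ε * ‖y‖ := by nlinarith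
    calc _ ≤ ε ^ 2 * ‖𝓕 b (ε • y)‖ * ‖G (x + y)‖ * ((1 + ‖x + y‖) * (1 + ‖y‖)) := by gcongr
      _ = ε * (1 + ‖y‖) * ‖𝓕 b (ε • y)‖ * ε * ((1 + ‖x + y‖) * ‖G (x + y)‖) := by ring
      _ ≤ (1 + ε * ‖y‖) * ‖𝓕 b (ε • y)‖ * ε * ((1 + ‖x + y‖) * ‖G (x + y)‖) := by gcongr
      _ ≤ _ := by gcongr
  have hi : Integrable (fun y => (1 + ‖x + y‖) * ‖G (x + y)‖) := hGi.comp_add_left x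
  calc _ ≤ (∫ y, M * ε * (1 + ‖x‖)⁻¹ * ((1 + ‖x + y‖) * ‖G (x + y)‖)) * (1 + ‖x‖) := by
        gcongr
        refine norm_integral_le_of_norm_le (hi.const_mul _) (.of_forall fun y => ?_)
        have := hbound y
        rw [← le_div_iff₀ (by positivity)] at this
        refine this.trans (le_of_eq ?_)
        ring
    _ = _ := by
        rw [integral_const_mul, integral_add_left_eq_self (fun y => (1 + ‖y‖) * ‖G y‖) x]
        field_simp

/-- The bump equals 1 near the origin, so `1 - dilate β` vanishes where `|ζ| ^ θ` fails to be
smooth. -/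
theorem exists_highPass {F : 𝓢(Plane, ℂ)} (hF : HasCompactSupport F) (β : ContDiffBump (0 : Plane))
    {ε : ℝ} (hε : 0 < ε) (θ : ℝ) : ∃ Q : 𝓢(Plane, ℂ), ∀ ζ, Q ζ =
      ((‖(2 * Real.pi) • ζ‖ ^ θ : ℝ) : ℂ) * ((1 - dilate (bumpSchwartz β) hε ζ) * F ζ) := by
  have hcs : HasCompactSupport fun ζ =>
      ((‖(2 * Real.pi) • ζ‖ ^ θ : ℝ) : ℂ) * ((1 - dilate (bumpSchwartz β) hε ζ) * F ζ) :=
    HasCompactSupport.mul_left (HasCompactSupport.mul_left hF)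
  have hsm : ContDiff ℝ ((⊤ : ℕ∞) : WithTop ℕ∞) fun ζ =>
      ((‖(2 * Real.pi) • ζ‖ ^ θ : ℝ) : ℂ) * ((1 - dilate (bumpSchwartz β) hε ζ) * F ζ) := by
    rw [contDiff_iff_contDiffAt]
    intro ζ
    by_cases hζ : ζ = 0
    · have hev : (fun ζ => ((‖(2 * Real.pi) • ζ‖ ^ θ : ℝ) : ℂ) *
          ((1 - dilate (bumpSchwartz β) hε ζ) * F ζ)) =ᶠ[nhds ζ] fun _ => 0 := by
        have ht : Filter.Tendsto (fun ζ : Plane => ε⁻¹ • ζ) (nhds ζ) (nhds 0) := by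
          rw [hζ]
          exact (by fun_prop : Continuous fun ζ : Plane => ε⁻¹ • ζ).tendsto' 0 0 (smul_zero _)
        filter_upwards [ht.eventually β.eventuallyEq_one] with η hη
        rw [dilate_apply, bumpSchwartz_apply, hη]
        simp
      exact contDiffAt_const.congr_of_eventuallyEq hev
    · have h0 : (2 * Real.pi) • ζ ≠ 0 := smul_ne_zero Real.two_pi_pos.ne' hζ
      have h1 : ContDiffAt ℝ ((⊤ : ℕ∞) : WithTop ℕ∞) (fun ζ : Plane => ‖(2 * Real.pi) • ζ‖ ^ θ) ζ := by
        refine ContDiffAt.rpow_const_of_ne ?_ (norm_ne_zero_iff.2 h0)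
        exact (contDiffAt_norm ℝ h0).comp ζ (contDiffAt_id.const_smul (2 * Real.pi))
      have h2 : ContDiffAt ℝ ((⊤ : ℕ∞) : WithTop ℕ∞)
          (fun ζ : Plane => ((‖(2 * Real.pi) • ζ‖ ^ θ : ℝ) : ℂ)) ζ :=
        Complex.ofRealCLM.contDiff.contDiffAt.comp ζ h1
      exact h2.mul ((contDiffAt_const.sub ((dilate (bumpSchwartz β) hε).smooth ⊤).contDiffAt).mul
        (F.smooth ⊤).contDiffAt)
  exact ⟨hcs.toSchwartzMap hsm, fun ζ => rfl⟩

/-- Polar coordinates on the Fourier side turn a function into an average of plane waves, whose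
profiles are integrals of a fixed function over lines. -/
theorem fourierInv_eq_integral_lineIntegral {Q₀ Q₁ : 𝓢(Plane, ℂ)}
    (h : ∀ ζ, Q₁ ζ = ((‖(2 * Real.pi) • ζ‖ : ℝ) : ℂ) * Q₀ ζ) (x : Plane) :
    ((4 * Real.pi : ℝ) : ℂ) * 𝓕⁻ (Q₀ : Plane → ℂ) x =
      ∫ ω : UnitCircle, lineIntegral (𝓕⁻ Q₁ : 𝓢(Plane, ℂ)) ω (inner ℝ (perp (ω : Plane)) x) ∂surf := by
  have hi : Integrable fun ζ => Real.fourierChar (inner ℝ ζ x) • Q₀ ζ := by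
    have := (Real.fourierIntegral_convergent_iff (-x)).2 (Q₀.integrable (μ := volume))
    simpa using this
  have hp := integral_polar_line _ hi
  rw [Real.fourierInv_eq]
  -- One factor 2 comes from signed polar coordinates covering the plane twice; `2 * π` converts
  -- `|t|` to angular frequency.
  have e : ((4 * Real.pi : ℝ) : ℂ) * ∫ ζ, Real.fourierChar (inner ℝ ζ x) • Q₀ ζ =
      ((2 * Real.pi : ℝ) : ℂ) * (2 * ∫ ζ, Real.fourierChar (inner ℝ ζ x) • Q₀ ζ) := by
    push_cast; ring
  rw [e, ← hp, ← integral_const_mul]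
  refine integral_congr_ae (.of_forall fun ω => ?_)
  simp only
  rw [lineIntegral_eq_fourierInv, FourierTransform.fourier_fourierInv_eq, Real.fourierInv_eq,
    ← integral_const_mul]
  refine integral_congr_ae (.of_forall fun t => ?_)
  simp only
  rw [restrictLine_apply, h, smul_smul, norm_smul, norm_perp_coe, inner_smul_left, Real.norm_eq_abs,
    abs_mul, abs_of_pos Real.two_pi_pos]
  simp only [Circle.smul_def, smul_eq_mul, RCLike.conj_to_real, RCLike.inner_apply]
  push_cast
  ring_nf

theorem IsWeight.aestronglyMeasurable {w : Plane → ℝ} (hw : IsWeight w) : AEStronglyMeasurable w := by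
  have h : AEStronglyMeasurable (fun x : Plane => w x / (1 + ‖x‖) * (1 + ‖x‖)) :=
    hw.integrable.1.mul (by fun_prop : Continuous fun x : Plane => 1 + ‖x‖).aestronglyMeasurable
  refine h.congr (.of_forall fun x => ?_)
  simp only
  rw [div_mul_cancel₀ _ (by positivity)]

theorem IsWeight.integrable_mul {w : Plane → ℝ} (hw : IsWeight w) {f : Plane → ℂ}
    (hf : AEStronglyMeasurable f) {C : ℝ} (hC : ∀ x, ‖f x‖ ≤ C * (1 + ‖x‖)⁻¹) :
    Integrable (fun x => (w x : ℂ) * f x) := by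
  refine (hw.integrable.const_mul C).mono' ?_ (.of_forall fun x => ?_)
  · exact (Complex.continuous_ofReal.comp_aestronglyMeasurable hw.aestronglyMeasurable).mul hf
  · rw [norm_mul, Complex.norm_real, Real.norm_of_nonneg (hw.nonneg x)]
    calc _ ≤ w x * (C * (1 + ‖x‖)⁻¹) := by
          have := hw.nonneg x
          gcongr
          exact hC x
      _ = _ := by rw [div_eq_mul_inv]; ring

/-- Justifies Fubini's theorem between `x` and `ω`. The profiles decay quadratically, and the
average of such a plane wave over `ω` is `O((1 + |x|)⁻¹)`. -/
theorem IsWeight.integrable_prod {w : Plane → ℝ} (hw : IsWeight w) (k : 𝓢(Plane, ℂ)) :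
    Integrable (fun q : Plane × UnitCircle =>
      (w q.1 : ℂ) * lineIntegral k q.2 (inner ℝ (perp (q.2 : Plane)) q.1)) (volume.prod surf) := by
  have hpc := continuous_perp
  have hk : Continuous fun q : Plane × UnitCircle =>
      lineIntegral k q.2 (inner ℝ (perp (q.2 : Plane)) q.1) :=
    (continuous_uncurry_lineIntegral k).comp
      (by fun_prop : Continuous fun q : Plane × UnitCircle => (q.2, inner ℝ (perp (q.2 : Plane)) q.1))
  have hm : AEStronglyMeasurable (fun q : Plane × UnitCircle =>
      (w q.1 : ℂ) * lineIntegral k q.2 (inner ℝ (perp (q.2 : Plane)) q.1)) (volume.prod surf) :=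
    (Complex.continuous_ofReal.comp_aestronglyMeasurable hw.aestronglyMeasurable).comp_fst.mul
      hk.aestronglyMeasurable
  obtain ⟨C, hC, hCk⟩ := exists_norm_lineIntegral_le k
  obtain ⟨D, hD⟩ := exists_lintegral_inv_one_add_sq_inner_le
  refine ⟨hm, ?_⟩
  rw [HasFiniteIntegral, lintegral_prod _ hm.enorm]
  have hb : ∀ x : Plane, ∫⁻ ω : UnitCircle,
      ‖(w x : ℂ) * lineIntegral k ω (inner ℝ (perp (ω : Plane)) x)‖ₑ ∂surf ≤
      ENNReal.ofReal C * D * ‖w x / (1 + ‖x‖)‖ₑ := by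
    intro x
    calc _ ≤ ∫⁻ ω : UnitCircle, ‖w x‖ₑ * ENNReal.ofReal C *
          ENNReal.ofReal ((1 + (inner ℝ (perp (ω : Plane)) x) ^ 2)⁻¹) ∂surf := by
          refine lintegral_mono fun ω => ?_
          rw [enorm_mul, mul_assoc, ← ENNReal.ofReal_mul hC, ← ofReal_norm (lineIntegral _ _ _),
            ← ofReal_norm (w x : ℂ), Complex.norm_real, ofReal_norm]
          gcongr
          exact hCk _ _
      _ ≤ ‖w x‖ₑ * ENNReal.ofReal C * (D * ENNReal.ofReal ((1 + ‖x‖)⁻¹)) := by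
          rw [lintegral_const_mul' _ _ (by finiteness)]
          gcongr
          exact hD x
      _ = _ := by
          rw [div_eq_mul_inv, enorm_mul, Real.enorm_of_nonneg (by positivity : (0 : ℝ) ≤ (1 + ‖x‖)⁻¹)]
          ring
  refine (lintegral_mono hb).trans_lt ?_
  rw [lintegral_const_mul' _ _ (by finiteness)]
  exact ENNReal.mul_lt_top (by finiteness) hw.integrable.2

/-- Integration of a weight against a plane wave is an integral of its X-ray transform. -/
theorem integral_mul_planeWave {w : Plane → ℝ} {ω : UnitCircle} {f : ℝ → ℂ}
    (h : Integrable fun x => (w x : ℂ) * f (inner ℝ (perp (ω : Plane)) x)) :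
    ∫ x, (w x : ℂ) * f (inner ℝ (perp (ω : Plane)) x) = ∫ v, (xray w ω v : ℂ) * f v := by
  rw [integral_lineCoords ω _ h]
  refine integral_congr_ae (.of_forall fun v => ?_)
  have hin : ∀ s : ℝ, inner ℝ (perp (ω : Plane)) (v • perp (ω : Plane) + s • (ω : Plane)) = v := by
    intro s
    have := inner_lineCoords_perp ω v s 1
    rwa [one_smul, mul_one, real_inner_comm] at this
  simp only [hin]
  rw [integral_mul_const, coe_xray, lineIntegral]

theorem enorm_integral_ofReal_mul_le {q p : ℝ≥0∞} (hqp : q.HolderConjugate p) {h : ℝ → ℝ}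
    (hm : AEStronglyMeasurable h) {φ : ℝ → ℂ} (hφ : AEStronglyMeasurable φ) :
    ‖∫ v, (h v : ℂ) * φ v‖ₑ ≤ eLpNorm h q * eLpNorm φ p := by
  have hc : AEStronglyMeasurable (fun v => (h v : ℂ)) :=
    Complex.continuous_ofReal.comp_aestronglyMeasurable hm
  have hh : eLpNorm (fun v => (h v : ℂ)) q = eLpNorm h q :=
    eLpNorm_congr_norm_ae (.of_forall fun v => Complex.norm_real _)
  have hH : ‖∫ v, (h v : ℂ) * φ v‖ₑ ≤ eLpNorm (fun v => (h v : ℂ) * φ v) 1 := by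
    rw [eLpNorm_one_eq_lintegral_enorm]
    exact enorm_integral_le_lintegral_enorm _
  have : ENNReal.HolderTriple q p 1 := hqp
  have hmul := eLpNorm_smul_le_mul_eLpNorm (p := q) (q := p) (r := 1) hφ hc
  rw [hh] at hmul
  exact hH.trans hmul

/-- Hölder's inequality applied to every admissible `h`, followed by the infimum. Finiteness of the
norm guarantees that at least one such `h` exists. -/
theorem enorm_integral_mul_fracLapSchwartz_le {s : ℝ} {q p : ℝ≥0∞} (hqp : q.HolderConjugate p)
    {u : ℝ → ℝ} (hu : fracLapNorm s q u ≠ ∞) (φ : 𝓢(ℝ, ℂ)) :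
    ‖∫ v, (u v : ℂ) * fracLapSchwartz s φ v‖ₑ ≤ fracLapNorm s q u * eLpNorm φ p := by
  have key : ∀ h : ℝ → ℝ, MemLp h q ∧ IsFracLap s u h →
      ‖∫ v, (u v : ℂ) * fracLapSchwartz s φ v‖ₑ ≤ eLpNorm h q * eLpNorm φ p := by
    rintro h ⟨hm, hf⟩
    rw [hf.pairing φ]
    exact enorm_integral_ofReal_mul_le hqp hm.1 φ.continuous.aestronglyMeasurable
  obtain ⟨h₀, hh₀⟩ : ∃ h, MemLp h q ∧ IsFracLap s u h := by
    by_contra hcon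
    push Not at hcon
    exact hu (iInf₂_eq_top.2 fun h hh => absurd hh.2 (hcon h hh.1))
  have hE : eLpNorm φ p volume ≠ ∞ := (SchwartzMap.eLpNorm_lt_top φ p volume).ne
  generalize eLpNorm φ p = E at key hE
  generalize ‖∫ v, (u v : ℂ) * fracLapSchwartz s φ v‖ₑ = a at key
  by_cases h0 : E = 0
  · simpa [h0] using key h₀ hh₀
  · rw [← ENNReal.div_le_iff h0 hE]
    exact le_iInf₂ fun h hh => (ENNReal.div_le_iff h0 hE).2 (key h hh)

theorem norm_two_pi_smul_perp (ω : UnitCircle) (η : ℝ) :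
    ‖(2 * Real.pi) • η • perp (ω : Plane)‖ = |2 * Real.pi * η| := by
  rw [smul_smul, norm_smul, norm_perp_coe, mul_one, Real.norm_eq_abs]

/-- The symbol `|η|` factors as `|η| ^ (2 s) * |η| ^ (1/p)`. The first factor is moved onto `Xw`
through a test function `φ`, and the `L^p` norm of `φ`, which carries the second factor, is bounded
band by band. -/
theorem enorm_integral_xray_mul_lineIntegral_le {F Q₀ Qθ Q₁ : 𝓢(Plane, ℂ)}
    (hF : ∀ ζ : Plane, 5 < ‖(2 * Real.pi) • ζ‖ → F ζ = 0) (h₀ : ∀ ζ, ‖Q₀ ζ‖ ≤ ‖F ζ‖)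
    {q p : ℝ≥0∞} (hqp : q.HolderConjugate p) (hp : 2 ≤ p) {s : ℝ} (hs : 0 ≤ s)
    (hsp : 2 * s + p.toReal⁻¹ = 1)
    (hθ : ∀ ζ, Qθ ζ = ((‖(2 * Real.pi) • ζ‖ ^ p.toReal⁻¹ : ℝ) : ℂ) * Q₀ ζ)
    (h₁ : ∀ ζ, Q₁ ζ = ((‖(2 * Real.pi) • ζ‖ : ℝ) : ℂ) * Q₀ ζ) {w : Plane → ℝ} {ω : UnitCircle}
    (hw : fracLapNorm s q (xray w ω) ≠ ∞) (K : ℕ) :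
    ‖∫ v, (xray w ω v : ℂ) * lineIntegral (𝓕⁻ Q₁ : 𝓢(Plane, ℂ)) ω v‖ₑ ≤
      fracLapNorm s q (xray w ω) * ((3 : ℝ≥0) *
        besovNorm K (fun t => ‖F ((2 * Real.pi)⁻¹ • t • perp (ω : Plane))‖ₑ ^ 2)) := by
  set φ : 𝓢(ℝ, ℂ) := 𝓕⁻ (restrictLine ω Qθ)
  have hφ : fracLapSchwartz s φ = lineIntegral (𝓕⁻ Q₁ : 𝓢(Plane, ℂ)) ω := by
    rw [fracLapSchwartz_eq, lineIntegral_eq_fourierInv, FourierTransform.fourier_fourierInv_eq,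
      FourierTransform.fourier_fourierInv_eq]
    congr 1
    ext η
    rw [symbolMul, restrictLine_apply, restrictLine_apply, hθ, h₁, norm_two_pi_smul_perp, ← mul_assoc,
      ← Complex.ofReal_mul, ← Real.rpow_add_of_nonneg (abs_nonneg _) (by positivity) (by positivity),
      hsp, Real.rpow_one]
  have hφ' : (φ : ℝ → ℂ) = 𝓕⁻ (symbolMul p.toReal⁻¹ (restrictLine ω Q₀)) := by
    rw [SchwartzMap.fourierInv_coe]
    congr 1
    ext η
    rw [symbolMul, restrictLine_apply, restrictLine_apply, hθ, norm_two_pi_smul_perp]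
  rw [← hφ]
  refine (enorm_integral_mul_fracLapSchwartz_le hqp hw φ).trans (mul_le_mul_right ?_ _)
  rw [hφ']
  have hQ5 : ∀ η, 5 < |2 * Real.pi * η| → restrictLine ω Q₀ η = 0 := by
    intro η hη
    have := h₀ (η • perp (ω : Plane))
    rw [hF _ (by rwa [norm_two_pi_smul_perp]), norm_zero] at this
    exact norm_le_zero_iff.1 this
  refine (eLpNorm_fourierInv_symbolMul_le (restrictLine ω Q₀).continuous hQ5 hp K).trans
    (mul_le_mul_right (besovNorm_mono fun t => ?_) _)
  rw [restrictLine_apply, mul_smul, ← ofReal_norm, ← ofReal_norm]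
  gcongr
  exact h₀ _

/-- After the high-pass cut all symbols are Schwartz, so the decomposition into plane waves and
Fubini's theorem are legitimate. The supremum over `ω` is then taken out of the `ω`-integral. -/
theorem enorm_integral_weight_highPass_le {F Q₀ Qθ Q₁ : 𝓢(Plane, ℂ)}
    (hF : ∀ ζ : Plane, 5 < ‖(2 * Real.pi) • ζ‖ → F ζ = 0) (h₀ : ∀ ζ, ‖Q₀ ζ‖ ≤ ‖F ζ‖)
    {q p : ℝ≥0∞} (hqp : q.HolderConjugate p) (hp : 2 ≤ p) {s : ℝ} (hs : 0 ≤ s)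
    (hsp : 2 * s + p.toReal⁻¹ = 1)
    (hθ : ∀ ζ, Qθ ζ = ((‖(2 * Real.pi) • ζ‖ ^ p.toReal⁻¹ : ℝ) : ℂ) * Q₀ ζ)
    (h₁ : ∀ ζ, Q₁ ζ = ((‖(2 * Real.pi) • ζ‖ : ℝ) : ℂ) * Q₀ ζ) {w : Plane → ℝ} (hw : IsWeight w)
    (hT : xrayNormTop s q w ≠ ∞) (K : ℕ) :
    ‖∫ x, (w x : ℂ) * 𝓕⁻ (Q₀ : Plane → ℂ) x‖ₑ ≤ xrayNormTop s q w * ((3 : ℝ≥0) *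
      ∫⁻ ω : UnitCircle, besovNorm K
        (fun t => ‖F ((2 * Real.pi)⁻¹ • t • perp (ω : Plane))‖ₑ ^ 2) ∂surf) := by
  set k : 𝓢(Plane, ℂ) := 𝓕⁻ Q₁
  have hi := hw.integrable_prod k
  have h4 : ((4 * Real.pi : ℝ) : ℂ) * ∫ x, (w x : ℂ) * 𝓕⁻ (Q₀ : Plane → ℂ) x =
      ∫ ω : UnitCircle, (∫ x, (w x : ℂ) * lineIntegral k ω (inner ℝ (perp (ω : Plane)) x)) ∂surf := by
    rw [← integral_integral_swap hi, ← integral_const_mul]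
    refine integral_congr_ae (.of_forall fun x => ?_)
    simp only
    rw [integral_const_mul, ← fourierInv_eq_integral_lineIntegral h₁]
    ring
  calc _ ≤ ‖((4 * Real.pi : ℝ) : ℂ) * ∫ x, (w x : ℂ) * 𝓕⁻ (Q₀ : Plane → ℂ) x‖ₑ := by
        rw [enorm_mul]
        refine le_mul_of_one_le_left (by positivity) ?_
        rw [← ofReal_norm, Complex.norm_real, Real.norm_of_nonneg (by positivity),
          ← ENNReal.ofReal_one]
        exact ENNReal.ofReal_le_ofReal (by linarith [Real.pi_gt_three])
    _ ≤ ∫⁻ ω : UnitCircle, ‖∫ x, (w x : ℂ) * lineIntegral k ω (inner ℝ (perp (ω : Plane)) x)‖ₑ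
          ∂surf := by
        rw [h4]
        exact enorm_integral_le_lintegral_enorm _
    _ ≤ ∫⁻ ω : UnitCircle, xrayNormTop s q w * ((3 : ℝ≥0) * besovNorm K
          (fun t => ‖F ((2 * Real.pi)⁻¹ • t • perp (ω : Plane))‖ₑ ^ 2)) ∂surf := by
        refine lintegral_mono_ae ?_
        filter_upwards [hi.prod_left_ae,
          ENNReal.ae_le_essSup fun ω : UnitCircle => fracLapNorm s q (xray w ω)] with ω hω hle
        rw [integral_mul_planeWave hω]
        refine (enorm_integral_xray_mul_lineIntegral_le hF h₀ hqp hp hs hsp hθ h₁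
          (ne_top_of_le_ne_top hT hle) K).trans ?_
        gcongr
        exact hle
    _ = _ := by
        rw [lintegral_const_mul' _ _ hT, lintegral_const_mul' _ _ ENNReal.coe_ne_top]

theorem hasCompactSupport_of_angular {F : 𝓢(Plane, ℂ)} {r : ℝ}
    (hF : ∀ ζ : Plane, r < ‖(2 * Real.pi) • ζ‖ → F ζ = 0) : HasCompactSupport F := by
  refine HasCompactSupport.intro (isCompact_closedBall (0 : Plane) (r / (2 * Real.pi))) fun ζ hζ => hF ζ ?_
  rw [mem_closedBall_zero_iff, not_le, div_lt_iff₀ Real.two_pi_pos] at hζ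
  rwa [norm_smul, Real.norm_of_nonneg Real.two_pi_pos.le, mul_comm]

theorem IsWeight.integrable_mul_schwartz {w : Plane → ℝ} (hw : IsWeight w) (G : 𝓢(Plane, ℂ)) :
    Integrable fun x => (w x : ℂ) * G x := by
  refine hw.integrable_mul G.continuous.aestronglyMeasurable
    (C := 2 ^ 1 * (Finset.Iic (1, 0)).sup (fun m => SchwartzMap.seminorm ℝ m.1 m.2) G) fun x => ?_
  have h := SchwartzMap.one_add_le_sup_seminorm_apply (𝕜 := ℝ) (m := (1, 0)) le_rfl le_rfl G x
  rw [norm_iteratedFDeriv_zero, pow_one] at h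
  rw [← div_eq_mul_inv, le_div_iff₀ (by positivity), mul_comm]
  exact h

/-- The function `G` is split into a high-pass and a low-pass part at scale `ε`. The bound for the
first is independent of `ε`, and the second contributes at most `C * ε * ∫ w / (1 + |x|)`, which is
made smaller than any `δ`. -/
theorem enorm_integral_weight_mul_le {G : 𝓢(Plane, ℂ)}
    (hG : ∀ ζ : Plane, 5 < ‖(2 * Real.pi) • ζ‖ → 𝓕 G ζ = 0)
    {q p : ℝ≥0∞} (hqp : q.HolderConjugate p) (hp : 2 ≤ p) {s : ℝ} (hs : 0 ≤ s)
    (hsp : 2 * s + p.toReal⁻¹ = 1) {w : Plane → ℝ} (hw : IsWeight w)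
    (hT : xrayNormTop s q w ≠ ∞) (K : ℕ) :
    ‖∫ x, (w x : ℂ) * G x‖ₑ ≤ xrayNormTop s q w * ((3 : ℝ≥0) *
      ∫⁻ ω : UnitCircle, besovNorm K
        (fun t => ‖𝓕 G ((2 * Real.pi)⁻¹ • t • perp (ω : Plane))‖ₑ ^ 2) ∂surf) := by
  have hcs := hasCompactSupport_of_angular hG
  set β : ContDiffBump (0 : Plane) := ⟨1, 2, by norm_num, by norm_num⟩
  obtain ⟨C, hC, hCb⟩ := norm_fourierInv_dilate_mul_le (bumpSchwartz β) G
  set M := ∫ x, w x / (1 + ‖x‖)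
  have hM : 0 ≤ M := integral_nonneg fun x => div_nonneg (hw.nonneg x) (by positivity)
  refine ENNReal.le_of_forall_pos_le_add fun δ hδ _ => ?_
  obtain ⟨ε, hε, hε1, hεδ⟩ : ∃ ε : ℝ, 0 < ε ∧ ε ≤ 1 ∧ C * ε * M ≤ δ := by
    have hδ' : (0 : ℝ) < δ := hδ
    have hCM : 0 ≤ C * M := mul_nonneg hC hM
    refine ⟨min 1 (δ / (C * M + 1)), by positivity, min_le_left _ _, ?_⟩
    calc C * min 1 (δ / (C * M + 1)) * M = C * M * min 1 (δ / (C * M + 1)) := by ring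
      _ ≤ (C * M + 1) * (δ / (C * M + 1)) := by
        gcongr
        · linarith
        · exact min_le_right _ _
      _ = δ := by field_simp
  obtain ⟨Q₀, hQ₀⟩ := exists_highPass hcs β hε 0
  obtain ⟨Qθ, hQθ⟩ := exists_highPass hcs β hε p.toReal⁻¹
  obtain ⟨Q₁, hQ₁⟩ := exists_highPass hcs β hε 1
  simp only [Real.rpow_zero, Complex.ofReal_one, one_mul] at hQ₀
  have hmain := enorm_integral_weight_highPass_le (Q₀ := Q₀) hG (fun ζ => ?_) hqp hp hs hsp
    (fun ζ => by rw [hQθ, hQ₀]) (fun ζ => by rw [hQ₁, hQ₀, Real.rpow_one]) hw hT K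
  swap
  · rw [hQ₀, norm_mul, dilate_apply, bumpSchwartz_apply, ← Complex.ofReal_one, ← Complex.ofReal_sub,
      Complex.norm_real, Real.norm_of_nonneg (sub_nonneg.2 β.le_one)]
    -- The cut only decreases the modulus, which is why the estimate does not depend on `ε`.
    exact mul_le_of_le_one_left (norm_nonneg _) (by linarith [β.nonneg (x := ε⁻¹ • ζ)])
  set E : 𝓢(Plane, ℂ) := schwartzMul (dilate (bumpSchwartz β) hε) (𝓕 G)
  have hE : ∀ x, ‖𝓕⁻ (E : Plane → ℂ) x‖ ≤ C * ε * (1 + ‖x‖)⁻¹ := hCb ε hε hε1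
  have hsplit : ∀ x, G x = 𝓕⁻ (Q₀ : Plane → ℂ) x + 𝓕⁻ (E : Plane → ℂ) x := by
    intro x
    have h1 : 𝓕 G = Q₀ + E := by
      ext ζ
      rw [add_apply, hQ₀, schwartzMul_apply]
      ring
    have h2 : G = 𝓕⁻ Q₀ + 𝓕⁻ E := by
      rw [← FourierTransform.fourierInv_add, ← h1, FourierTransform.fourierInv_fourier_eq]
    rw [h2, add_apply, SchwartzMap.fourierInv_coe, SchwartzMap.fourierInv_coe]
  have hEi : Integrable fun x => (w x : ℂ) * 𝓕⁻ (E : Plane → ℂ) x :=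
    hw.integrable_mul (continuous_fourierInv E.integrable).aestronglyMeasurable hE
  have hGi : Integrable fun x => (w x : ℂ) * G x := hw.integrable_mul_schwartz G
  have hsum : ∫ x, (w x : ℂ) * G x = (∫ x, (w x : ℂ) * 𝓕⁻ (Q₀ : Plane → ℂ) x) +
      ∫ x, (w x : ℂ) * 𝓕⁻ (E : Plane → ℂ) x := by
    have hQi : Integrable fun x => (w x : ℂ) * 𝓕⁻ (Q₀ : Plane → ℂ) x := by
      refine (hGi.sub hEi).congr (.of_forall fun x => ?_)
      simp only [Pi.sub_apply]
      rw [hsplit]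
      ring
    rw [← integral_add hQi hEi]
    refine integral_congr_ae (.of_forall fun x => ?_)
    simp only
    rw [hsplit]
    ring
  rw [hsum]
  refine (enorm_add_le _ _).trans (add_le_add hmain ?_)
  have hEn : ‖∫ x, (w x : ℂ) * 𝓕⁻ (E : Plane → ℂ) x‖ ≤ δ := by
    refine le_trans (norm_integral_le_of_norm_le (hw.integrable.const_mul (C * ε))
      (.of_forall fun x => ?_)) ((integral_const_mul _ _).trans_le hεδ)
    rw [norm_mul, Complex.norm_real, Real.norm_of_nonneg (hw.nonneg x)]
    calc _ ≤ w x * (C * ε * (1 + ‖x‖)⁻¹) := by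
          have := hw.nonneg x
          gcongr
          exact hE x
      _ = _ := by rw [div_eq_mul_inv]; ring
  rw [← ofReal_norm]
  exact (ENNReal.ofReal_le_ofReal hEn).trans_eq (ENNReal.ofReal_coe_nnreal)

theorem BandLimited.lintegral_weight_mul_le {γ : 𝓢(Plane, ℂ)} (hγ : BandLimited γ) {f : Plane → ℝ}
    (hγf : ∀ x, γ x = (f x : ℂ)) (hf : ∀ x, 0 ≤ f x) : ∃ C : ℝ≥0, ∀ (q p : ℝ≥0∞) (s : ℝ),
    q.HolderConjugate p → 2 ≤ p → 0 ≤ s → 2 * s + p.toReal⁻¹ = 1 → ∀ R : ℝ, 1 ≤ R →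
    ∀ g : UnitCircle → ℂ, MemLp g 2 surf → ∀ w : Plane → ℝ, IsWeight w → xrayNormTop s q w ≠ ∞ →
      ∫⁻ x, ENNReal.ofReal (w x * (f (R⁻¹ • x) * ‖extension g x‖ ^ 2)) ≤
        C * ENNReal.ofReal (1 + Real.log R) * xrayNormTop s q w * eLpNorm g 2 surf ^ 2 := by
  obtain ⟨C, hC⟩ := hγ.exists_besovNorm_le
  refine ⟨3 * C, fun q p s hqp hp hs hsp R hR g hg w hw hT => ?_⟩
  obtain ⟨K, hK⟩ := hC R hR
  have hgi : Integrable g surf := hg.integrable (by norm_num)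
  set G := truncSchwartz (dilate γ (one_pos.trans_le hR)) g
  have hGx : ∀ x, G x = ((f (R⁻¹ • x) * ‖extension g x‖ ^ 2 : ℝ) : ℂ) := by
    intro x
    rw [truncSchwartz_apply hgi, dilate_apply, hγf, Complex.ofReal_mul]
  have hG5 : ∀ ζ : Plane, 5 < ‖(2 * Real.pi) • ζ‖ → 𝓕 G ζ = 0 := fun ζ hζ =>
    fourier_truncSchwartz_eq_zero hgi (hγ.fourier_dilate_eq_zero hR) ζ (by linarith)
  have hmain := enorm_integral_weight_mul_le hG5 hqp hp hs hsp hw hT K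
  have hle : ‖∫ x, (w x : ℂ) * G x‖ₑ ≤ xrayNormTop s q w * ((3 : ℝ≥0) *
      (C * ENNReal.ofReal (1 + Real.log R) * eLpNorm g 2 surf ^ 2)) := by
    refine hmain.trans ?_
    gcongr
    exact hK g hg
  have hnn : ∀ x, 0 ≤ w x * (f (R⁻¹ • x) * ‖extension g x‖ ^ 2) := fun x =>
    mul_nonneg (hw.nonneg x) (mul_nonneg (hf _) (sq_nonneg _))
  have hint : ∀ x, (w x : ℂ) * G x = ((w x * (f (R⁻¹ • x) * ‖extension g x‖ ^ 2) : ℝ) : ℂ) := by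
    intro x
    rw [hGx, ← Complex.ofReal_mul]
  have hGi : Integrable fun x => (w x : ℂ) * G x := hw.integrable_mul_schwartz G
  have hGr : Integrable fun x => w x * (f (R⁻¹ • x) * ‖extension g x‖ ^ 2) := by
    have := hGi.re
    simpa only [hint, RCLike.re_to_complex, Complex.ofReal_re] using this
  rw [← ofReal_integral_eq_lintegral_ofReal hGr (.of_forall hnn)]
  simp only [hint] at hle
  rw [integral_complex_ofReal, ← ofReal_norm, Complex.norm_real,
    Real.norm_of_nonneg (integral_nonneg hnn)] at hle
  refine hle.trans (le_of_eq ?_)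
  push_cast
  ring

theorem weightedMass_le : ∃ C : ℝ≥0, ∀ (q p : ℝ≥0∞) (s : ℝ), q.HolderConjugate p → 2 ≤ p → 0 ≤ s →
    2 * s + p.toReal⁻¹ = 1 → ∀ R : ℝ, 1 ≤ R → ∀ g : UnitCircle → ℂ, MemLp g 2 surf →
    ∀ w : Plane → ℝ, IsWeight w → weightedMass R g w ≤
      C * ENNReal.ofReal (1 + Real.log R) * xrayNormTop s q w * eLpNorm g 2 surf ^ 2 := by
  obtain ⟨γ, f, c, hγ, hγf, hf, hc, hfc⟩ := exists_bandLimited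
  obtain ⟨C, hC⟩ := hγ.lintegral_weight_mul_le hγf hf
  -- The added 1 keeps the constant nonzero, so that the right side is `∞` whenever the norm of the
  -- weight is infinite and `g` is not null.
  refine ⟨(c⁻¹).toNNReal * C + 1, fun q p s hqp hp hs hsp R hR g hg w hw => ?_⟩
  have hlog : 0 < 1 + Real.log R := by linarith [Real.log_nonneg hR]
  -- For null `g` the right side is `0` even if the norm of the weight is `∞`, so the left side must
  -- be shown to vanish.
  by_cases hg0 : eLpNorm g 2 surf = 0
  · have hz : g =ᵐ[surf] 0 := (eLpNorm_eq_zero_iff hg.1 (by norm_num)).1 hg0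
    have he : ∀ x, extension g x = 0 := by
      intro x
      rw [extension_congr hz, extension]
      simp
    simp [weightedMass, he]
  by_cases hT : xrayNormTop s q w = ∞
  · rw [hT, ENNReal.mul_top, ENNReal.top_mul]
    · exact le_top
    · exact pow_ne_zero _ hg0
    · refine mul_ne_zero ?_ (ENNReal.ofReal_pos.2 hlog).ne'
      simp
  have hmain := hC q p s hqp hp hs hsp R hR g hg w hw hT
  have hR0 : 0 < R := by linarith
  calc weightedMass R g w ≤ ∫⁻ x in Metric.ball (0 : Plane) R, ENNReal.ofReal c⁻¹ *
        ENNReal.ofReal (w x * (f (R⁻¹ • x) * ‖extension g x‖ ^ 2)) := by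
        refine setLIntegral_mono' Metric.isOpen_ball.measurableSet fun x hx => ?_
        rw [← ENNReal.ofReal_mul (by positivity)]
        refine ENNReal.ofReal_le_ofReal ?_
        have hx1 : ‖R⁻¹ • x‖ ≤ 1 := by
          rw [mem_ball_zero_iff] at hx
          rw [norm_smul, norm_inv, Real.norm_of_nonneg hR0.le, inv_mul_le_iff₀ hR0]
          linarith
        have h1 := hfc _ hx1
        have h2 : 1 ≤ c⁻¹ * f (R⁻¹ • x) := by rwa [le_inv_mul_iff₀ hc, mul_one]
        have h3 : 0 ≤ ‖extension g x‖ ^ 2 * w x := mul_nonneg (sq_nonneg _) (hw.nonneg x)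
        nlinarith
    _ ≤ ENNReal.ofReal c⁻¹ * (C * ENNReal.ofReal (1 + Real.log R) * xrayNormTop s q w *
          eLpNorm g 2 surf ^ 2) := by
        refine (setLIntegral_le_lintegral _ _).trans ?_
        rw [lintegral_const_mul' _ _ ENNReal.ofReal_ne_top]
        gcongr
    _ = ((c⁻¹).toNNReal * C : ℝ≥0) * ENNReal.ofReal (1 + Real.log R) * xrayNormTop s q w *
          eLpNorm g 2 surf ^ 2 := by
        rw [ENNReal.coe_mul, ← ENNReal.ofReal]
        ring
    _ ≤ _ := by
        gcongr
        exact le_self_add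

end MizohataTakeuchi

end

/-! ### The four estimates -/

theorem theorem1p7 :
    -- the reduced X-ray estimate for `1 ≤ q ≤ 2`, `n = 2`
    (∀ ψ : 𝓢(MizohataTakeuchi.Plane, ℝ), MizohataTakeuchi.IsProfile ψ →
      ∀ q : ℝ, 1 ≤ q → q ≤ 2 → ∀ ε : ℝ, 0 < ε →
        ∃ C : ℝ≥0, ∀ R : ℝ, 1 ≤ R →
          ∀ g : MizohataTakeuchi.UnitCircle → ℂ, MemLp g 2 MizohataTakeuchi.surf →
            MizohataTakeuchi.xrayNormOne (1 / 2 * (1 - 1 / q)) (ENNReal.ofReal q).conjExponent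
                (MizohataTakeuchi.truncatedSq ψ R g)
              ≤ C * ENNReal.ofReal (R ^ ε) * eLpNorm g 2 MizohataTakeuchi.surf ^ 2) ∧
    -- the local weighted inequality for `1 ≤ q ≤ 2`, `n = 2`
    (∀ q : ℝ, 1 ≤ q → q ≤ 2 → ∀ ε : ℝ, 0 < ε →
        ∃ C : ℝ≥0, ∀ R : ℝ, 1 ≤ R →
          ∀ g : MizohataTakeuchi.UnitCircle → ℂ, MemLp g 2 MizohataTakeuchi.surf →
            ∀ w : MizohataTakeuchi.Plane → ℝ, MizohataTakeuchi.IsWeight w →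
              MizohataTakeuchi.weightedMass R g w
                ≤ C * ENNReal.ofReal (R ^ ε)
                  * MizohataTakeuchi.xrayNormTop (1 / (2 * q)) (ENNReal.ofReal q) w
                  * eLpNorm g 2 MizohataTakeuchi.surf ^ 2) ∧
    -- the endpoint reduced estimate with logarithmic growth
    (∀ ψ : 𝓢(MizohataTakeuchi.Plane, ℝ), MizohataTakeuchi.IsProfile ψ →
        ∃ C : ℝ≥0, ∀ R : ℝ, 2 ≤ R →
          ∀ g : MizohataTakeuchi.UnitCircle → ℂ, MemLp g 2 MizohataTakeuchi.surf →
            MizohataTakeuchi.xrayNormOne (1 / 4) 2 (MizohataTakeuchi.truncatedSq ψ R g)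
              ≤ C * ENNReal.ofReal (Real.log R) * eLpNorm g 2 MizohataTakeuchi.surf ^ 2) ∧
    -- the endpoint weighted inequality with logarithmic growth
    (∃ C : ℝ≥0, ∀ R : ℝ, 2 ≤ R →
        ∀ g : MizohataTakeuchi.UnitCircle → ℂ, MemLp g 2 MizohataTakeuchi.surf →
          ∀ w : MizohataTakeuchi.Plane → ℝ, MizohataTakeuchi.IsWeight w →
            MizohataTakeuchi.weightedMass R g w
              ≤ C * ENNReal.ofReal (Real.log R)
                * MizohataTakeuchi.xrayNormTop (1 / 4) 2 w
                * eLpNorm g 2 MizohataTakeuchi.surf ^ 2) := by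
  refine ⟨fun ψ hψ q hq hq2 ε hε => ?_, fun q hq hq2 ε hε => ?_, fun ψ hψ => ?_, ?_⟩
  · obtain ⟨C, hC⟩ := MizohataTakeuchi.xrayNormOne_truncatedSq_le hψ
    obtain ⟨D, hD⟩ := MizohataTakeuchi.ofReal_one_add_log_le_rpow hε
    refine ⟨C * D, fun R hR g hg => ?_⟩
    have h := hC _ (MizohataTakeuchi.two_le_conjExponent hq2) R hR g hg
    rw [MizohataTakeuchi.toReal_conjExponent_inv hq] at h
    rw [one_div_mul_eq_div]
    refine h.trans ?_
    rw [ENNReal.coe_mul, mul_assoc (C : ℝ≥0∞) (D : ℝ≥0∞)]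
    gcongr
    exact hD R hR
  · obtain ⟨C, hC⟩ := MizohataTakeuchi.weightedMass_le
    obtain ⟨D, hD⟩ := MizohataTakeuchi.ofReal_one_add_log_le_rpow hε
    refine ⟨C * D, fun R hR g hg w hw => ?_⟩
    have hq0 : 0 < q := by linarith
    refine (hC (ENNReal.ofReal q) (ENNReal.ofReal q).conjExponent (1 / (2 * q))
      (.conjExponent (ENNReal.one_le_ofReal.2 hq)) (MizohataTakeuchi.two_le_conjExponent hq2) (by positivity) ?_
      R hR g hg w hw).trans ?_
    · rw [MizohataTakeuchi.toReal_conjExponent_inv hq]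
      field_simp
      ring
    · rw [ENNReal.coe_mul, mul_assoc (C : ℝ≥0∞) (D : ℝ≥0∞)]
      gcongr
      exact hD R hR
  · obtain ⟨C, hC⟩ := MizohataTakeuchi.xrayNormOne_truncatedSq_le hψ
    refine ⟨C * 3, fun R hR g hg => ?_⟩
    have h := hC 2 le_rfl R (by linarith) g hg
    have e : (2 : ℝ≥0∞).toReal⁻¹ / 2 = 1 / 4 := by norm_num
    rw [e] at h
    refine h.trans ?_
    rw [ENNReal.coe_mul, mul_assoc (C : ℝ≥0∞) ((3 : ℝ≥0) : ℝ≥0∞)]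
    gcongr
    exact MizohataTakeuchi.ofReal_one_add_log_le hR
  · obtain ⟨C, hC⟩ := MizohataTakeuchi.weightedMass_le
    refine ⟨C * 3, fun R hR g hg w hw => ?_⟩
    -- At `q = p = 2` the derivative is shared equally: `2 * (1 / 4) + 1 / 2 = 1`.
    refine (hC 2 2 (1 / 4) inferInstance le_rfl (by norm_num) (by norm_num) R (by linarith) g hg w
      hw).trans ?_
    rw [ENNReal.coe_mul, mul_assoc (C : ℝ≥0∞) ((3 : ℝ≥0) : ℝ≥0∞)]
    gcongr
    exact MizohataTakeuchi.ofReal_one_add_log_le hR
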